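/- **Setting.** Fix $T>0$, $\omega=2\pi/T$ and constants $r,L,C>0$. The averaged model of the three-phase AC/DC converter, with state $x=(i_a,i_b,i_c,v_{dc})$, control $d=(d_a,d_b,d_c)$ and exogenous input $v=(e_a,e_b,e_c,i_{dc})$, is $$\dot x=Ax+G(x)d+Bv,\qquad A=\begin{bmatrix}-\frac rL I_3&0\\0&0\end{bmatrix},\quad G(x)=\begin{bmatrix}-\frac{v_{dc}}{L}C_{33}\\ \frac1C i_{abc}^T\end{bmatrix},\quad B=\begin{bmatrix}-\frac1LI_3&0\\0&-\frac1C\end{bmatrix},$$ where $C_{33}=I_3-\frac13\mathbf 1\mathbf 1^T$. For a locally square integrable signal $x$, let $X=\mathcal F(x)$ be its sliding Fourier decomposition, $X_k(t)=\frac1T\int_{t-T}^t x(\tau)e^{-j\omega k\tau}d\tau$, $k\in\mathbb Z$. For a bounded matrix function $M$, let $\mathcal T(M)$ be the block Toeplitz operator on $\ell^2$ with $(k,l)$ block equal to the $(k-l)$-th phasor of $M$. Write $\mathcal A=\mathcal T(A)$, $\mathcal B=\mathcal T(B)$, $\mathcal G(X)=\mathcal T(G(x))$, and let $\mathcal N$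 multiply the $k$-th phasor by $j\omega k$. The harmonic model is $$\dot X=(\mathcal A-\mathcal N)X+\mathcal G(X)D+\mathcal BV .\qquad(1)$$ Let $x^e$ (continuous), $d^e$ (in $L^\infty$) and $v^e$ (in $L^2([0,T])$) be real and $T$-periodic, and suppose that their harmonics $(X^e,D^e,V^e)$ form an equilibrium: $0=(\mathcal A-\mathcal N)X^e+\mathcal G(X^e)D^e+\mathcal BV^e$. Put $\mathcal A(\mathcal D^e)=\mathcal T(A(d^e))$ with $A(d)=\begin{bmatrix}0&-\frac1LC_{33}d\\ \frac1Cd^T&0\end{bmatrix}$, so that $A(d)x=G(x)d$, and $\mathcal M=\mathcal A+\mathcal A(\mathcal D^e)-\mathcal N$, an unbounded operator on $\ell^2(\mathbb C^4)$ with the domain of $\mathcal N$. **Theorem.** Assume that $\mathcal M$ is Hurwitz, that is, its spectrum lies in the open left half-plane. Let $Q$ be a $T$-periodic real matrix function in $L^\infty$, with $Q(t)$ symmetric positive definite for almost every $t$, and $\mathcal Q=\mathcal T(Q)$. Then the harmonic Lyapunov equation $$\mathcal M^*\mathcal P+\mathcal P\mathcal M+\mathcal Q=0$$ (on the domain of $\mathcal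 M$) has exactly one bounded solution $\mathcal P$ on $\ell^2(\mathbb C^4)$. It is Hermitian and positive definite (there is $m>0$ with $\langle X,\mathcal PX\rangle\ge m\|X\|^2$ for all $X$), and $\mathcal P=\mathcal T(P)$ for a real $T$-periodic matrix function $P$ in $L^\infty$. Moreover, let $H_1$ be any $T$-periodic real matrix function in $L^\infty$, with $H_1(t)$ symmetric positive definite for almost every $t$, and $\mathcal H_1=\mathcal T(H_1)$. Consider (1) with $V=V^e$ and $$D=D^e-\mathcal H_1\,\mathcal G^*(X)\,\mathcal P\,(X-X^e),$$ its trajectories from time $t_0$ on being those $X=\mathcal F(x)$ with a (complex) locally bounded $x$ on $[t_0-T,\infty)$ for which every phasor satisfies the equation at almost every $t>t_0$. Then this closed loop is globally asymptotically stable at $X^e$: * for each $t_0$ and each initial value $x(t_0-T)\in\mathbb C^4$ there is a trajectory from $t_0$ on, with $x$ continuous; * for each $\varepsilon>0$ there is $\delta>0$, independent of $t_0$, such that every trajectory with $\|X(t_0)-X^e\|_{\ell^2}<\delta$ satisfies $\|X(t)-X^e\|_{\ell^2}<\varepsilon$ for all $t\ge t_0$; * every trajectory satisfies $\|X(t)-X^e\|_{\ell^2}\to0$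 as $t\to\infty$. Along each trajectory, $D(t)=\mathcal F(d)(t)$ for $t\ge t_0$, with $d=d^e-H_1G(x)^*P(x-x^e)$. The real time-domain system $\dot x=Ax+G(x)d+Bv^e$ with $$d=d^e-H_1G(x)^TP(x-x^e)$$ has the same guarantee: for each $t_0$ and $x(t_0)\in\mathbb R^4$ there is a Carathéodory solution on $[t_0,\infty)$; for each $\varepsilon>0$ there is $\delta>0$, independent of $t_0$, such that $\|x(t_0)-x^e(t_0)\|<\delta$ implies $\|x(t)-x^e(t)\|<\varepsilon$ for all $t\ge t_0$; and every solution on $[t_0,\infty)$ satisfies $x(t)-x^e(t)\to0$. -/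

import Mathlib

open MeasureTheory Filter Topology Matrix
open scoped ENNReal ComplexConjugate

noncomputable section

namespace HarmonicConverter

/-! ### Phasors, the space `ℓ²(ℂⁿ)` and block Toeplitz operators -/

/-- The `k`-th phasor at time `t` of a scalar signal: its sliding Fourier coefficient over the
window `[t - T, t]`, with pulsation `ω = 2π / T`. -/
def phasor (T : ℝ) (x : ℝ → ℂ) (t : ℝ) (k : ℤ) : ℂ :=
  (1 / (T : ℂ)) * ∫ τ in (t - T)..t,
    x τ * Complex.exp (-(Complex.I * ((2 * Real.pi / T : ℝ) : ℂ) * (k : ℂ) * (τ : ℂ)))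

/-- Componentwise phasors of a vector signal. -/
def vecPhasor {n : ℕ} (T : ℝ) (x : ℝ → Fin n → ℂ) (t : ℝ) (k : ℤ) : Fin n → ℂ :=
  fun i => phasor T (fun τ => x τ i) t k

/-- The (constant) Fourier coefficients of a `T`-periodic real vector signal. -/
def vecHarmonics {n : ℕ} (T : ℝ) (x : ℝ → Fin n → ℝ) (k : ℤ) : Fin n → ℂ :=
  vecPhasor T (fun τ i => (x τ i : ℂ)) T k

/-- The (constant) Fourier coefficients of a `T`-periodic real matrix function. -/
def matHarmonics {m n : ℕ} (T : ℝ) (a : ℝ → Matrix (Fin m) (Fin n) ℝ) (k : ℤ) :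
    Matrix (Fin m) (Fin n) ℂ :=
  Matrix.of fun i j => phasor T (fun τ => (a τ i j : ℂ)) T k

/-- The Hilbert space `ℓ²(ℂⁿ)` of square summable sequences indexed by `ℤ`. -/
abbrev EllTwo (n : ℕ) : Type := lp (fun _ : ℤ => EuclideanSpace ℂ (Fin n)) 2

/-- The coordinates of an element of `ℓ²(ℂⁿ)`. -/
def coords {n : ℕ} (X : EllTwo n) : ℤ → Fin n → ℂ := fun k i => X k i

/-- Action on a sequence of the infinite block Toeplitz matrix with `(k, l)` block `a (k - l)`.
With `a` the Fourier coefficients of a bounded matrix function and `X` in `ℓ²`, all the series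
converge absolutely. -/
def toeplitzMul {m n : ℕ} (a : ℤ → Matrix (Fin m) (Fin n) ℂ) (X : ℤ → Fin n → ℂ) :
    ℤ → Fin m → ℂ :=
  fun k => ∑' l : ℤ, a (k - l) *ᵥ X l

/-- The blocks of the conjugate transpose of the block Toeplitz matrix with blocks `a`. -/
def adjointSymbol {m n : ℕ} (a : ℤ → Matrix (Fin m) (Fin n) ℂ) :
    ℤ → Matrix (Fin n) (Fin m) ℂ :=
  fun k => (a (-k))ᴴ

/-- The diagonal operator `𝒩 = Id ⊗ diag (j ω k)`. -/
def frequencyMul {n : ℕ} (T : ℝ) (X : ℤ → Fin n → ℂ) : ℤ → Fin n → ℂ :=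
  fun k => (Complex.I * ((2 * Real.pi / T : ℝ) : ℂ) * (k : ℂ)) • X k

/-- `a` is a `T`-periodic matrix function with entries in `L^∞`. -/
def IsBoundedPeriodic {m n : ℕ} (T : ℝ) (a : ℝ → Matrix (Fin m) (Fin n) ℝ) : Prop :=
  Function.Periodic a T ∧ ∀ i j, MemLp (fun t => a t i j) ⊤ volume

/-! ### Unbounded operators on a Hilbert space, given by their graphs -/

section Operators

variable {E : Type*} [NormedAddCommGroup E] [InnerProductSpace ℂ E]

/-- `z` is in the resolvent set: `z - M` is a bijection from the domain onto the whole space, with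
a bounded inverse `R`. -/
def InResolventSet (M : Set (E × E)) (z : ℂ) : Prop :=
  ∃ R : E →L[ℂ] E, (∀ Y, (R Y, z • R Y - Y) ∈ M) ∧ ∀ p ∈ M, R (z • p.1 - p.2) = p.1

/-- A Hurwitz operator: its spectrum is contained in the open left half-plane. -/
def IsHurwitz (M : Set (E × E)) : Prop :=
  ∀ z : ℂ, ¬ InResolventSet M z → z.re < 0

/-- The graph of the adjoint operator. -/
def adjointGraph (M : Set (E × E)) : Set (E × E) :=
  {q | ∀ p ∈ M, inner ℂ p.2 q.1 = inner ℂ p.1 q.2}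

end Operators

/-- The bounded operator `P` solves `M* P + P M + 𝒬 = 0`, where `𝒬` is the block Toeplitz operator
with blocks `q`: for each `Y` in the domain of `M`, `P Y` is in the domain of `M*` and
`M* P Y + P M Y + 𝒬 Y = 0`. -/
def SolvesLyapunov {n : ℕ} (M : Set (EllTwo n × EllTwo n)) (q : ℤ → Matrix (Fin n) (Fin n) ℂ)
    (P : EllTwo n →L[ℂ] EllTwo n) : Prop :=
  ∀ p ∈ M, ∃ W : EllTwo n, (P p.1, W) ∈ adjointGraph M ∧
    ∀ k, coords W k + coords (P p.2) k + toeplitzMul q (coords p.1) k = 0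

/-! ### The three-phase converter -/

/-- Phase resistance, phase inductance and bus capacitance of the converter. -/
structure Converter where
  r : ℝ
  L : ℝ
  C : ℝ
  r_pos : 0 < r
  L_pos : 0 < L
  C_pos : 0 < C

/-- The matrix `C₃₃`. -/
def C33 (𝕜 : Type*) [RCLike 𝕜] : Matrix (Fin 3) (Fin 3) 𝕜 :=
  !![2 / 3, -1 / 3, -1 / 3; -1 / 3, 2 / 3, -1 / 3; -1 / 3, -1 / 3, 2 / 3]

namespace Converter

variable (c : Converter)

/-- Drift matrix; the state is `x = (i_a, i_b, i_c, v_dc)`. -/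
def A : Matrix (Fin 4) (Fin 4) ℝ :=
  Matrix.diagonal ![-c.r / c.L, -c.r / c.L, -c.r / c.L, 0]

/-- Input matrix of the exogenous signal `v = (e_a, e_b, e_c, i_dc)`. -/
def B : Matrix (Fin 4) (Fin 4) ℝ :=
  Matrix.diagonal ![-1 / c.L, -1 / c.L, -1 / c.L, -1 / c.C]

/-- The control matrix `G(x)`: upper block `-(v_dc / L) C₃₃`, last row `i_abcᵀ / C`. -/
def G {𝕜 : Type*} [RCLike 𝕜] (x : Fin 4 → 𝕜) : Matrix (Fin 4) (Fin 3) 𝕜 :=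
  Matrix.of ![(fun j => -(C33 𝕜 0 j * x 3) / (c.L : 𝕜)),
    (fun j => -(C33 𝕜 1 j * x 3) / (c.L : 𝕜)),
    (fun j => -(C33 𝕜 2 j * x 3) / (c.L : 𝕜)),
    ![x 0 / (c.C : 𝕜), x 1 / (c.C : 𝕜), x 2 / (c.C : 𝕜)]]

/-- The matrix `A(d)`: last column `-C₃₃ d / L`, last row `dᵀ / C`; thus `A(d) x = G(x) d`. -/
def Ad (d : Fin 3 → ℝ) : Matrix (Fin 4) (Fin 4) ℝ :=
  !![0, 0, 0, -(C33 ℝ *ᵥ d) 0 / c.L;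
    0, 0, 0, -(C33 ℝ *ᵥ d) 1 / c.L;
    0, 0, 0, -(C33 ℝ *ᵥ d) 2 / c.L;
    d 0 / c.C, d 1 / c.C, d 2 / c.C, 0]

/-- The blocks of the constant Toeplitz operator `𝒜 = 𝒯(A)`. -/
def symA (T : ℝ) : ℤ → Matrix (Fin 4) (Fin 4) ℂ := matHarmonics T fun _ => c.A

/-- The blocks of the constant Toeplitz operator `ℬ = 𝒯(B)`. -/
def symB (T : ℝ) : ℤ → Matrix (Fin 4) (Fin 4) ℂ := matHarmonics T fun _ => c.B

/-- The blocks of `𝒢(X) = 𝒯(G(x))`, `X = ℱ(x)`; as `G` is linear they are `G(X_k)`. -/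
def symG (X : ℤ → Fin 4 → ℂ) : ℤ → Matrix (Fin 4) (Fin 3) ℂ := fun k => c.G (X k)

/-- The graph of the unbounded operator `𝒜 + 𝒜(𝒟ᵉ) - 𝒩` on `ℓ²(ℂ⁴)` with its maximal domain. For
bounded `dᵉ` that is the domain of `𝒩`. -/
def errorOperator (T : ℝ) (de : ℝ → Fin 3 → ℝ) : Set (EllTwo 4 × EllTwo 4) :=
  {p | ∀ k, coords p.2 k = toeplitzMul (c.symA T) (coords p.1) k
    + toeplitzMul (matHarmonics T fun t => c.Ad (de t)) (coords p.1) k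
    - frequencyMul T (coords p.1) k}

/-- Right-hand side `(𝒜 - 𝒩) X + 𝒢(X) D + ℬ V` of the harmonic model. -/
def harmonicField (T : ℝ) (X : ℤ → Fin 4 → ℂ) (D : ℤ → Fin 3 → ℂ) (V : ℤ → Fin 4 → ℂ) :
    ℤ → Fin 4 → ℂ :=
  toeplitzMul (c.symA T) X - frequencyMul T X + toeplitzMul (c.symG X) D
    + toeplitzMul (c.symB T) V

/-- The harmonic feedback `D = Dᵉ - ℋ₁ 𝒢*(X) 𝒫 (X - Xᵉ)`. -/
def harmonicFeedback (T : ℝ) (de : ℝ → Fin 3 → ℝ) (Xe : EllTwo 4)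
    (P : EllTwo 4 →L[ℂ] EllTwo 4) (H₁ : ℝ → Matrix (Fin 3) (Fin 3) ℝ) (X : EllTwo 4) :
    ℤ → Fin 3 → ℂ :=
  vecHarmonics T de - toeplitzMul (matHarmonics T H₁)
    (toeplitzMul (adjointSymbol (c.symG (coords X))) (coords (P (X - Xe))))

/-- `X` is, from time `t₀` on, a trajectory of the harmonic model with exogenous input `Vᵉ` in
closed loop with the harmonic feedback, and the signal `x` is its representative: `X = ℱ(x)`.
Local boundedness of `x` makes `𝒢(X(t))` a bounded operator on `ℓ²`. Each phasor of `x` is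
absolutely continuous in `t`; the equation is required for almost every `t`. -/
structure IsHarmonicTrajectory (T : ℝ) (de : ℝ → Fin 3 → ℝ) (ve : ℝ → Fin 4 → ℝ)
    (Xe : EllTwo 4) (P : EllTwo 4 →L[ℂ] EllTwo 4) (H₁ : ℝ → Matrix (Fin 3) (Fin 3) ℝ)
    (t₀ : ℝ) (x : ℝ → Fin 4 → ℂ) (X : ℝ → EllTwo 4) : Prop where
  bounded : ∀ t ≥ t₀, ∀ i, MemLp (fun s => x s i) ⊤ (volume.restrict (Set.Icc (t₀ - T) t))
  phasors : ∀ t ≥ t₀, coords (X t) = vecPhasor T x t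
  equation : ∀ k, ∀ᵐ t, t₀ < t → HasDerivAt (fun s => coords (X s) k)
    (c.harmonicField T (coords (X t)) (c.harmonicFeedback T de Xe P H₁ (X t))
      (vecHarmonics T ve) k) t

/-- The time-domain feedback `d = dᵉ - H₁ G(x)* P (x - xᵉ)` at one instant, for a real or complex
state; for a real state `G(x)* = G(x)ᵀ`. -/
def feedback {𝕜 : Type*} [RCLike 𝕜] (de : Fin 3 → ℝ) (xe : Fin 4 → ℝ)
    (P : Matrix (Fin 4) (Fin 4) ℝ) (H₁ : Matrix (Fin 3) (Fin 3) ℝ) (x : Fin 4 → 𝕜) :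
    Fin 3 → 𝕜 :=
  (fun i => (de i : 𝕜)) - H₁.map (fun a => (a : 𝕜)) *ᵥ ((c.G x)ᴴ *ᵥ
    (P.map (fun a => (a : 𝕜)) *ᵥ (x - fun i => (xe i : 𝕜))))

/-- `x` is, from time `t₀` on, a Carathéodory solution of `ẋ = A x + G(x) d + B vᵉ` with the
time-domain feedback `d = dᵉ - H₁ G(x)ᵀ P (x - xᵉ)`. -/
def IsTimeTrajectory (de : ℝ → Fin 3 → ℝ) (ve xe : ℝ → Fin 4 → ℝ)
    (P : ℝ → Matrix (Fin 4) (Fin 4) ℝ) (H₁ : ℝ → Matrix (Fin 3) (Fin 3) ℝ)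
    (t₀ : ℝ) (x : ℝ → Fin 4 → ℝ) : Prop :=
  let f : ℝ → Fin 4 → ℝ := fun s =>
    c.A *ᵥ x s + c.G (x s) *ᵥ c.feedback (de s) (xe s) (P s) (H₁ s) (x s) + c.B *ᵥ ve s
  ∀ t ≥ t₀, IntervalIntegrable f volume t₀ t ∧ x t = x t₀ + ∫ s in t₀..t, f s

end Converter

/-- The reference `ref` is stable (uniformly in the initial time) and globally attractive for the
trajectories `z`, where `traj t₀ z` says that `z` is a trajectory from time `t₀` on. -/
def IsGloballyAsymptoticallyStable {E : Type*} [NormedAddCommGroup E]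
    (traj : ℝ → (ℝ → E) → Prop) (ref : ℝ → E) : Prop :=
  (∀ ε > 0, ∃ δ > 0, ∀ t₀ z, traj t₀ z → ‖z t₀ - ref t₀‖ < δ →
    ∀ t ≥ t₀, ‖z t - ref t‖ < ε) ∧
  ∀ t₀ z, traj t₀ z → Tendsto (fun t => ‖z t - ref t‖) atTop (𝓝 0)

end HarmonicConverter

end

/-! Multiplying phasors by jωk differentiates the signal. Hence, with F = A + A(dᵉ), the operator 𝓜
is y ↦ F y − y' on absolutely continuous T-periodic functions with square integrable derivative, and
every harmonic statement becomes one about a periodic linear differential equation.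

Let Φ be the fundamental matrix of y' = F y. If Φ(T)v = μv and exp(zT) = μ, then exp(−zs)Φ(s)v is
periodic and is an eigenvector of 𝓜 for z. Since 𝓜 is Hurwitz, |μ| < 1, so Φ(T) is Schur
(`IsFundamental.isSchur`). The discrete Lyapunov equation with right-hand side J(T), J(t) = ∫₀ᵗ
ΦᵀQΦ, therefore has a solution S, and p = Φ⁻ᵀ(S − J)Φ⁻¹ is periodic, uniformly positive definite,
and satisfies p' + Fᵀp + pF + Q = 0 (`exists_isPeriodicLyapunov`). Integrating (y₂* p y)' over a
period shows that 𝒫 = 𝒯(p) solves the harmonic equation (`IsPeriodicLyapunov.solvesLyapunov`).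

For uniqueness, the difference D of two solutions satisfies 𝓜*D + D𝓜 = 0 weakly. An eigenvector for
z with Re z < 0 is orthogonal to the range of D because −z̄ is in the resolvent set. Climbing the
Jordan chains of Φ(T), and shifting z by multiples of jω, yields enough orthogonal vectors to
conclude D = 0 (`orthogonalVectors_step`, `eq_zero_of_homogeneous_lyapunov`).

For the closed loop, G(x)dᵉ = A(dᵉ)x makes the error y = x − xᵉ satisfy y' = F y − G H₁ G* p y,
where G = G(x). The nonlinear term has nonnegative real pairing with p y, so V = y* p y obeys V' ≤
−y* Q y. This bounds y, which gives global existence and stability. The matrix Q need not be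
uniformly positive, but y* Q y ≥ q|y|² with q periodic and positive; since ∫q diverges, V tends to 0
(`exists_rate`, `tendsto_zero_of_dissipation`).

It remains to pass between phasors and signals. The derivative of a sliding phasor involves only
x(t) − x(t − T). Comparing it with the harmonic equation shows that x is, on almost every window, a
primitive of the closed-loop field up to a constant; overlapping windows force the constants to
agree (`exists_solution_of_harmonic`). By Parseval, ‖X − Xᵉ‖² is the mean of |x − xᵉ|² over a
window, so the pointwise estimates carry over. -/

noncomputable section

namespace HarmonicConverter

/-! ### Absolutely continuous functions, as indefinite integrals -/

section Primitive

variable {E : Type*} [NormedAddCommGroup E] [NormedSpace ℝ E]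

/-- `u` is absolutely continuous on `[a, b]` with derivative `u'`, in integral form. -/
def IsPrimitiveOn (u u' : ℝ → E) (a b : ℝ) : Prop :=
  IntervalIntegrable u' volume a b ∧ ∀ t ∈ Set.Icc a b, u t = u a + ∫ s in a..t, u' s

/-- The increment of a vector-valued primitive over an interval is dominated by the increment of the
primitive of ‖f‖, which reduces the claim to the real case. -/
theorem absolutelyContinuousOnInterval_integral {f : ℝ → E} {a b : ℝ}
    (h : IntervalIntegrable f volume a b) :
    AbsolutelyContinuousOnInterval (fun x => ∫ v in a..x, f v) a b := by
  have h1 := h.norm.absolutelyContinuousOnInterval_intervalIntegral (c := a) (by simp)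
  unfold AbsolutelyContinuousOnInterval at h1 ⊢
  refine squeeze_zero' (Eventually.of_forall fun t => Finset.sum_nonneg fun i _ => dist_nonneg)
    ?_ h1
  have : ∀ᶠ E in AbsolutelyContinuousOnInterval.totalLengthFilter ⊓
      𝓟 (AbsolutelyContinuousOnInterval.disjWithin a b),
      E ∈ AbsolutelyContinuousOnInterval.disjWithin a b :=
    mem_inf_of_right (mem_principal_self _)
  filter_upwards [this] with I hI
  refine Finset.sum_le_sum fun i hi => ?_
  have hmem := hI.1 i hi
  have hsub : Set.uIcc (I.2 i).2 (I.2 i).1 ⊆ Set.uIcc a b :=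
    Set.uIcc_subset_uIcc hmem.2 hmem.1
  have e1 : IntervalIntegrable f volume a (I.2 i).1 :=
    h.mono_set (Set.uIcc_subset_uIcc Set.left_mem_uIcc hmem.1)
  have e2 : IntervalIntegrable f volume a (I.2 i).2 :=
    h.mono_set (Set.uIcc_subset_uIcc Set.left_mem_uIcc hmem.2)
  rw [dist_eq_norm, dist_eq_norm, intervalIntegral.integral_interval_sub_left e1 e2,
    intervalIntegral.integral_interval_sub_left e1.norm e2.norm, Real.norm_eq_abs]
  exact intervalIntegral.norm_integral_le_abs_integral_norm

namespace IsPrimitiveOn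

variable {u u' v v' : ℝ → E} {a b : ℝ}

theorem integral_eq (h : IsPrimitiveOn u u' a b) (hab : a ≤ b) :
    ∫ s in a..b, u' s = u b - u a := by
  rw [h.2 b ⟨hab, le_rfl⟩]; abel

theorem continuousOn (h : IsPrimitiveOn u u' a b) (hab : a ≤ b) :
    ContinuousOn u (Set.Icc a b) := by
  have := (absolutelyContinuousOnInterval_integral h.1).continuousOn
  rw [Set.uIcc_of_le hab] at this
  exact (continuousOn_const.add this).congr h.2

theorem mono (h : IsPrimitiveOn u u' a b) {c d : ℝ} (hac : a ≤ c) (hcd : c ≤ d) (hdb : d ≤ b) :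
    IsPrimitiveOn u u' c d := by
  have hi : ∀ {x y : ℝ}, x ∈ Set.Icc a b → y ∈ Set.Icc a b → IntervalIntegrable u' volume x y :=
    fun hx hy => h.1.mono_set (Set.uIcc_subset_uIcc (Set.Icc_subset_uIcc hx)
      (Set.Icc_subset_uIcc hy))
  refine ⟨hi ⟨hac, hcd.trans hdb⟩ ⟨hac.trans hcd, hdb⟩, fun t ht => ?_⟩
  have htm : t ∈ Set.Icc a b := ⟨hac.trans ht.1, ht.2.trans hdb⟩
  have hcm : c ∈ Set.Icc a b := ⟨hac, hcd.trans hdb⟩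
  have ham : a ∈ Set.Icc a b := ⟨le_rfl, hcm.1.trans hcm.2⟩
  rw [h.2 t htm, h.2 c hcm, add_assoc,
    intervalIntegral.integral_add_adjacent_intervals (hi ham hcm) (hi hcm htm)]

theorem of_integral {f : ℝ → E} (hf : IntervalIntegrable f volume a b) (c : E) :
    IsPrimitiveOn (fun t => c + ∫ s in a..t, f s) f a b :=
  ⟨hf, fun t _ => by simp⟩

theorem of_hasDerivAt [CompleteSpace E] {f f' : ℝ → E} (h : ∀ t, HasDerivAt f (f' t) t)
    (hf' : Continuous f') (a b : ℝ) : IsPrimitiveOn f f' a b := by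
  refine ⟨hf'.intervalIntegrable _ _, fun t _ => ?_⟩
  rw [intervalIntegral.integral_eq_sub_of_hasDerivAt (fun x _ => h x)
    (hf'.intervalIntegrable _ _)]
  abel

theorem const (c : E) (a b : ℝ) : IsPrimitiveOn (fun _ => c) (fun _ => 0) a b :=
  ⟨by simp, fun t _ => by simp⟩

theorem add (hu : IsPrimitiveOn u u' a b) (hv : IsPrimitiveOn v v' a b) :
    IsPrimitiveOn (fun t => u t + v t) (fun t => u' t + v' t) a b := by
  refine ⟨hu.1.add hv.1, fun t ht => ?_⟩
  have hs : Set.uIcc a t ⊆ Set.uIcc a b :=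
    Set.uIcc_subset_uIcc Set.left_mem_uIcc (Set.Icc_subset_uIcc ht)
  beta_reduce
  rw [intervalIntegral.integral_add (hu.1.mono_set hs) (hv.1.mono_set hs), hu.2 t ht, hv.2 t ht]
  abel

theorem sum {ι : Type*} (s : Finset ι) {f f' : ι → ℝ → E}
    (h : ∀ i ∈ s, IsPrimitiveOn (f i) (f' i) a b) :
    IsPrimitiveOn (fun t => ∑ i ∈ s, f i t) (fun t => ∑ i ∈ s, f' i t) a b := by
  classical
  induction s using Finset.induction_on with
  | empty => simpa using IsPrimitiveOn.const (0 : E) a b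
  | insert i s hi ih =>
    simp only [Finset.sum_insert hi]
    exact (h i (by simp)).add (ih fun j hj => h j (by simp [hj]))

theorem clm {F : Type*} [NormedAddCommGroup F] [NormedSpace ℝ F] [CompleteSpace E]
    [CompleteSpace F] (L : E →L[ℝ] F) (hu : IsPrimitiveOn u u' a b) :
    IsPrimitiveOn (fun t => L (u t)) (fun t => L (u' t)) a b := by
  have hi : ∀ {t : ℝ}, t ∈ Set.Icc a b → IntervalIntegrable u' volume a t := fun ht =>
    hu.1.mono_set (Set.uIcc_subset_uIcc Set.left_mem_uIcc (Set.Icc_subset_uIcc ht))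
  refine ⟨⟨L.integrable_comp hu.1.1, L.integrable_comp hu.1.2⟩, fun t ht => ?_⟩
  beta_reduce
  rw [L.intervalIntegral_comp_comm (hi ht), hu.2 t ht, map_add]

theorem neg (hu : IsPrimitiveOn u u' a b) :
    IsPrimitiveOn (fun t => -u t) (fun t => -u' t) a b := by
  refine ⟨hu.1.neg, fun t ht => ?_⟩
  beta_reduce
  rw [intervalIntegral.integral_neg, hu.2 t ht]; abel

theorem sub (hu : IsPrimitiveOn u u' a b) (hv : IsPrimitiveOn v v' a b) :
    IsPrimitiveOn (fun t => u t - v t) (fun t => u' t - v' t) a b := by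
  simpa only [sub_eq_add_neg] using hu.add hv.neg

theorem congr_deriv (hu : IsPrimitiveOn u u' a b) (hab : a ≤ b)
    (h : ∀ᵐ s, s ∈ Set.Ioc a b → u' s = v' s) :
    IsPrimitiveOn u v' a b := by
  refine ⟨hu.1.congr_ae ?_, fun t ht => ?_⟩
  · rw [Filter.EventuallyEq, Set.uIoc_of_le hab, ae_restrict_iff' measurableSet_Ioc]
    exact h
  · rw [hu.2 t ht]
    congr 1
    refine intervalIntegral.integral_congr_ae ?_
    filter_upwards [h] with s hs hs'
    rw [Set.uIoc_of_le ht.1] at hs'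
    exact hs ⟨hs'.1, hs'.2.trans ht.2⟩

theorem congr (hu : IsPrimitiveOn u u' a b) (hab : a ≤ b) (h : ∀ s ∈ Set.Icc a b, u s = v s) :
    IsPrimitiveOn v u' a b :=
  ⟨hu.1, fun t ht => by rw [← h t ht, ← h a ⟨le_rfl, hab⟩, hu.2 t ht]⟩

theorem ae_hasDerivAt_integral [CompleteSpace E] (hu : IsPrimitiveOn u u' a b) :
    ∀ᵐ x, x ∈ Set.uIcc a b → HasDerivAt (fun x => u a + ∫ s in a..x, u' s) (u' x) x := by
  filter_upwards [hu.1.ae_hasDerivAt_integral] with x hx hx'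
  exact (hx hx' a (by simp)).const_add _

variable {𝕜 : Type*} [RCLike 𝕜]

/-- Product rule. -/
theorem mul {c c' d d' : ℝ → 𝕜} (hc : IsPrimitiveOn c c' a b) (hd : IsPrimitiveOn d d' a b)
    (hab : a ≤ b) :
    IsPrimitiveOn (fun t => c t * d t) (fun t => c' t * d t + c t * d' t) a b := by
  have hco := hc.continuousOn hab
  have hdo := hd.continuousOn hab
  have hI : IntervalIntegrable (fun t => c' t * d t + c t * d' t) volume a b := by
    rw [← Set.uIcc_of_le hab] at hco hdo
    exact (hc.1.mul_continuousOn hdo).add (hd.1.continuousOn_mul hco)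
  refine ⟨hI, ?_⟩
  have constAC (z : 𝕜) : AbsolutelyContinuousOnInterval (fun _ : ℝ => z) a b :=
    (contDiff_const (n := 1)).contDiffOn.absolutelyContinuousOnInterval
  have hCac := (constAC (c a)).fun_add (absolutelyContinuousOnInterval_integral hc.1)
  have hDac := (constAC (d a)).fun_add (absolutelyContinuousOnInterval_integral hd.1)
  -- The product minus the proposed integral is absolutely continuous with derivative zero almost
  -- everywhere, hence constant. Absolute continuity is essential here: a zero derivative almost
  -- everywhere would not suffice.
  have hac := (hCac.fun_smul hDac).fun_sub (absolutelyContinuousOnInterval_integral hI)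
  simp only [smul_eq_mul] at hac
  obtain ⟨z, hz⟩ := hac.const_of_ae_hasDerivAt_zero (by
    filter_upwards [hc.ae_hasDerivAt_integral, hd.ae_hasDerivAt_integral,
      hI.ae_hasDerivAt_integral] with x h1 h2 h3 hx
    have hx' := hx
    rw [Set.uIcc_of_le hab] at hx'
    have := ((h1 hx).mul (h2 hx)).sub (h3 hx a (by simp))
    convert! this using 1
    rw [← hc.2 x hx', ← hd.2 x hx']
    ring)
  rw [Set.uIcc_of_le hab] at hz
  intro t ht
  have e1 := hz t ht
  have e2 := hz a ⟨le_rfl, hab⟩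
  simp only [intervalIntegral.integral_same, sub_zero, add_zero] at e1 e2
  rw [← e2, ← hc.2 t ht, ← hd.2 t ht] at e1
  linear_combination e1

theorem star {c c' : ℝ → 𝕜} (hc : IsPrimitiveOn c c' a b) :
    IsPrimitiveOn (fun t => star (c t)) (fun t => star (c' t)) a b :=
  hc.clm (RCLike.conjCLE (K := 𝕜) : 𝕜 →L[ℝ] 𝕜)

theorem re {c c' : ℝ → 𝕜} (hc : IsPrimitiveOn c c' a b) :
    IsPrimitiveOn (fun t => RCLike.re (c t)) (fun t => RCLike.re (c' t)) a b :=
  hc.clm (RCLike.reCLM (K := 𝕜))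

theorem ofReal {c c' : ℝ → ℝ} (hc : IsPrimitiveOn c c' a b) :
    IsPrimitiveOn (fun t => (c t : 𝕜)) (fun t => (c' t : 𝕜)) a b :=
  hc.clm (RCLike.ofRealCLM (K := 𝕜))

theorem dotProduct {n : Type*} [Fintype n] {x x' y y' : ℝ → n → 𝕜}
    (hx : ∀ i, IsPrimitiveOn (fun t => x t i) (fun t => x' t i) a b)
    (hy : ∀ i, IsPrimitiveOn (fun t => y t i) (fun t => y' t i) a b) (hab : a ≤ b) :
    IsPrimitiveOn (fun t => x t ⬝ᵥ y t) (fun t => x' t ⬝ᵥ y t + x t ⬝ᵥ y' t) a b := by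
  simp only [_root_.dotProduct, ← Finset.sum_add_distrib]
  exact sum _ fun i _ => (hx i).mul (hy i) hab

theorem mulVec {m n : Type*} [Fintype n] {A A' : ℝ → Matrix m n 𝕜} {y y' : ℝ → n → 𝕜}
    (hA : ∀ i j, IsPrimitiveOn (fun t => A t i j) (fun t => A' t i j) a b)
    (hy : ∀ i, IsPrimitiveOn (fun t => y t i) (fun t => y' t i) a b) (hab : a ≤ b) (i : m) :
    IsPrimitiveOn (fun t => (A t *ᵥ y t) i) (fun t => (A' t *ᵥ y t + A t *ᵥ y' t) i) a b :=
  IsPrimitiveOn.dotProduct (x := fun t => A t i) (x' := fun t => A' t i) (hA i) hy hab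

theorem matMul {l m n : Type*} [Fintype m] {A A' : ℝ → Matrix l m 𝕜} {B B' : ℝ → Matrix m n 𝕜}
    (hA : ∀ i j, IsPrimitiveOn (fun t => A t i j) (fun t => A' t i j) a b)
    (hB : ∀ i j, IsPrimitiveOn (fun t => B t i j) (fun t => B' t i j) a b) (hab : a ≤ b)
    (i : l) (j : n) :
    IsPrimitiveOn (fun t => (A t * B t) i j) (fun t => (A' t * B t + A t * B' t) i j) a b :=
  IsPrimitiveOn.dotProduct (x := fun t => A t i) (x' := fun t => A' t i)
    (y := fun t k => B t k j) (y' := fun t k => B' t k j) (hA i) (fun k => hB k j) hab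

end IsPrimitiveOn

end Primitive

/-! ### Global solutions of Carathéodory differential equations -/

/-- Integrating the exponential weight gains a factor 1/l. This is what makes the Picard map
contract on the whole line at once. -/
theorem integral_exp_abs_le {l : ℝ} (hl : 0 < l) (t₀ t : ℝ) :
    |∫ s in t₀..t, Real.exp (l * |s - t₀|)| ≤ Real.exp (l * |t - t₀|) / l := by
  have key : ∀ c : ℝ, c ≠ 0 → ∀ x y : ℝ, ∫ s in x..y, Real.exp (c * (s - t₀)) =
      Real.exp (c * (y - t₀)) / c - Real.exp (c * (x - t₀)) / c := by
    intro c hc x y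
    have hcont : Continuous fun s : ℝ => Real.exp (c * (s - t₀)) := by fun_prop
    refine intervalIntegral.integral_eq_sub_of_hasDerivAt
      (f := fun s => Real.exp (c * (s - t₀)) / c) (fun s _ => ?_) (hcont.intervalIntegrable _ _)
    have h1 : HasDerivAt (fun s => c * (s - t₀)) c s := by
      simpa using ((hasDerivAt_id s).sub_const t₀).const_mul c
    simpa [hc] using h1.exp.div_const c
  rcases le_total t₀ t with h | h
  · rw [intervalIntegral.integral_congr (g := fun s => Real.exp (l * (s - t₀)))]
    · rw [key l hl.ne', abs_of_nonneg (sub_nonneg.2 h), sub_self, mul_zero, Real.exp_zero,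
        abs_of_nonneg]
      · have : 0 ≤ 1 / l := by positivity
        linarith
      · rw [← sub_div]
        have := Real.one_le_exp (mul_nonneg hl.le (sub_nonneg.2 h))
        exact div_nonneg (by linarith) hl.le
    · intro s hs
      rw [Set.uIcc_of_le h] at hs
      simp only [abs_of_nonneg (sub_nonneg.2 hs.1)]
  · rw [intervalIntegral.integral_congr (g := fun s => Real.exp (-l * (s - t₀)))]
    · rw [key (-l) (by linarith), abs_of_nonpos (sub_nonpos.2 h), sub_self, mul_zero,
        Real.exp_zero]
      have e : l * -(t - t₀) = -l * (t - t₀) := by ring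
      rw [e, abs_of_nonpos]
      · have : 0 ≤ 1 / l := by positivity
        rw [div_neg, div_neg]
        linarith
      · rw [← sub_div]
        have : 1 ≤ Real.exp (-l * (t - t₀)) := Real.one_le_exp (by nlinarith)
        exact div_nonpos_of_nonneg_of_nonpos (by linarith) (by linarith)
    · intro s hs
      rw [Set.uIcc_of_ge h] at hs
      simp only [abs_of_nonpos (sub_nonpos.2 hs.2)]
      ring_nf

/-- Picard's theorem for a Carathéodory right-hand side that is Lipschitz in the state, uniformly
in time. -/
theorem exists_global_solution {E : Type*} [NormedAddCommGroup E] [NormedSpace ℝ E]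
    [CompleteSpace E] (f : ℝ → E → E) (K : NNReal) (C : ℝ)
    (hmeas : ∀ u : ℝ → E, Continuous u → AEStronglyMeasurable (fun s => f s (u s)) volume)
    (hlip : ∀ᵐ s, LipschitzWith K (f s)) (h0 : ∀ᵐ s, ‖f s 0‖ ≤ C) (t₀ : ℝ) (y₀ : E) :
    ∃ y : ℝ → E, Continuous y ∧ y t₀ = y₀ ∧
      ∀ a b, IsPrimitiveOn y (fun s => f s (y s)) a b := by
  -- Chosen so that K / l ≤ 1/2, the contraction constant below.
  set l : ℝ := 2 * (K + 1) with hl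
  have hlpos : 0 < l := by positivity
  set w : ℝ → ℝ := fun s => Real.exp (l * |s - t₀|) with hw
  have hwpos : ∀ s, 0 < w s := fun s => Real.exp_pos _
  have hw1 : ∀ s, 1 ≤ w s := fun s => Real.one_le_exp (by positivity)
  have hwc : Continuous w := by fun_prop
  have hC : 0 ≤ C := by
    obtain ⟨s, hs⟩ := h0.exists
    exact (norm_nonneg _).trans hs
  -- The unknown is the bounded function u = y / w. In this weighted sup norm a single fixed point
  -- gives the solution for all times, with no continuation argument.
  let Y : BoundedContinuousFunction ℝ E → ℝ → E := fun u s => w s • u s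
  have hYc : ∀ u, Continuous (Y u) := fun u => hwc.smul u.continuous
  have hFb : ∀ u, ∀ᵐ s, ‖f s (Y u s)‖ ≤ (C + K * ‖u‖) * w s := by
    intro u
    filter_upwards [hlip, h0] with s h1 h2
    have h3 := h1.dist_le_mul (Y u s) 0
    rw [dist_eq_norm, dist_zero_right] at h3
    have h4 : ‖Y u s‖ ≤ w s * ‖u‖ := by
      rw [norm_smul, Real.norm_of_nonneg (hwpos s).le]
      exact mul_le_mul_of_nonneg_left (u.norm_coe_le_norm s) (hwpos s).le
    calc ‖f s (Y u s)‖ ≤ ‖f s (Y u s) - f s 0‖ + ‖f s 0‖ := norm_le_norm_sub_add _ _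
      _ ≤ K * (w s * ‖u‖) + C := by gcongr; exact h3.trans (by gcongr)
      _ ≤ (C + K * ‖u‖) * w s := by nlinarith [hw1 s]
  have hFi : ∀ u a b, IntervalIntegrable (fun s => f s (Y u s)) volume a b := by
    intro u a b
    refine IntervalIntegrable.mono_fun (f := fun s => (C + K * ‖u‖) * w s)
      ((hwc.const_mul _).intervalIntegrable a b) (hmeas _ (hYc u)).restrict ?_
    filter_upwards [ae_restrict_of_ae (hFb u)] with s hs
    exact hs.trans (le_abs_self _)
  have hint : ∀ c t : ℝ, 0 ≤ c → |∫ s in t₀..t, c * w s| ≤ c * (w t / l) := by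
    intro c t hc
    rw [intervalIntegral.integral_const_mul, abs_mul, abs_of_nonneg hc]
    exact mul_le_mul_of_nonneg_left (integral_exp_abs_le hlpos t₀ t) hc
  let S : BoundedContinuousFunction ℝ E → BoundedContinuousFunction ℝ E := fun u =>
    BoundedContinuousFunction.ofNormedAddCommGroup
      (fun t => (w t)⁻¹ • (y₀ + ∫ s in t₀..t, f s (Y u s)))
      ((hwc.inv₀ fun s => (hwpos s).ne').smul (continuous_const.add
        (intervalIntegral.continuous_primitive (hFi u) t₀)))
      (‖y₀‖ + (C + K * ‖u‖) / l) (by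
        intro t
        have h1 : ‖∫ s in t₀..t, f s (Y u s)‖ ≤ (C + K * ‖u‖) * (w t / l) :=
          (intervalIntegral.norm_integral_le_abs_of_norm_le
            (ae_restrict_of_ae (hFb u)) ((hwc.const_mul _).intervalIntegrable _ _)).trans
            (hint _ t (by positivity))
        rw [norm_smul, norm_inv, Real.norm_of_nonneg (hwpos t).le, inv_mul_le_iff₀ (hwpos t)]
        calc _ ≤ ‖y₀‖ + (C + K * ‖u‖) * (w t / l) := (norm_add_le _ _).trans (by gcongr)
          _ ≤ w t * ‖y₀‖ + (C + K * ‖u‖) * (w t / l) := by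
            have := hw1 t
            nlinarith [norm_nonneg y₀]
          _ = _ := by ring)
  have hS : ContractingWith (1 / 2) S := by
    refine ⟨by rw [← NNReal.coe_lt_coe]; norm_num, LipschitzWith.of_dist_le_mul fun u v => ?_⟩
    rw [BoundedContinuousFunction.dist_le (by positivity)]
    intro t
    have h1 : ∀ᵐ s, ‖f s (Y u s) - f s (Y v s)‖ ≤ (K * dist u v) * w s := by
      filter_upwards [hlip] with s hs
      have h3 := hs.dist_le_mul (Y u s) (Y v s)
      rw [dist_eq_norm] at h3
      refine h3.trans ?_
      rw [dist_smul₀, Real.norm_of_nonneg (hwpos s).le]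
      have := BoundedContinuousFunction.dist_coe_le_dist (f := u) (g := v) s
      calc (K : ℝ) * (w s * dist (u s) (v s)) ≤ K * (w s * dist u v) := by
            have := hwpos s
            gcongr
        _ = _ := by ring
    have h2 : ‖∫ s in t₀..t, (f s (Y u s) - f s (Y v s))‖ ≤ (K * dist u v) * (w t / l) :=
      (intervalIntegral.norm_integral_le_abs_of_norm_le
        (ae_restrict_of_ae h1) ((hwc.const_mul _).intervalIntegrable _ _)).trans
        (hint _ t (by positivity))
    rw [intervalIntegral.integral_sub (hFi u _ _) (hFi v _ _)] at h2
    change dist ((w t)⁻¹ • (y₀ + ∫ s in t₀..t, f s (Y u s)))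
      ((w t)⁻¹ • (y₀ + ∫ s in t₀..t, f s (Y v s))) ≤ _
    rw [dist_smul₀, norm_inv, Real.norm_of_nonneg (hwpos t).le, inv_mul_le_iff₀ (hwpos t),
      dist_add_left, dist_eq_norm]
    refine h2.trans ?_
    have h3 : (K : ℝ) / l ≤ 1 / 2 := by
      rw [hl, div_le_div_iff₀ (by positivity) (by norm_num)]
      have := K.2
      linarith
    calc (K : ℝ) * dist u v * (w t / l) = (K / l) * (w t * dist u v) := by ring
      _ ≤ 1 / 2 * (w t * dist u v) := by
        have := hwpos t
        gcongr
      _ = _ := by push_cast; ring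
  have hfix : S (hS.fixedPoint S) = hS.fixedPoint S := hS.fixedPoint_isFixedPt
  set u := hS.fixedPoint S
  have hYu : ∀ t, Y u t = y₀ + ∫ s in t₀..t, f s (Y u s) := by
    intro t
    have : u t = (w t)⁻¹ • (y₀ + ∫ s in t₀..t, f s (Y u s)) := by
      conv_lhs => rw [← hfix]
      rfl
    change w t • u t = _
    rw [this, smul_inv_smul₀ (hwpos t).ne']
  refine ⟨Y u, hYc u, by rw [hYu]; simp, fun a b => ⟨hFi u a b, fun t _ => ?_⟩⟩
  rw [hYu t, hYu a, add_assoc, intervalIntegral.integral_add_adjacent_intervals (hFi u _ _)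
    (hFi u _ _)]

/-! ### Fourier analysis on a sliding window -/

/-- Lebesgue measure on the window `(t - T, t]`. -/
abbrev window (T t : ℝ) : Measure ℝ := volume.restrict (Set.Ioc (t - T) t)

section Scalar

variable {T : ℝ}

/-- A window wraps exactly once around the circle of length T. Parseval and Riesz–Fischer on a
window are those of the circle, through this identity. -/
theorem phasor_eq_fourierCoeff [hT : Fact (0 < T)] (x : ℝ → ℂ) (t : ℝ) (k : ℤ) :
    phasor T x t k = fourierCoeff (AddCircle.liftIoc T (t - T) x) k := by
  rw [fourierCoeff_eq_intervalIntegral _ _ (t - T), phasor, sub_add_cancel]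
  have : (1 / T : ℝ) • ∫ y in (t - T)..t, (fourier (-k) (y : AddCircle T) : ℂ) •
      AddCircle.liftIoc T (t - T) x y = (1 / (T : ℂ)) * ∫ y in (t - T)..t,
      (fourier (-k) (y : AddCircle T) : ℂ) • AddCircle.liftIoc T (t - T) x y := by
    rw [Complex.real_smul]; push_cast; rfl
  rw [this]
  congr 1
  refine intervalIntegral.integral_congr_ae (ae_of_all _ fun s hs => ?_)
  have hT0 := hT.out
  rw [Set.uIoc_of_le (by linarith)] at hs
  rw [AddCircle.liftIoc_coe_apply (by simpa using hs), fourier_coe_apply, smul_eq_mul, mul_comm]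
  congr 2
  push_cast
  ring

theorem memLp_liftIoc_haar [Fact (0 < T)] {x : ℝ → ℂ} {t : ℝ} (hx : MemLp x 2 (window T t)) :
    MemLp (AddCircle.liftIoc T (t - T) x) 2 AddCircle.haarAddCircle := by
  rw [memLp_haarAddCircle_iff]
  exact MemLp.memLp_liftIoc (by simpa using hx)

/-- Parseval's identity on a window. -/
theorem hasSum_conj_phasor_mul (hT : 0 < T) {x y : ℝ → ℂ} {t : ℝ} (hx : MemLp x 2 (window T t))
    (hy : MemLp y 2 (window T t)) :
    HasSum (fun k => conj (phasor T x t k) * phasor T y t k)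
      ((1 / (T : ℂ)) * ∫ s in (t - T)..t, conj (x s) * y s) := by
  have : Fact (0 < T) := ⟨hT⟩
  have hX := memLp_liftIoc_haar hx
  have hY := memLp_liftIoc_haar hy
  have h := (fourierBasis (T := T)).hasSum_inner_mul_inner hX.toLp hY.toLp
  have e : ∀ {z : ℝ → ℂ} (hZ : MemLp (AddCircle.liftIoc T (t - T) z) 2 AddCircle.haarAddCircle)
      (k : ℤ), inner ℂ ((fourierBasis (T := T)) k) hZ.toLp = phasor T z t k := by
    intro z hZ k
    rw [← HilbertBasis.repr_apply_apply, fourierBasis_repr, phasor_eq_fourierCoeff,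
      fourierCoeff_congr_ae hZ.coeFn_toLp]
  convert! h using 1
  · ext k
    rw [e, ← inner_conj_symm, e]
  · rw [MeasureTheory.L2.inner_def]
    have h1 : ∫ a, inner ℂ ((hX.toLp : AddCircle T → ℂ) a) ((hY.toLp : AddCircle T → ℂ) a)
        ∂AddCircle.haarAddCircle = ∫ a, AddCircle.liftIoc T (t - T) (fun s => conj (x s) * y s) a
        ∂AddCircle.haarAddCircle := by
      refine integral_congr_ae ?_
      filter_upwards [hX.coeFn_toLp, hY.coeFn_toLp] with a h1 h2
      rw [h1, h2, RCLike.inner_apply, mul_comm]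
      rfl
    rw [h1, AddCircle.integral_haarAddCircle, AddCircle.integral_liftIoc_eq_intervalIntegral,
      sub_add_cancel, Complex.real_smul]
    push_cast
    rw [one_div]

/-- Riesz-Fischer theorem on a window. -/
theorem exists_phasor_eq (hT : 0 < T) (t : ℝ) {c : ℤ → ℂ} (hc : Memℓp c 2) :
    ∃ x : ℝ → ℂ, MemLp x 2 (window T t) ∧ phasor T x t = c := by
  have : Fact (0 < T) := ⟨hT⟩
  let f := (fourierBasis (T := T)).repr.symm ⟨c, hc⟩
  have hf : MemLp (f : AddCircle T → ℂ) 2 volume := by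
    rw [← memLp_haarAddCircle_iff]; exact Lp.memLp f
  refine ⟨fun s => f (s : AddCircle T), ?_, ?_⟩
  · have := hf.comp_measurePreserving (AddCircle.measurePreserving_mk T (t - T))
    rw [sub_add_cancel] at this
    exact this
  · ext k
    have h1 : fourierCoeff (f : AddCircle T → ℂ) k = c k := by
      rw [← fourierBasis_repr, LinearIsometryEquiv.apply_symm_apply]
    rw [← h1, phasor_eq_fourierCoeff]
    congr 1
    ext a
    rw [AddCircle.liftIoc, Function.comp_apply, Set.domRestrict_apply]
    congr 1
    exact (AddCircle.equivIoc T (t - T)).symm_apply_apply a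

theorem phasor_congr_ae {x y : ℝ → ℂ} {t : ℝ} (hT : 0 < T) (h : x =ᵐ[window T t] y) :
    phasor T x t = phasor T y t := by
  ext k
  rw [phasor, phasor]
  congr 1
  refine intervalIntegral.integral_congr_ae ?_
  rw [Filter.EventuallyEq, ae_restrict_iff' measurableSet_Ioc] at h
  filter_upwards [h] with s hs hs'
  rw [Set.uIoc_of_le (by linarith)] at hs'
  rw [hs hs']

theorem intervalIntegrable_window (hT : 0 < T) {x : ℝ → ℂ} {t : ℝ} :
    IntervalIntegrable x volume (t - T) t ↔ Integrable x (window T t) := by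
  rw [intervalIntegrable_iff_integrableOn_Ioc_of_le (by linarith), IntegrableOn]

theorem continuous_mode (T : ℝ) (k : ℤ) : Continuous fun τ : ℝ =>
    Complex.exp (-(Complex.I * ((2 * Real.pi / T : ℝ) : ℂ) * (k : ℂ) * (τ : ℂ))) := by
  fun_prop

theorem norm_mode (T : ℝ) (k : ℤ) (τ : ℝ) :
    ‖Complex.exp (-(Complex.I * ((2 * Real.pi / T : ℝ) : ℂ) * (k : ℂ) * (τ : ℂ)))‖ = 1 := by
  have : -(Complex.I * ((2 * Real.pi / T : ℝ) : ℂ) * (k : ℂ) * (τ : ℂ)) =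
      ((-(2 * Real.pi / T * k * τ) : ℝ) : ℂ) * Complex.I := by push_cast; ring
  rw [this, Complex.norm_exp_ofReal_mul_I]

theorem mode_add_period (hT : 0 < T) (k : ℤ) (τ : ℝ) :
    Complex.exp (-(Complex.I * ((2 * Real.pi / T : ℝ) : ℂ) * (k : ℂ) * ((τ + T : ℝ) : ℂ))) =
    Complex.exp (-(Complex.I * ((2 * Real.pi / T : ℝ) : ℂ) * (k : ℂ) * (τ : ℂ))) := by
  have hT' : (T : ℂ) ≠ 0 := by exact_mod_cast hT.ne'
  rw [Complex.exp_eq_exp_iff_exists_int]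
  refine ⟨-k, ?_⟩
  push_cast
  field_simp
  ring

theorem phasor_add {x y : ℝ → ℂ} {t : ℝ} (hx : IntervalIntegrable x volume (t - T) t)
    (hy : IntervalIntegrable y volume (t - T) t) (k : ℤ) :
    phasor T (fun s => x s + y s) t k = phasor T x t k + phasor T y t k := by
  simp only [phasor, add_mul]
  rw [intervalIntegral.integral_add (hx.mul_continuousOn (continuous_mode T k).continuousOn)
    (hy.mul_continuousOn (continuous_mode T k).continuousOn), mul_add]

theorem phasor_const_mul (c : ℂ) (x : ℝ → ℂ) (t : ℝ) (k : ℤ) :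
    phasor T (fun s => c * x s) t k = c * phasor T x t k := by
  simp only [phasor, mul_assoc, intervalIntegral.integral_const_mul]
  ring

theorem phasor_neg (x : ℝ → ℂ) (t : ℝ) (k : ℤ) :
    phasor T (fun s => -x s) t k = -phasor T x t k := by
  simpa using phasor_const_mul (T := T) (-1) x t k

theorem phasor_sub {x y : ℝ → ℂ} {t : ℝ} (hx : IntervalIntegrable x volume (t - T) t)
    (hy : IntervalIntegrable y volume (t - T) t) (k : ℤ) :
    phasor T (fun s => x s - y s) t k = phasor T x t k - phasor T y t k := by
  simp only [sub_eq_add_neg]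
  rw [← phasor_neg]
  exact phasor_add hx hy.neg k

theorem phasor_sum {ι : Type*} (s : Finset ι) {x : ι → ℝ → ℂ} {t : ℝ}
    (hx : ∀ i ∈ s, IntervalIntegrable (x i) volume (t - T) t) (k : ℤ) :
    phasor T (fun τ => ∑ i ∈ s, x i τ) t k = ∑ i ∈ s, phasor T (x i) t k := by
  simp only [phasor, Finset.sum_mul]
  rw [intervalIntegral.integral_finsetSum fun i hi =>
    (hx i hi).mul_continuousOn (continuous_mode T k).continuousOn, Finset.mul_sum]

theorem phasor_conj (x : ℝ → ℂ) (t : ℝ) (k : ℤ) :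
    phasor T (fun s => conj (x s)) t k = conj (phasor T x t (-k)) := by
  simp only [phasor, intervalIntegral, map_mul, map_sub, ← integral_conj]
  have (τ : ℝ) : conj (Complex.exp (-(Complex.I * ((2 * Real.pi / T : ℝ) : ℂ) * ((-k : ℤ) : ℂ) *
      (τ : ℂ)))) = Complex.exp (-(Complex.I * ((2 * Real.pi / T : ℝ) : ℂ) * (k : ℂ) * (τ : ℂ))) := by
    rw [← Complex.exp_conj]
    simp [-Complex.ofReal_mul, -Complex.ofReal_div]
  simp only [this, map_div₀, map_one, Complex.conj_ofReal]

theorem phasor_const (hT : 0 < T) (c : ℂ) (t : ℝ) (k : ℤ) :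
    phasor T (fun _ => c) t k = if k = 0 then c else 0 := by
  have hT' : (T : ℂ) ≠ 0 := by exact_mod_cast hT.ne'
  split_ifs with hk
  · subst hk
    simp [phasor]
    field_simp
  · simp only [phasor, intervalIntegral.integral_const_mul]
    have hc : (-(Complex.I * ((2 * Real.pi / T : ℝ) : ℂ) * (k : ℂ))) ≠ 0 := by
      have hk' : (k : ℂ) ≠ 0 := by exact_mod_cast hk
      have hpi : (Real.pi : ℂ) ≠ 0 := by exact_mod_cast Real.pi_ne_zero
      push_cast
      simp [hk', hT', hpi]
    have h1 := mode_add_period hT k (t - T)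
    rw [sub_add_cancel] at h1
    have h2 := integral_exp_mul_complex (a := t - T) (b := t) hc
    simp only [neg_mul, h1, sub_self, zero_div] at h2
    rw [h2, mul_zero, mul_zero]

theorem phasor_periodic (hT : 0 < T) {x : ℝ → ℂ} (hx : Function.Periodic x T) (t t' : ℝ) (k : ℤ) :
    phasor T x t k = phasor T x t' k := by
  have hp : Function.Periodic (fun τ : ℝ => x τ * Complex.exp (-(Complex.I *
      ((2 * Real.pi / T : ℝ) : ℂ) * (k : ℂ) * (τ : ℂ)))) T := by
    intro τ
    simp only [hx τ, mode_add_period hT k τ]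
  have := hp.intervalIntegral_add_eq (t - T) (t' - T)
  rw [sub_add_cancel, sub_add_cancel] at this
  rw [phasor, phasor, this]

theorem phasor_mul_mode (x : ℝ → ℂ) (t : ℝ) (k l : ℤ) :
    phasor T (fun τ => x τ * Complex.exp (Complex.I * ((2 * Real.pi / T : ℝ) : ℂ) * (k : ℂ) *
      (τ : ℂ))) t l = phasor T x t (l - k) := by
  simp only [phasor, mul_assoc, ← Complex.exp_add]
  congr 1
  congr 1
  ext τ
  congr 2
  push_cast
  ring

theorem memLp_mul_mode {x : ℝ → ℂ} {p : ℝ≥0∞} {μ : Measure ℝ} (hx : MemLp x p μ) (k : ℤ) :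
    MemLp (fun τ => x τ * Complex.exp (Complex.I * ((2 * Real.pi / T : ℝ) : ℂ) * (k : ℂ) *
      (τ : ℂ))) p μ := by
  refine hx.of_le (hx.1.mul (Continuous.aestronglyMeasurable (by fun_prop)))
    (ae_of_all _ fun τ => ?_)
  have := norm_mode T (-k) τ
  rw [norm_mul]
  simp only [Int.cast_neg, mul_neg, neg_mul, neg_neg] at this
  rw [this, mul_one]

/-- The phasors of a product are the convolution of the phasors. -/
theorem hasSum_phasor_mul (hT : 0 < T) {a x : ℝ → ℂ} {t : ℝ} (ha : MemLp a 2 (window T t))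
    (hx : MemLp x 2 (window T t)) (k : ℤ) :
    HasSum (fun l => phasor T a t (k - l) * phasor T x t l)
      (phasor T (fun s => a s * x s) t k) := by
  have hstar : MemLp (fun s => conj (a s)) 2 (window T t) := ha.star
  -- Parseval for the pair (ā·mode k, x): modulation shifts the index by k and conjugation reflects
  -- it, which turns the inner product into a convolution.
  have h := hasSum_conj_phasor_mul hT (memLp_mul_mode (T := T) hstar k) hx
  convert! h using 1
  · ext l
    rw [phasor_mul_mode, phasor_conj, Complex.conj_conj, neg_sub]
  · rw [phasor]
    congr 1
    congr 1
    ext s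
    rw [map_mul, Complex.conj_conj, ← Complex.exp_conj, mul_right_comm]
    congr 2
    simp [-Complex.ofReal_mul, -Complex.ofReal_div]

/-- By Parseval the difference has zero L² norm on the window. -/
theorem ae_eq_of_phasor_eq (hT : 0 < T) {x y : ℝ → ℂ} {t : ℝ} (hx : MemLp x 2 (window T t))
    (hy : MemLp y 2 (window T t)) (h : ∀ k, phasor T x t k = phasor T y t k) :
    x =ᵐ[window T t] y := by
  have hxy := hx.sub hy
  have hxi := (intervalIntegrable_window hT).2 (hx.integrable one_le_two)
  have hyi := (intervalIntegrable_window hT).2 (hy.integrable one_le_two)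
  have h0 := hasSum_conj_phasor_mul hT hxy hxy
  have h1 : ∀ k, phasor T (x - y) t k = 0 := fun k => by
    have := phasor_sub hxi hyi k
    rw [h k, sub_self] at this
    exact this
  simp only [h1, mul_zero] at h0
  have h2 := h0.unique hasSum_zero
  have hT' : (T : ℂ) ≠ 0 := by exact_mod_cast hT.ne'
  rw [mul_eq_zero, or_iff_right (by simp [hT'])] at h2
  have h3 : ∀ s, conj ((x - y) s) * (x - y) s = ((‖(x - y) s‖ ^ 2 : ℝ) : ℂ) := fun s => by
    rw [Complex.conj_mul']; push_cast; rfl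
  simp only [h3] at h2
  rw [intervalIntegral.integral_ofReal, Complex.ofReal_eq_zero,
    intervalIntegral.integral_of_le (by linarith),
    integral_eq_zero_iff_of_nonneg (fun s => by positivity) (hxy.integrable_norm_pow two_ne_zero)]
    at h2
  filter_upwards [h2] with s hs
  simpa [sub_eq_zero] using hs

/-- The phasors of an absolutely continuous function and of its derivative. -/
theorem phasor_deriv (hT : 0 < T) {x f : ℝ → ℂ} {t : ℝ} (h : IsPrimitiveOn x f (t - T) t)
    (k : ℤ) :
    Complex.I * ((2 * Real.pi / T : ℝ) : ℂ) * (k : ℂ) * phasor T x t k = phasor T f t k -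
      (1 / (T : ℂ)) * ((x t - x (t - T)) *
        Complex.exp (-(Complex.I * ((2 * Real.pi / T : ℝ) : ℂ) * (k : ℂ) * (t : ℂ)))) := by
  set w : ℂ := Complex.I * ((2 * Real.pi / T : ℝ) : ℂ) * (k : ℂ) with hw
  have hle : t - T ≤ t := by linarith
  have he : IsPrimitiveOn (fun τ : ℝ => Complex.exp (-(w * τ)))
      (fun τ : ℝ => -w * Complex.exp (-(w * τ))) (t - T) t := by
    refine IsPrimitiveOn.of_hasDerivAt (fun τ => ?_) (by fun_prop) _ _
    have h1 : HasDerivAt (fun τ : ℝ => -(w * (τ : ℂ))) (-w) τ := by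
      simpa using ((Complex.ofRealCLM.hasDerivAt (x := τ)).const_mul w).fun_neg
    simpa [mul_comm] using h1.cexp
  have h1 := (h.mul he hle).integral_eq hle
  have hf : IntervalIntegrable (fun s => f s * Complex.exp (-(w * s))) volume (t - T) t :=
    h.1.mul_continuousOn (continuous_mode T k).continuousOn
  have hx : IntervalIntegrable (fun s => x s * (-w * Complex.exp (-(w * s)))) volume (t - T) t := by
    refine ContinuousOn.intervalIntegrable ?_
    rw [Set.uIcc_of_le hle]
    exact (h.continuousOn hle).mul (by fun_prop)
  rw [intervalIntegral.integral_add hf hx] at h1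
  have h2 : ∫ s in (t - T)..t, x s * (-w * Complex.exp (-(w * s))) =
      -w * ∫ s in (t - T)..t, x s * Complex.exp (-(w * s)) := by
    rw [← intervalIntegral.integral_const_mul]
    congr 1; ext s; ring
  -- The mode takes the same value at both ends of the window, so the boundary terms of the
  -- integration by parts combine into one jump.
  have h3 := mode_add_period hT k (t - T)
  rw [sub_add_cancel] at h3
  rw [h2, ← h3] at h1
  simp only [phasor, ← hw]
  linear_combination (-(1 / (T : ℂ))) * h1

/-- A square integrable function whose phasors are those of a primitive of `f` is, up to a null
set, such a primitive. -/
theorem ae_eq_primitive_of_phasor (hT : 0 < T) {x f : ℝ → ℂ} {t : ℝ}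
    (hx : MemLp x 2 (window T t)) (hf : IntervalIntegrable f volume (t - T) t)
    (h : ∀ k : ℤ, Complex.I * ((2 * Real.pi / T : ℝ) : ℂ) * (k : ℂ) * phasor T x t k =
      phasor T f t k - (1 / (T : ℂ)) * ((∫ s in (t - T)..t, f s) *
        Complex.exp (-(Complex.I * ((2 * Real.pi / T : ℝ) : ℂ) * (k : ℂ) * (t : ℂ))))) :
    ∃ C : ℂ, ∀ᵐ s ∂(window T t), x s = C + ∫ τ in (t - T)..s, f τ := by
  have hle : t - T ≤ t := by linarith
  have hprim := IsPrimitiveOn.of_integral hf 0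
  have hxi := (intervalIntegrable_window hT).2 (hx.integrable one_le_two)
  have hc := hprim.continuousOn hle
  have hL : ∀ C : ℂ, MemLp (fun s => C + ∫ τ in (t - T)..s, f τ) 2 (window T t) := by
    intro C
    have hc' := (continuousOn_const (c := C)).add hc
    simp only [zero_add] at hc'
    obtain ⟨M, hM⟩ := isCompact_Icc.exists_bound_of_continuousOn hc'
    refine MemLp.of_bound ((hc'.mono Set.Ioc_subset_Icc_self).aestronglyMeasurable
      measurableSet_Ioc) M ?_
    rw [ae_restrict_iff' measurableSet_Ioc]
    exact ae_of_all _ fun s hs => hM s (Set.Ioc_subset_Icc_self hs)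
  -- The constant corrects mode 0, where the factor jωk vanishes and the hypothesis says nothing
  -- about x. In the other modes this factor can be cancelled.
  refine ⟨phasor T x t 0 - phasor T (fun s => ∫ τ in (t - T)..s, f τ) t 0,
    ae_eq_of_phasor_eq hT hx (hL _) fun k => ?_⟩
  have hI := (intervalIntegrable_window hT).2 ((hL 0).integrable one_le_two)
  simp only [zero_add] at hI
  rw [phasor_add (by simp) hI, phasor_const hT]
  by_cases hk : k = 0
  · subst hk; simp
  · rw [if_neg hk, zero_add]
    have h1 := phasor_deriv hT hprim k
    simp only [zero_add, intervalIntegral.integral_same, sub_zero] at h1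
    have hc : Complex.I * ((2 * Real.pi / T : ℝ) : ℂ) * (k : ℂ) ≠ 0 := by
      have hk' : (k : ℂ) ≠ 0 := by exact_mod_cast hk
      have hpi : (Real.pi : ℂ) ≠ 0 := by exact_mod_cast Real.pi_ne_zero
      have hT' : (T : ℂ) ≠ 0 := by exact_mod_cast hT.ne'
      push_cast
      simp [hk', hT', hpi]
    exact mul_left_cancel₀ hc ((h k).trans h1.symm)

end Scalar

/-! ### Vector signals, `ℓ²(ℂⁿ)` and Toeplitz operators -/

/-- The entries of a real matrix in `ℝ` or `ℂ`. -/
abbrev castMat (𝕜 : Type*) [RCLike 𝕜] {m n : Type*} (A : Matrix m n ℝ) : Matrix m n 𝕜 :=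
  A.map fun a => (a : 𝕜)

section Vector

variable {T : ℝ} {l m n : ℕ}

theorem coords_injective {X Y : EllTwo n} (h : coords X = coords Y) : X = Y := by
  ext k i
  exact congrFun (congrFun h k) i

@[simp] theorem coords_add (X Y : EllTwo n) : coords (X + Y) = coords X + coords Y := rfl
@[simp] theorem coords_sub (X Y : EllTwo n) : coords (X - Y) = coords X - coords Y := rfl
@[simp] theorem coords_neg (X : EllTwo n) : coords (-X) = -coords X := rfl
@[simp] theorem coords_smul (c : ℂ) (X : EllTwo n) : coords (c • X) = c • coords X := rfl

/-- The phasors of the signal `x` over the window ending at `t` form the sequence `X`. -/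
def Represents (T t : ℝ) (x : ℝ → Fin n → ℂ) (X : EllTwo n) : Prop :=
  (∀ i, MemLp (fun s => x s i) 2 (window T t)) ∧ coords X = vecPhasor T x t

theorem exists_represents (hT : 0 < T) (t : ℝ) (X : EllTwo n) : ∃ x, Represents T t x X := by
  have hX : Summable fun k => ‖X k‖ ^ 2 := by
    have := (memℓp_gen_iff (p := 2) (by norm_num)).1 X.2
    simpa using this
  have h : ∀ i, Memℓp (fun k => coords X k i) 2 := fun i => by
    refine memℓp_gen (Summable.of_nonneg_of_le (fun k => by positivity) (fun k => ?_) hX)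
    simp only [ENNReal.toReal_ofNat, Real.rpow_ofNat]
    gcongr
    exact PiLp.norm_apply_le (X k) i
  choose x hx hx' using fun i => exists_phasor_eq hT t (h i)
  refine ⟨fun s i => x i s, hx, ?_⟩
  ext k i
  exact (congrFun (hx' i) k).symm

theorem exists_represented (hT : 0 < T) {t : ℝ} {x : ℝ → Fin n → ℂ}
    (hx : ∀ i, MemLp (fun s => x s i) 2 (window T t)) : ∃ X, Represents T t x X := by
  have h : Memℓp (fun k => (WithLp.toLp 2 (vecPhasor T x t k) : EuclideanSpace ℂ (Fin n))) 2 := by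
    refine memℓp_gen ?_
    simp only [ENNReal.toReal_ofNat, Real.rpow_ofNat, EuclideanSpace.norm_sq_eq]
    refine summable_sum fun i _ => ?_
    have := (hasSum_conj_phasor_mul hT (hx i) (hx i)).summable.norm
    refine this.congr fun k => ?_
    rw [norm_mul, RCLike.norm_conj, ← sq]
    rfl
  exact ⟨⟨_, h⟩, hx, rfl⟩

namespace Represents

variable {t : ℝ} {x y : ℝ → Fin n → ℂ} {X Y : EllTwo n}

theorem intervalIntegrable (hT : 0 < T) (hx : Represents T t x X) (i : Fin n) :
    IntervalIntegrable (fun s => x s i) volume (t - T) t :=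
  (intervalIntegrable_window hT).2 ((hx.1 i).integrable one_le_two)

theorem add (hT : 0 < T) (hx : Represents T t x X) (hy : Represents T t y Y) :
    Represents T t (fun s => x s + y s) (X + Y) := by
  refine ⟨fun i => (hx.1 i).add (hy.1 i), ?_⟩
  ext k i
  rw [coords_add, hx.2, hy.2]
  exact (phasor_add (hx.intervalIntegrable hT i) (hy.intervalIntegrable hT i) k).symm

theorem smul (c : ℂ) (hx : Represents T t x X) :
    Represents T t (fun s => c • x s) (c • X) := by
  refine ⟨fun i => (hx.1 i).const_mul c, ?_⟩
  ext k i
  rw [coords_smul, hx.2]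
  exact (phasor_const_mul c _ t k).symm

theorem neg (hx : Represents T t x X) : Represents T t (fun s => -x s) (-X) := by
  simpa using hx.smul (-1)

theorem sub (hT : 0 < T) (hx : Represents T t x X) (hy : Represents T t y Y) :
    Represents T t (fun s => x s - y s) (X - Y) := by
  simpa only [sub_eq_add_neg] using hx.add hT hy.neg

theorem congr_ae (hT : 0 < T) (hx : Represents T t x X) (h : x =ᵐ[window T t] y) :
    Represents T t y X := by
  have h' : ∀ i, (fun s => x s i) =ᵐ[window T t] fun s => y s i := fun i => by
    filter_upwards [h] with s hs
    rw [hs]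
  refine ⟨fun i => (hx.1 i).ae_eq (h' i), ?_⟩
  ext k i
  rw [hx.2]
  exact congrFun (phasor_congr_ae hT (h' i)) k

theorem ae_eq (hT : 0 < T) (hx : Represents T t x X) (hy : Represents T t y X) :
    x =ᵐ[window T t] y := by
  have h : ∀ i, ∀ᵐ s ∂(window T t), x s i = y s i := fun i =>
    ae_eq_of_phasor_eq hT (hx.1 i) (hy.1 i)
      fun k => congrFun (congrFun (hx.2.symm.trans hy.2) k) i
  filter_upwards [ae_all_iff.2 h] with s hs
  exact funext hs

theorem integrable_dotProduct (hx : Represents T t x X) (hy : Represents T t y Y) :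
    Integrable (fun s => star (x s) ⬝ᵥ y s) (window T t) := by
  simp only [dotProduct]
  exact integrable_finsetSum _ fun i _ => (hx.1 i).star.integrable_mul (hy.1 i)

theorem inner_eq (hT : 0 < T) (hx : Represents T t x X) (hy : Represents T t y Y) :
    inner ℂ X Y = (1 / (T : ℂ)) * ∫ s in (t - T)..t, star (x s) ⬝ᵥ y s := by
  have h1 := lp.hasSum_inner (𝕜 := ℂ) X Y
  have h2 := hasSum_sum fun i (_ : i ∈ Finset.univ) => hasSum_conj_phasor_mul hT (hx.1 i) (hy.1 i)
  have h3 : (fun k => inner ℂ (X k) (Y k)) = fun k => ∑ i, conj (phasor T (fun s => x s i) t k) *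
      phasor T (fun s => y s i) t k := by
    ext k
    rw [PiLp.inner_apply]
    refine Finset.sum_congr rfl fun i _ => ?_
    have e1 : X k i = phasor T (fun s => x s i) t k := congrFun (congrFun hx.2 k) i
    have e2 : Y k i = phasor T (fun s => y s i) t k := congrFun (congrFun hy.2 k) i
    rw [RCLike.inner_apply, e1, e2, mul_comm]
  rw [h3] at h1
  rw [h1.unique h2, ← Finset.mul_sum]
  congr 1
  simp only [dotProduct]
  rw [intervalIntegral.integral_finsetSum (f := fun i s => star (x s) i * y s i)
    fun i _ => (intervalIntegrable_window hT).2 ((hx.1 i).star.integrable_mul (hy.1 i))]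
  rfl

theorem norm_sq_eq (hT : 0 < T) (hx : Represents T t x X) :
    ‖X‖ ^ 2 = (1 / T) * ∫ s in (t - T)..t, ∑ i, ‖x s i‖ ^ 2 := by
  have h := hx.inner_eq hT hx
  have h1 : ∀ s, star (x s) ⬝ᵥ x s = ((∑ i, ‖x s i‖ ^ 2 : ℝ) : ℂ) := fun s => by
    simp only [dotProduct]
    push_cast
    exact Finset.sum_congr rfl fun i _ => Complex.conj_mul' _
  simp only [h1] at h
  rw [intervalIntegral.integral_ofReal, inner_self_eq_norm_sq_to_K] at h
  change ((‖X‖ : ℝ) : ℂ) ^ 2 = _ at h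
  exact_mod_cast h

end Represents

/-- A Toeplitz operator multiplies the signal by the matrix function that defines it. -/
theorem toeplitzMul_vecPhasor (hT : 0 < T) {t : ℝ} {A : ℝ → Matrix (Fin m) (Fin n) ℂ}
    {x : ℝ → Fin n → ℂ} (hA : ∀ i j, MemLp (fun s => A s i j) 2 (window T t))
    (hx : ∀ i, MemLp (fun s => x s i) 2 (window T t)) :
    toeplitzMul (fun k => Matrix.of fun i j => phasor T (fun s => A s i j) t k)
      (vecPhasor T x t) = vecPhasor T (fun s => A s *ᵥ x s) t := by
  ext k i
  have h : HasSum (fun l => (Matrix.of fun i j => phasor T (fun s => A s i j) t (k - l)) *ᵥ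
      vecPhasor T x t l) (vecPhasor T (fun s => A s *ᵥ x s) t k) := by
    rw [Pi.hasSum]
    intro i
    have h1 := hasSum_sum fun j (_ : j ∈ Finset.univ) => hasSum_phasor_mul hT (hA i j) (hx j) k
    rw [← phasor_sum (x := fun j s => A s i j * x s j) _ fun j _ => (intervalIntegrable_window hT).2
      ((hA i j).integrable_mul (hx j))] at h1
    exact h1
  exact congrFun h.tsum_eq i

theorem memLp_window {p : ℝ≥0∞} {f : ℝ → ℝ} (hf : MemLp f ⊤ volume) (t : ℝ) :
    MemLp (fun s => (f s : ℂ)) p (window T t) :=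
  (hf.restrict (Set.Ioc (t - T) t)).ofReal.mono_exponent le_top

theorem memLp_mulVec {μ : Measure ℝ} {q : ℝ≥0∞} {A : ℝ → Matrix (Fin m) (Fin n) ℂ} {x : ℝ → Fin n → ℂ}
    (hA : ∀ i j, MemLp (fun s => A s i j) ⊤ μ) (hx : ∀ i, MemLp (fun s => x s i) q μ) (i : Fin m) :
    MemLp (fun s => (A s *ᵥ x s) i) q μ := by
  simp only [mulVec, dotProduct]
  exact memLp_finsetSum _ fun j _ => (hx j).mul (hA i j)

theorem matHarmonics_eq (hT : 0 < T) {a : ℝ → Matrix (Fin m) (Fin n) ℝ}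
    (ha : Function.Periodic a T) (t : ℝ) :
    matHarmonics T a = fun k => Matrix.of fun i j => phasor T (fun s => castMat ℂ (a s) i j) t k := by
  ext k i j
  exact phasor_periodic hT (fun s => by simp only [ha s]) _ _ _

theorem toeplitzMul_matHarmonics (hT : 0 < T) {a : ℝ → Matrix (Fin m) (Fin n) ℝ}
    (ha : IsBoundedPeriodic T a) {t : ℝ} {x : ℝ → Fin n → ℂ}
    (hx : ∀ i, MemLp (fun s => x s i) 2 (window T t)) :
    toeplitzMul (matHarmonics T a) (vecPhasor T x t) =
      vecPhasor T (fun s => castMat ℂ (a s) *ᵥ x s) t := by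
  rw [matHarmonics_eq hT ha.1 t]
  exact toeplitzMul_vecPhasor hT (fun i j => memLp_window (ha.2 i j) t) hx

theorem isBoundedPeriodic_const (T : ℝ) (A : Matrix (Fin m) (Fin n) ℝ) :
    IsBoundedPeriodic T fun _ => A :=
  ⟨fun _ => rfl, fun _ _ => memLp_top_const _⟩

theorem vecHarmonics_eq (hT : 0 < T) {x : ℝ → Fin n → ℝ} (hx : Function.Periodic x T) (t : ℝ) :
    vecHarmonics T x = vecPhasor T (fun s i => (x s i : ℂ)) t := by
  ext k i
  exact phasor_periodic hT (fun s => by simp only [hx s]) _ _ _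

theorem exists_bound_of_memLp_top {a : ℝ → Matrix (Fin m) (Fin n) ℝ}
    (ha : ∀ i j, MemLp (fun t => a t i j) ⊤ volume) :
    ∃ C, 0 ≤ C ∧ ∀ᵐ t, ∀ i j, |a t i j| ≤ C := by
  have h : ∀ i j, ∃ C, ∀ᵐ t, |a t i j| ≤ C := fun i j => by
    have h1 := ae_le_eLpNormEssSup (f := fun t => a t i j) (μ := volume)
    have h2 := (ha i j).2
    rw [eLpNorm_exponent_top] at h2
    refine ⟨(eLpNormEssSup (fun t => a t i j) volume).toReal, ?_⟩
    filter_upwards [h1] with t ht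
    have := ENNReal.toReal_mono h2.ne ht
    simpa using this
  choose C hC using h
  refine ⟨∑ i, ∑ j, |C i j|, by positivity, ?_⟩
  have := ae_all_iff.2 fun i => ae_all_iff.2 (hC i)
  filter_upwards [this] with t ht i j
  refine (ht i j).trans ((le_abs_self _).trans ?_)
  refine le_trans ?_ (Finset.single_le_sum (f := fun i => ∑ j, |C i j|)
    (fun i _ => by positivity) (Finset.mem_univ i))
  exact Finset.single_le_sum (f := fun j => |C i j|) (fun i _ => by positivity) (Finset.mem_univ j)

theorem norm_mulVec_sq_le {A : Matrix (Fin m) (Fin n) ℂ} {C : ℝ} (hA : ∀ i j, ‖A i j‖ ≤ C)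
    (x : Fin n → ℂ) : ∑ i, ‖(A *ᵥ x) i‖ ^ 2 ≤ m * (n * C ^ 2) * ∑ j, ‖x j‖ ^ 2 := by
  have h : ∀ i, ‖(A *ᵥ x) i‖ ^ 2 ≤ n * C ^ 2 * ∑ j, ‖x j‖ ^ 2 := fun i => by
    have h1 : ‖(A *ᵥ x) i‖ ≤ ∑ j, C * ‖x j‖ := by
      simp only [mulVec, dotProduct]
      refine (norm_sum_le _ _).trans (Finset.sum_le_sum fun j _ => ?_)
      rw [norm_mul]
      exact mul_le_mul_of_nonneg_right (hA i j) (norm_nonneg _)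
    calc ‖(A *ᵥ x) i‖ ^ 2 ≤ (∑ j, C * ‖x j‖) ^ 2 := by gcongr
      _ ≤ (Finset.univ : Finset (Fin n)).card * ∑ j, (C * ‖x j‖) ^ 2 := sq_sum_le_card_mul_sum_sq
      _ = _ := by simp only [mul_pow, ← Finset.mul_sum, Finset.card_univ, Fintype.card_fin]; ring
  refine (Finset.sum_le_sum fun i _ => h i).trans (le_of_eq ?_)
  simp only [Finset.sum_const, Finset.card_univ, Fintype.card_fin, nsmul_eq_mul]
  ring

/-- The bounded Toeplitz operator of a bounded periodic matrix function. -/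
theorem exists_toeplitz_operator (hT : 0 < T) {a : ℝ → Matrix (Fin m) (Fin n) ℝ}
    (ha : IsBoundedPeriodic T a) :
    ∃ A : EllTwo n →L[ℂ] EllTwo m,
      (∀ X, coords (A X) = toeplitzMul (matHarmonics T a) (coords X)) ∧
      ∀ t x X, Represents T t x X → Represents T t (fun s => castMat ℂ (a s) *ᵥ x s) (A X) := by
  -- Any sequence with the Toeplitz coordinates is represented by the pointwise product. Linearity
  -- and the norm bound are then read off signals, the latter from a pointwise bound and Parseval.
  have hrep : ∀ {t x} {X : EllTwo n} {Y : EllTwo m}, Represents T t x X →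
      coords Y = toeplitzMul (matHarmonics T a) (coords X) →
      Represents T t (fun s => castMat ℂ (a s) *ᵥ x s) Y := fun {t x X Y} hx hY =>
    ⟨memLp_mulVec (fun i j => memLp_window (ha.2 i j) t) hx.1, by
      rw [hY, hx.2, toeplitzMul_matHarmonics hT ha hx.1]⟩
  have hex : ∀ X : EllTwo n, ∃ Y : EllTwo m,
      coords Y = toeplitzMul (matHarmonics T a) (coords X) := fun X => by
    obtain ⟨x, hx⟩ := exists_represents hT T X
    obtain ⟨Y, hY⟩ := exists_represented hT
      (memLp_mulVec (A := fun s => castMat ℂ (a s))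
        (fun i j => memLp_window (T := T) (ha.2 i j) T) hx.1)
    refine ⟨Y, ?_⟩
    rw [hY.2, hx.2, toeplitzMul_matHarmonics hT ha hx.1]
  choose A hA using hex
  have hadd : ∀ X Y, A (X + Y) = A X + A Y := fun X Y => by
    obtain ⟨x, hx⟩ := exists_represents hT T X
    obtain ⟨y, hy⟩ := exists_represents hT T Y
    apply coords_injective
    rw [(hrep (hx.add hT hy) (hA _)).2, ((hrep hx (hA X)).add hT (hrep hy (hA Y))).2]
    simp only [mulVec_add]
  have hsmul : ∀ (c : ℂ) X, A (c • X) = c • A X := fun c X => by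
    obtain ⟨x, hx⟩ := exists_represents hT T X
    apply coords_injective
    rw [(hrep (hx.smul c) (hA _)).2, ((hrep hx (hA X)).smul c).2]
    simp only [mulVec_smul]
  obtain ⟨C, hC0, hC⟩ := exists_bound_of_memLp_top ha.2
  have hbound : ∀ X, ‖A X‖ ≤ Real.sqrt (m * (n * C ^ 2)) * ‖X‖ := fun X => by
    obtain ⟨x, hx⟩ := exists_represents hT T X
    have hAx := hrep hx (hA X)
    refine (pow_le_pow_iff_left₀ (norm_nonneg _) (by positivity) two_ne_zero).1 ?_
    rw [mul_pow, Real.sq_sqrt (by positivity), hAx.norm_sq_eq hT, hx.norm_sq_eq hT]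
    have hint : ∀ {k : ℕ} {z : ℝ → Fin k → ℂ} {Z : EllTwo k}, Represents T T z Z →
        IntervalIntegrable (fun s => ∑ i, ‖z s i‖ ^ 2) volume (T - T) T := fun hz => by
      rw [intervalIntegrable_iff_integrableOn_Ioc_of_le (by linarith)]
      exact integrable_finsetSum _ fun i _ => (hz.1 i).integrable_norm_pow two_ne_zero
    have hmono := intervalIntegral.integral_mono_ae (by linarith) (hint hAx)
      ((hint hx).const_mul (m * (n * C ^ 2))) (by
        filter_upwards [hC] with s hs
        exact norm_mulVec_sq_le (fun i j => by simpa using hs i j) _)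
    rw [intervalIntegral.integral_const_mul] at hmono
    calc _ ≤ (1 / T) * (m * (n * C ^ 2) * ∫ s in (T - T)..T, ∑ i, ‖x s i‖ ^ 2) :=
          mul_le_mul_of_nonneg_left hmono (by positivity)
      _ = _ := by ring
  exact ⟨LinearMap.mkContinuous
    { toFun := A, map_add' := hadd, map_smul' := hsmul } _ hbound, hA,
    fun t x X hx => hrep hx (hA X)⟩

end Vector

/-! ### The discrete Lyapunov equation -/

section Stein

open scoped Matrix.Norms.Operator

variable {n : ℕ}

/-- Every eigenvalue of the real matrix `A` is in the open unit disk. -/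
def IsSchur (A : Matrix (Fin n) (Fin n) ℝ) : Prop :=
  ∀ (μ : ℂ) (v : Fin n → ℂ), v ≠ 0 → castMat ℂ A *ᵥ v = μ • v → ‖μ‖ < 1

/-- Gelfand's formula: with r strictly between the spectral radius and 1, the norms of the powers
are eventually at most r ^ k. The constant K absorbs the finitely many earlier powers. -/
theorem IsSchur.exists_norm_pow_le [NeZero n] {A : Matrix (Fin n) (Fin n) ℝ} (hA : IsSchur A) :
    ∃ K r : ℝ, 0 ≤ K ∧ 0 ≤ r ∧ r < 1 ∧ ∀ k i j, |(A ^ k) i j| ≤ K * r ^ k := by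
  set B : Matrix (Fin n) (Fin n) ℂ := castMat ℂ A with hB
  have hspec : ∀ z ∈ spectrum ℂ B, ‖z‖₊ < 1 := by
    intro z hz
    rw [spectrum.mem_iff, Matrix.isUnit_iff_isUnit_det, isUnit_iff_ne_zero, not_not,
      ← Matrix.exists_mulVec_eq_zero_iff] at hz
    obtain ⟨v, hv, hv'⟩ := hz
    rw [Matrix.sub_mulVec, sub_eq_zero, Algebra.algebraMap_eq_smul_one, Matrix.smul_mulVec,
      Matrix.one_mulVec] at hv'
    exact_mod_cast hA z v hv hv'.symm
  have h1 := spectrum.spectralRadius_lt_of_forall_lt B hspec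
  obtain ⟨r, hr1, hr2⟩ := ENNReal.lt_iff_exists_nnreal_btwn.1 h1
  have hr2' : r < 1 := by exact_mod_cast hr2
  have h2 := (spectrum.pow_nnnorm_pow_one_div_tendsto_nhds_spectralRadius B).eventually_lt_const hr1
  obtain ⟨N, hN⟩ := eventually_atTop.1 (h2.and (eventually_ge_atTop 1))
  have h3 : ∀ k ≥ N, ‖B ^ k‖ ≤ (r : ℝ) ^ k := by
    intro k hk
    obtain ⟨h4, h5⟩ := hN k hk
    have hk0 : (k : ℝ) ≠ 0 := by positivity
    have h6 := ENNReal.rpow_le_rpow h4.le (Nat.cast_nonneg k : (0 : ℝ) ≤ k)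
    rw [← ENNReal.rpow_mul, one_div, inv_mul_cancel₀ hk0, ENNReal.rpow_one, ENNReal.rpow_natCast]
      at h6
    exact_mod_cast h6
  have hent : ∀ k i j, |(A ^ k) i j| ≤ ‖B ^ k‖ := by
    intro k i j
    have h4 : B ^ k = castMat ℂ (A ^ k) :=
      (map_pow (Complex.ofRealHom.mapMatrix (m := Fin n)) A k).symm
    have h5 : |(A ^ k) i j| = ‖(B ^ k) i j‖ := by rw [h4]; simp
    rw [h5]
    have h6 := Matrix.linfty_opNorm_mulVec (B ^ k) (Pi.single j 1)
    rw [Matrix.mulVec_single_one, Pi.norm_single, norm_one, mul_one] at h6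
    exact (norm_le_pi_norm ((B ^ k).col j) i).trans h6
  -- Dividing by r ^ k requires r ≠ 0. When r = 0 the powers beyond N vanish and any rate, here 1/2,
  -- will do.
  rcases eq_or_ne r 0 with hr0 | hr0
  · refine ⟨(∑ k ∈ Finset.range (N + 1), ‖B ^ k‖) * 2 ^ N, 1 / 2, by positivity, by norm_num,
      by norm_num, fun k i j => (hent k i j).trans ?_⟩
    rcases lt_or_ge k (N + 1) with hk | hk
    · have h4 : ‖B ^ k‖ ≤ ∑ k ∈ Finset.range (N + 1), ‖B ^ k‖ :=
        Finset.single_le_sum (f := fun k => ‖B ^ k‖) (fun _ _ => norm_nonneg _)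
          (Finset.mem_range.2 hk)
      have h5 : (1 : ℝ) ≤ 2 ^ N * (1 / 2) ^ k := by
        rw [one_div, inv_pow, ← div_eq_mul_inv, one_le_div (by positivity)]
        exact pow_le_pow_right₀ (by norm_num) (by omega)
      calc ‖B ^ k‖ ≤ (∑ k ∈ Finset.range (N + 1), ‖B ^ k‖) * 1 := by rw [mul_one]; exact h4
        _ ≤ (∑ k ∈ Finset.range (N + 1), ‖B ^ k‖) * (2 ^ N * (1 / 2) ^ k) := by gcongr
        _ = _ := by ring
    · have h4 := h3 k (by omega)
      rw [hr0, NNReal.coe_zero, zero_pow (by omega)] at h4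
      exact h4.trans (by positivity)
  · have hrpos : (0 : ℝ) < r := by positivity
    refine ⟨1 + ∑ k ∈ Finset.range N, ‖B ^ k‖ / r ^ k, r, by positivity, r.2, by exact_mod_cast hr2',
      fun k i j => (hent k i j).trans ?_⟩
    rcases lt_or_ge k N with hk | hk
    · have h4 : ‖B ^ k‖ / r ^ k ≤ ∑ k ∈ Finset.range N, ‖B ^ k‖ / (r : ℝ) ^ k :=
        Finset.single_le_sum (f := fun k => ‖B ^ k‖ / (r : ℝ) ^ k) (fun _ _ => by positivity)
          (Finset.mem_range.2 hk)
      rw [← div_le_iff₀ (by positivity)]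
      linarith
    · refine (h3 k hk).trans ?_
      rw [one_add_mul]
      have : 0 ≤ (∑ k ∈ Finset.range N, ‖B ^ k‖ / (r : ℝ) ^ k) * (r : ℝ) ^ k := by positivity
      linarith

/-- Solution of the discrete Lyapunov equation. -/
theorem IsSchur.exists_stein [NeZero n] {A : Matrix (Fin n) (Fin n) ℝ} (hA : IsSchur A)
    (W : Matrix (Fin n) (Fin n) ℝ) (hW : Wᵀ = W) (hW0 : ∀ x, 0 ≤ x ⬝ᵥ W *ᵥ x) :
    ∃ S : Matrix (Fin n) (Fin n) ℝ, S = W + Aᵀ * S * A ∧ Sᵀ = S ∧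
      ∀ x, x ⬝ᵥ W *ᵥ x ≤ x ⬝ᵥ S *ᵥ x := by
  obtain ⟨K, r, hK, hr0, hr1, hKr⟩ := hA.exists_norm_pow_le
  -- The solution is the sum of these terms. Splitting off the term k = 0 gives the equation, and
  -- since all terms are nonnegative forms it also gives the lower bound by W.
  let M : ℕ → Matrix (Fin n) (Fin n) ℝ := fun k => (A ^ k)ᵀ * W * A ^ k
  have hM : Summable M := by
    refine Pi.summable.2 fun i => Pi.summable.2 fun j => ?_
    simp only [M, Matrix.mul_apply, Matrix.transpose_apply, Finset.sum_mul]
    refine summable_sum fun a _ => summable_sum fun b _ => ?_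
    have hgeo : Summable fun k : ℕ => K * |W b a| * K * (r ^ 2) ^ k :=
      (summable_geometric_of_lt_one (by positivity) (by nlinarith)).mul_left _
    refine Summable.of_norm_bounded hgeo fun k => ?_
    rw [norm_mul, norm_mul, Real.norm_eq_abs, Real.norm_eq_abs, Real.norm_eq_abs]
    calc |(A ^ k) b i| * |W b a| * |(A ^ k) a j| ≤ (K * r ^ k) * |W b a| * (K * r ^ k) := by
          gcongr <;> exact hKr _ _ _
      _ = _ := by ring
  have hquad : ∀ k x, x ⬝ᵥ M k *ᵥ x = (A ^ k *ᵥ x) ⬝ᵥ W *ᵥ (A ^ k *ᵥ x) := fun k x => by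
    simp only [M, ← Matrix.mulVec_mulVec]
    rw [Matrix.dotProduct_mulVec, Matrix.vecMul_transpose]
  have hL : ∀ x, HasSum (fun k => x ⬝ᵥ M k *ᵥ x) (x ⬝ᵥ (∑' k, M k) *ᵥ x) := fun x => by
    let L : Matrix (Fin n) (Fin n) ℝ →+ ℝ :=
      { toFun := fun B => x ⬝ᵥ B *ᵥ x
        map_zero' := by simp
        map_add' := fun B C => by rw [Matrix.add_mulVec, dotProduct_add] }
    have hLc : Continuous L := by
      change Continuous fun B : Matrix (Fin n) (Fin n) ℝ => x ⬝ᵥ B *ᵥ x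
      fun_prop
    exact hM.hasSum.map L hLc
  refine ⟨∑' k, M k, ?_, ?_, fun x => ?_⟩
  · have h1 := hM.tsum_eq_zero_add
    have h2 : ∀ k, M (k + 1) = Aᵀ * M k * A := fun k => by
      simp only [M, pow_succ, Matrix.transpose_mul, mul_assoc]
    have h3 : ∑' k, M (k + 1) = Aᵀ * (∑' k, M k) * A := by
      simp only [h2]
      rw [(hM.mul_left Aᵀ).tsum_mul_right, hM.tsum_mul_left]
    rw [h3] at h1
    simpa [M] using h1
  · rw [Matrix.transpose_tsum]
    congr 1
    ext1 k
    simp only [M, Matrix.transpose_mul, Matrix.transpose_transpose, hW, mul_assoc]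
  · have := (hL x).summable.le_tsum 0 fun k _ => by rw [hquad]; exact hW0 _
    rw [(hL x).tsum_eq] at this
    simpa [M] using this

end Stein

/-- A lower bound of a positive definite quadratic form. -/
theorem PosDef.div_sum_abs_inv_le {n : ℕ} {Q : Matrix (Fin n) (Fin n) ℝ} (hQ : Q.PosDef)
    (x : Fin n → ℝ) : (x ⬝ᵥ x) / (∑ i, ∑ j, |Q⁻¹ i j|) ≤ x ⬝ᵥ Q *ᵥ x := by
  rcases eq_or_ne x 0 with rfl | hx
  · simp
  have hsymm : ∀ u v : Fin n → ℝ, u ⬝ᵥ Q *ᵥ v = v ⬝ᵥ Q *ᵥ u := fun u v => by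
    have h := hQ.1
    rw [Matrix.IsHermitian, Matrix.conjTranspose_eq_transpose_of_trivial] at h
    rw [Matrix.dotProduct_mulVec, ← Matrix.mulVec_transpose, h, dotProduct_comm]
  have hdet : IsUnit Q.det := isUnit_iff_ne_zero.2 hQ.det_pos.ne'
  set w := Q⁻¹ *ᵥ x with hw
  have hQw : Q *ᵥ w = x := by rw [hw, Matrix.mulVec_mulVec, Matrix.mul_nonsing_inv _ hdet,
    Matrix.one_mulVec]
  set α := x ⬝ᵥ Q *ᵥ x with hα
  set β := x ⬝ᵥ x with hβ
  set γ := w ⬝ᵥ x with hγ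
  have hαpos : 0 < α := by simpa using hQ.dotProduct_mulVec_pos hx
  have hβpos : 0 < β := by
    rw [hβ]; exact lt_of_le_of_ne (Finset.sum_nonneg fun i _ => mul_self_nonneg _)
      (Ne.symm (by simpa [dotProduct_self_eq_zero] using hx))
  -- Cauchy–Schwarz for the inner product of Q between x and Q⁻¹x: it gives β² ≤ αγ, and γ is at
  -- most β times the sum of the |Q⁻¹ i j|.
  have h1 : 0 ≤ (β • x - α • w) ⬝ᵥ Q *ᵥ (β • x - α • w) := by
    simpa using hQ.posSemidef.dotProduct_mulVec_nonneg (β • x - α • w)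
  have h2 : (β • x - α • w) ⬝ᵥ Q *ᵥ (β • x - α • w) = α * (α * γ - β ^ 2) := by
    have e1 : w ⬝ᵥ Q *ᵥ x = β := by rw [hsymm, hQw]
    simp only [Matrix.mulVec_sub, Matrix.mulVec_smul, sub_dotProduct, dotProduct_sub,
      smul_dotProduct, dotProduct_smul, hQw, smul_eq_mul, e1, ← hα, ← hβ, ← hγ]
    ring
  rw [h2] at h1
  have h3 : β ^ 2 ≤ α * γ := by nlinarith [nonneg_of_mul_nonneg_right h1 hαpos]
  have hentry : ∀ i j, |x i| * |x j| ≤ β := fun i j => by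
    have hi : ∀ k, x k ^ 2 ≤ β := fun k => by
      rw [sq]
      exact Finset.single_le_sum (f := fun k => x k * x k) (fun _ _ => mul_self_nonneg _)
        (Finset.mem_univ k)
    nlinarith [hi i, hi j, sq_nonneg (|x i| - |x j|), sq_abs (x i), sq_abs (x j)]
  have h4 : γ ≤ (∑ i, ∑ j, |Q⁻¹ i j|) * β := by
    rw [hγ, hw]
    simp only [dotProduct, mulVec, Finset.sum_mul]
    refine Finset.sum_le_sum fun i _ => Finset.sum_le_sum fun j _ => ?_
    calc Q⁻¹ i j * x j * x i ≤ |Q⁻¹ i j * x j * x i| := le_abs_self _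
      _ = |Q⁻¹ i j| * (|x i| * |x j|) := by rw [abs_mul, abs_mul]; ring
      _ ≤ _ := mul_le_mul_of_nonneg_left (hentry i j) (abs_nonneg _)
  set σ := ∑ i, ∑ j, |Q⁻¹ i j|
  have hσ : 0 ≤ σ := by positivity
  refine div_le_of_le_mul₀ hσ hαpos.le ?_
  have h5 : β * β ≤ (α * σ) * β := by nlinarith [mul_le_mul_of_nonneg_left h4 hαpos.le]
  exact le_of_mul_le_mul_right h5 hβpos

/-! ### Floquet theory and the periodic Lyapunov differential equation -/

section PrimitiveMore

variable {E : Type*} [NormedAddCommGroup E] [NormedSpace ℝ E]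

theorem IsPrimitiveOn.comp_add_right {u u' : ℝ → E} {a b c : ℝ}
    (h : IsPrimitiveOn u u' (a + c) (b + c)) :
    IsPrimitiveOn (fun t => u (t + c)) (fun t => u' (t + c)) a b := by
  refine ⟨by simpa using h.1.comp_add_right c, fun t ht => ?_⟩
  have := h.2 (t + c) ⟨by linarith [ht.1], by linarith [ht.2]⟩
  beta_reduce
  rw [this, intervalIntegral.integral_comp_add_right]

theorem IsPrimitiveOn.eq_of_deriv_zero {u : ℝ → E}
    (h : ∀ a b, a ≤ b → IsPrimitiveOn u (fun _ => 0) a b) (t s : ℝ) : u t = u s := by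
  have key : ∀ a b, a ≤ b → u b = u a := fun a b hab => by
    simpa using (h a b hab).2 b ⟨hab, le_rfl⟩
  rcases le_total t s with hts | hts
  · exact (key t s hts).symm
  · exact key s t hts

theorem IsPrimitiveOn.continuous {u u' : ℝ → E} (h : ∀ a b, IsPrimitiveOn u u' a b) :
    Continuous u := by
  rw [continuous_iff_continuousAt]
  intro t
  exact ((h (t - 1) (t + 1)).continuousOn (by linarith)).continuousAt
    (Icc_mem_nhds (by linarith) (by linarith))

end PrimitiveMore

section Floquet

variable {n : ℕ}

theorem aestronglyMeasurable_pi' {μ : Measure ℝ} {𝕜 : Type*} [RCLike 𝕜] {x : ℝ → Fin n → 𝕜}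
    (h : ∀ i, AEStronglyMeasurable (fun s => x s i) μ) : AEStronglyMeasurable x μ :=
  (aemeasurable_pi_lambda x fun i => (h i).aemeasurable).aestronglyMeasurable

theorem exists_linear_solution {F : ℝ → Matrix (Fin n) (Fin n) ℝ}
    (hF : ∀ i j, MemLp (fun t => F t i j) ⊤ volume) (t₀ : ℝ) (y₀ : Fin n → ℝ) :
    ∃ y : ℝ → Fin n → ℝ, y t₀ = y₀ ∧
      ∀ a b i, IsPrimitiveOn (fun t => y t i) (fun t => (F t *ᵥ y t) i) a b := by
  obtain ⟨C, hC0, hC⟩ := exists_bound_of_memLp_top hF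
  obtain ⟨y, -, hy0, hy⟩ := exists_global_solution (fun s y => F s *ᵥ y) (n * C).toNNReal 0
    (fun u hu => aestronglyMeasurable_pi' fun i => by
      simp only [mulVec, dotProduct]
      exact Finset.aestronglyMeasurable_fun_sum _ fun j _ =>
        (hF i j).1.mul ((continuous_apply j).comp hu).aestronglyMeasurable)
    (by
      filter_upwards [hC] with s hs
      refine LipschitzWith.of_dist_le_mul fun x z => ?_
      rw [dist_eq_norm, dist_eq_norm, ← Matrix.mulVec_sub, Real.coe_toNNReal _ (by positivity),
        pi_norm_le_iff_of_nonneg (by positivity)]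
      intro i
      simp only [mulVec, dotProduct]
      refine (norm_sum_le _ _).trans ?_
      calc ∑ j, ‖F s i j * (x - z) j‖ ≤ ∑ _j : Fin n, C * ‖x - z‖ := by
            refine Finset.sum_le_sum fun j _ => ?_
            rw [norm_mul]
            exact mul_le_mul (hs i j) (norm_le_pi_norm _ _) (norm_nonneg _) hC0
        _ = _ := by simp; ring)
    (ae_of_all _ fun s => by simp) t₀ y₀
  exact ⟨y, hy0, fun a b i => (hy a b).clm (ContinuousLinearMap.proj (R := ℝ)
    (φ := fun _ : Fin n => ℝ) i)⟩

/-- `Φ` is the fundamental matrix of `y' = F y` with `Φ 0 = 1`, and `Z` its inverse. -/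
structure IsFundamental (F Φ Z : ℝ → Matrix (Fin n) (Fin n) ℝ) : Prop where
  deriv : ∀ a b i j, IsPrimitiveOn (fun t => Φ t i j) (fun t => (F t * Φ t) i j) a b
  deriv_inv : ∀ a b i j, IsPrimitiveOn (fun t => Z t i j) (fun t => (-(Z t * F t)) i j) a b
  zero : Φ 0 = 1
  inv_mul : ∀ t, Z t * Φ t = 1

/-- The inverse is constructed independently, row by row, from the adjoint equation Z' = −ZF. Then
(ZΦ)' = 0 identifies it as the inverse, so no determinant is needed. -/
theorem exists_isFundamental {F : ℝ → Matrix (Fin n) (Fin n) ℝ}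
    (hF : ∀ i j, MemLp (fun t => F t i j) ⊤ volume) : ∃ Φ Z, IsFundamental F Φ Z := by
  choose φ hφ0 hφ using fun j => exists_linear_solution hF 0 (Pi.single j 1)
  choose ζ hζ0 hζ using fun j => exists_linear_solution (F := fun t => -(F t)ᵀ)
    (fun i j => (hF j i).neg) 0 (Pi.single j 1)
  let Φ : ℝ → Matrix (Fin n) (Fin n) ℝ := fun t => Matrix.of fun i j => φ j t i
  let Z : ℝ → Matrix (Fin n) (Fin n) ℝ := fun t => Matrix.of fun i j => ζ i t j
  have hΦ : ∀ a b i j, IsPrimitiveOn (fun t => Φ t i j) (fun t => (F t * Φ t) i j) a b :=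
    fun a b i j => hφ j a b i
  have hZ : ∀ a b i j, IsPrimitiveOn (fun t => Z t i j) (fun t => (-(Z t * F t)) i j) a b := by
    intro a b i j
    have h := hζ i a b j
    have e : ∀ t, (-(Z t * F t)) i j = (-(F t)ᵀ *ᵥ ζ i t) j := fun t => by
      simp [Z, Matrix.mul_apply, mulVec, dotProduct, mul_comm]
    simp only [e]
    exact h
  have hΦ0 : Φ 0 = 1 := by
    ext i j
    simp [Φ, hφ0, Matrix.one_apply, Pi.single_apply]
  have hZ0 : Z 0 = 1 := by
    ext i j
    simp [Z, hζ0, Matrix.one_apply, Pi.single_apply, eq_comm]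
  refine ⟨Φ, Z, hΦ, hZ, hΦ0, fun t => ?_⟩
  ext i j
  have h : (Z t * Φ t) i j = (Z 0 * Φ 0) i j := by
    refine IsPrimitiveOn.eq_of_deriv_zero (u := fun t => (Z t * Φ t) i j) (fun a b hab => ?_) t 0
    have h := IsPrimitiveOn.matMul (hZ a b) (hΦ a b) hab i j
    have e : ∀ t, (-(Z t * F t) * Φ t + Z t * (F t * Φ t)) i j = 0 := fun t => by
      rw [neg_mul, mul_assoc, neg_add_cancel]; rfl
    simpa only [e] using h
  rw [h, hΦ0, hZ0, mul_one]

namespace IsFundamental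

variable {F Φ Z : ℝ → Matrix (Fin n) (Fin n) ℝ} {T : ℝ}

theorem mul_inv (h : IsFundamental F Φ Z) (t : ℝ) : Φ t * Z t = 1 :=
  mul_eq_one_comm.1 (h.inv_mul t)

theorem continuous (h : IsFundamental F Φ Z) (i j : Fin n) : Continuous fun t => Φ t i j :=
  IsPrimitiveOn.continuous fun a b => h.deriv a b i j

/-- By periodicity of F the product Z(t)Φ(t + T) has zero derivative, so it keeps its value Φ(T) at
t = 0. -/
theorem add_period (h : IsFundamental F Φ Z) (hF : Function.Periodic F T) (t : ℝ) :
    Φ (t + T) = Φ t * Φ T := by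
  have key : Z t * Φ (t + T) = Z 0 * Φ (0 + T) := by
    ext i j
    refine IsPrimitiveOn.eq_of_deriv_zero (u := fun t => (Z t * Φ (t + T)) i j)
      (fun a b hab => ?_) t 0
    have h1 := IsPrimitiveOn.matMul (h.deriv_inv a b)
      (fun i j => (h.deriv (a + T) (b + T) i j).comp_add_right) hab i j
    have e : ∀ t, (-(Z t * F t) * Φ (t + T) + Z t * (F (t + T) * Φ (t + T))) i j = 0 := fun t => by
      rw [neg_mul, mul_assoc, hF t, neg_add_cancel]; rfl
    simpa only [e] using h1
  have h0 : Z 0 = 1 := by simpa [h.zero] using h.inv_mul 0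
  rw [h0, one_mul, zero_add] at key
  rw [← key, ← mul_assoc, h.mul_inv, one_mul]

theorem inv_add_period (h : IsFundamental F Φ Z) (hF : Function.Periodic F T) (t : ℝ) :
    Z (t + T) = Z T * Z t := by
  have h1 : Z T * Z t * Φ (t + T) = 1 := by
    rw [h.add_period hF, mul_assoc, ← mul_assoc (Z t), h.inv_mul, one_mul, h.inv_mul]
  calc Z (t + T) = (Z T * Z t * Φ (t + T)) * Z (t + T) := by rw [h1, one_mul]
    _ = _ := by rw [mul_assoc, h.mul_inv, mul_one]

end IsFundamental

theorem intervalIntegrable_fun_sum {ι E : Type*} [NormedAddCommGroup E] {f : ι → ℝ → E} {a b : ℝ}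
    (s : Finset ι) (h : ∀ i ∈ s, IntervalIntegrable (f i) volume a b) :
    IntervalIntegrable (fun t => ∑ i ∈ s, f i t) volume a b := by
  have h1 := IntervalIntegrable.sum s h
  rwa [show ∑ i ∈ s, f i = fun t => ∑ i ∈ s, f i t by ext t; simp] at h1

theorem intervalIntegrable_of_memLp_top {E : Type*} [NormedAddCommGroup E] {f : ℝ → E}
    (hf : MemLp f ⊤ volume) (a b : ℝ) : IntervalIntegrable f volume a b := by
  have : IsFiniteMeasure (volume.restrict (Set.uIoc a b)) := ⟨by simp [Set.uIoc]⟩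
  exact intervalIntegrable_iff.2 ((hf.restrict _).integrable le_top)

theorem dotProduct_congr_quad (B S : Matrix (Fin n) (Fin n) ℝ) (x : Fin n → ℝ) :
    x ⬝ᵥ (Bᵀ * S * B) *ᵥ x = (B *ᵥ x) ⬝ᵥ S *ᵥ (B *ᵥ x) := by
  simp only [← Matrix.mulVec_mulVec]
  rw [Matrix.dotProduct_mulVec, Matrix.vecMul_transpose]

/-- The matrix `p` solves the periodic Lyapunov differential equation `p' + Fᵀ p + p F + Q = 0`,
is symmetric, and is positive definite uniformly in time. -/
structure IsPeriodicLyapunov (T : ℝ) (F Q p : ℝ → Matrix (Fin n) (Fin n) ℝ) : Prop where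
  periodic : Function.Periodic p T
  symm : ∀ t, (p t)ᵀ = p t
  deriv : ∀ a b i j, IsPrimitiveOn (fun t => p t i j)
    (fun t => (-((F t)ᵀ * p t + p t * F t + Q t)) i j) a b
  coercive : ∃ m > 0, ∀ t x, m * (x ⬝ᵥ x) ≤ x ⬝ᵥ p t *ᵥ x

/-- Since Φ(s) is invertible the integrand is positive almost everywhere; if its integral vanished
it would also be zero almost everywhere on an interval of positive length. -/
theorem integral_quad_pos {T : ℝ} (hT : 0 < T) {F Φ Z Q : ℝ → Matrix (Fin n) (Fin n) ℝ}
    (h : IsFundamental F Φ Z) (hQpos : ∀ᵐ t, (Q t).PosDef) {v : Fin n → ℝ} (hv : v ≠ 0)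
    (hi : IntervalIntegrable (fun s => (Φ s *ᵥ v) ⬝ᵥ Q s *ᵥ (Φ s *ᵥ v)) volume 0 T) :
    0 < ∫ s in (0 : ℝ)..T, (Φ s *ᵥ v) ⬝ᵥ Q s *ᵥ (Φ s *ᵥ v) := by
  have hpos : ∀ᵐ s, 0 < (Φ s *ᵥ v) ⬝ᵥ Q s *ᵥ (Φ s *ᵥ v) := by
    filter_upwards [hQpos] with s hs
    have hne : Φ s *ᵥ v ≠ 0 := fun h0 => hv <| by
      have := congrArg (Z s *ᵥ ·) h0
      simpa [Matrix.mulVec_mulVec, h.inv_mul] using this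
    simpa using hs.dotProduct_mulVec_pos hne
  have hnonneg : 0 ≤ᵐ[volume.restrict (Set.Ioc 0 T)]
      fun s => (Φ s *ᵥ v) ⬝ᵥ Q s *ᵥ (Φ s *ᵥ v) := ae_restrict_of_ae (hpos.mono fun s hs => hs.le)
  refine lt_of_le_of_ne (intervalIntegral.integral_nonneg_of_ae_restrict hT.le
    (ae_restrict_of_ae (hpos.mono fun s hs => hs.le))) fun h0 => ?_
  have h1 := (intervalIntegral.integral_eq_zero_iff_of_le_of_nonneg_ae hT.le hnonneg hi).1 h0.symm
  have h2 : ∀ᵐ s ∂volume.restrict (Set.Ioc 0 T), False := by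
    filter_upwards [h1, ae_restrict_of_ae hpos] with s hs hs'
    exact hs'.ne' hs
  rw [ae_iff] at h2
  simp [hT.not_ge] at h2

/-- The solution is p = Zᵀ(S − J)Z with J(t) = ∫₀ᵗ ΦᵀQΦ. The matrix S plays the role of ∫₀^∞ ΦᵀQΦ
and is obtained from S = J(T) + Φ(T)ᵀ S Φ(T), solvable because Φ(T) is Schur. This equation is
exactly the condition for p to be periodic. -/
theorem exists_isPeriodicLyapunov [NeZero n] {T : ℝ} (hT : 0 < T)
    {F Φ Z Q : ℝ → Matrix (Fin n) (Fin n) ℝ} (hF : IsBoundedPeriodic T F)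
    (h : IsFundamental F Φ Z) (hΨ : IsSchur (Φ T)) (hQ : IsBoundedPeriodic T Q)
    (hQpos : ∀ᵐ t, (Q t).PosDef) : ∃ p, IsPeriodicLyapunov T F Q p := by
  have hQsymm : ∀ᵐ t, (Q t)ᵀ = Q t := hQpos.mono fun t ht => by
    have := ht.1
    rwa [Matrix.IsHermitian, Matrix.conjTranspose_eq_transpose_of_trivial] at this
  let R : ℝ → Matrix (Fin n) (Fin n) ℝ := fun s => (Φ s)ᵀ * Q s * Φ s
  have hRi : ∀ i j a b, IntervalIntegrable (fun s => R s i j) volume a b := by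
    intro i j a b
    simp only [R, Matrix.mul_apply, Matrix.transpose_apply]
    have hQi : ∀ i j, IntervalIntegrable (fun s => Q s i j) volume a b := fun i j =>
      intervalIntegrable_of_memLp_top (hQ.2 i j) a b
    refine intervalIntegrable_fun_sum _ fun k _ => IntervalIntegrable.mul_continuousOn
      (intervalIntegrable_fun_sum _ fun l _ => ?_) (h.continuous k j).continuousOn
    exact (hQi l k).continuousOn_mul (h.continuous l i).continuousOn
  let J : ℝ → Matrix (Fin n) (Fin n) ℝ := fun t => Matrix.of fun i j => ∫ s in (0 : ℝ)..t, R s i j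
  have hJ : ∀ a b i j, IsPrimitiveOn (fun t => J t i j) (fun t => R t i j) a b := fun a b i j =>
    ⟨hRi i j a b, fun t _ => (intervalIntegral.integral_add_adjacent_intervals (hRi i j _ _)
      (hRi i j _ _)).symm⟩
  have hJsymm : ∀ t, (J t)ᵀ = J t := fun t => by
    ext i j
    simp only [J, Matrix.transpose_apply, Matrix.of_apply]
    refine intervalIntegral.integral_congr_ae ?_
    filter_upwards [hQsymm] with s hs _
    have : (R s)ᵀ = R s := by
      simp only [R, Matrix.transpose_mul, Matrix.transpose_transpose, hs, mul_assoc]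
    exact congrFun (congrFun this i) j
  have hRquad : ∀ s x, x ⬝ᵥ R s *ᵥ x = (Φ s *ᵥ x) ⬝ᵥ Q s *ᵥ (Φ s *ᵥ x) := fun s x =>
    dotProduct_congr_quad _ _ _
  have hquadi : ∀ x a b, IntervalIntegrable (fun s => x ⬝ᵥ R s *ᵥ x) volume a b := by
    intro x a b
    simp only [dotProduct, mulVec, Finset.mul_sum]
    exact intervalIntegrable_fun_sum _ fun i _ => intervalIntegrable_fun_sum _ fun j _ =>
      ((hRi i j a b).mul_const _).const_mul _
  have hquad : ∀ x a b, x ⬝ᵥ (J b - J a) *ᵥ x = ∫ s in a..b, x ⬝ᵥ R s *ᵥ x := by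
    intro x a b
    simp only [dotProduct, mulVec, Finset.mul_sum]
    rw [intervalIntegral.integral_finsetSum (f := fun i s => ∑ j, x i * (R s i j * x j))
      fun i _ => intervalIntegrable_fun_sum _ fun j _ => ((hRi i j a b).mul_const _).const_mul _]
    refine Finset.sum_congr rfl fun i _ => ?_
    rw [intervalIntegral.integral_finsetSum (f := fun j s => x i * (R s i j * x j))
      fun j _ => ((hRi i j a b).mul_const _).const_mul _]
    refine Finset.sum_congr rfl fun j _ => ?_
    rw [intervalIntegral.integral_const_mul, intervalIntegral.integral_mul_const]
    congr 2
    exact intervalIntegral.integral_interval_sub_left (hRi i j _ _) (hRi i j _ _)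
  have hJ0 : J 0 = 0 := by ext i j; simp [J]
  have hmono : ∀ x a b, a ≤ b → 0 ≤ x ⬝ᵥ (J b - J a) *ᵥ x := by
    intro x a b hab
    rw [hquad]
    refine intervalIntegral.integral_nonneg_of_ae hab (hQpos.mono fun s hs => ?_)
    simp only [hRquad, Pi.zero_apply]
    simpa using hs.posSemidef.dotProduct_mulVec_nonneg (Φ s *ᵥ x)
  have hWpos : ∀ x, x ≠ 0 → 0 < x ⬝ᵥ J T *ᵥ x := by
    intro x hx
    have := hquad x 0 T
    rw [hJ0, sub_zero] at this
    rw [this]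
    have h1 := hquadi x 0 T
    simp only [hRquad] at h1 ⊢
    exact integral_quad_pos hT h hQpos hx h1
  obtain ⟨S, hS, hSsymm, hSW⟩ := hΨ.exists_stein (J T) (hJsymm T) fun x => by
    simpa [hJ0] using hmono x 0 T hT.le
  -- Both sides have the same derivative, because Φ(s + T) = Φ(s)Φ(T) and Q is periodic, and they
  -- agree at t = 0.
  have hJT : ∀ t, J (t + T) = J T + (Φ T)ᵀ * J t * Φ T := by
    intro t
    have hR : ∀ s, R (s + T) = (Φ T)ᵀ * R s * Φ T := fun s => by
      simp only [R, h.add_period hF.1, hQ.1 s, Matrix.transpose_mul, mul_assoc]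
    have h0 : ∀ i j, J (t + T) i j - (J T + (Φ T)ᵀ * J t * Φ T) i j =
        J (0 + T) i j - (J T + (Φ T)ᵀ * J 0 * Φ T) i j := by
      intro i j
      refine IsPrimitiveOn.eq_of_deriv_zero
        (u := fun t => J (t + T) i j - (J T + (Φ T)ᵀ * J t * Φ T) i j) (fun a b hab => ?_) t 0
      have hc : ∀ (B : Matrix (Fin n) (Fin n) ℝ) i j,
          IsPrimitiveOn (fun _ => B i j) (fun _ => (0 : Matrix (Fin n) (Fin n) ℝ) i j) a b :=
        fun B i j => IsPrimitiveOn.const _ a b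
      have h2 := IsPrimitiveOn.matMul (IsPrimitiveOn.matMul (hc (Φ T)ᵀ) (hJ a b) hab)
        (hc (Φ T)) hab i j
      have h3 := (hJ (a + T) (b + T) i j).comp_add_right.sub ((hc (J T) i j).add h2)
      have e : ∀ s, R (s + T) i j - ((0 : Matrix (Fin n) (Fin n) ℝ) i j +
          (((0 : Matrix (Fin n) (Fin n) ℝ) * J s + (Φ T)ᵀ * R s) * Φ T +
            (Φ T)ᵀ * J s * (0 : Matrix (Fin n) (Fin n) ℝ) : Matrix (Fin n) (Fin n) ℝ) i j) = 0 := fun s => by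
        rw [hR]; simp
      simp only [e] at h3
      exact h3
    ext i j
    have h1 := h0 i j
    rw [hJ0, zero_add, mul_zero, zero_mul, add_zero, sub_self, sub_eq_zero] at h1
    exact h1
  let p : ℝ → Matrix (Fin n) (Fin n) ℝ := fun t => (Z t)ᵀ * (S - J t) * Z t
  have hperiodic : Function.Periodic p T := fun t => by
    have h1 : S - J (t + T) = (Φ T)ᵀ * (S - J t) * Φ T := by
      conv_lhs => rw [hS, hJT]
      rw [Matrix.mul_sub, Matrix.sub_mul]; abel
    simp only [p, h1, h.inv_add_period hF.1 t, Matrix.transpose_mul]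
    have h2 : (Z T)ᵀ * (Φ T)ᵀ = 1 := by
      rw [← Matrix.transpose_mul, h.mul_inv, Matrix.transpose_one]
    calc (Z t)ᵀ * (Z T)ᵀ * ((Φ T)ᵀ * (S - J t) * Φ T) * (Z T * Z t)
        = (Z t)ᵀ * ((Z T)ᵀ * (Φ T)ᵀ) * (S - J t) * (Φ T * Z T) * Z t := by
          simp only [mul_assoc]
      _ = _ := by rw [h2, h.mul_inv, mul_one, mul_one]
  have hpquad : ∀ t x, x ⬝ᵥ p t *ᵥ x = (Z t *ᵥ x) ⬝ᵥ (S - J t) *ᵥ (Z t *ᵥ x) := fun t x =>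
    dotProduct_congr_quad _ _ _
  have hderiv : ∀ a b, a ≤ b → ∀ i j, IsPrimitiveOn (fun t => p t i j)
      (fun t => (-((F t)ᵀ * p t + p t * F t + Q t)) i j) a b := by
    intro a b hab i j
    have hZt : ∀ i j, IsPrimitiveOn (fun t => (Z t)ᵀ i j) (fun t => (-(Z t * F t))ᵀ i j) a b :=
      fun i j => h.deriv_inv a b j i
    have hSJ : ∀ i j, IsPrimitiveOn (fun t => (S - J t) i j) (fun t => (0 - R t) i j) a b :=
      fun i j => (IsPrimitiveOn.const _ a b).sub (hJ a b i j)
    have h1 := IsPrimitiveOn.matMul (IsPrimitiveOn.matMul hZt hSJ hab) (h.deriv_inv a b) hab i j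
    have e : ∀ t, ((-(Z t * F t))ᵀ * (S - J t) + (Z t)ᵀ * (0 - R t)) * Z t +
        (Z t)ᵀ * (S - J t) * -(Z t * F t) = -((F t)ᵀ * p t + p t * F t + Q t) := fun t => by
      have h2 : (Z t)ᵀ * R t * Z t = Q t := by
        have h3 : (Z t)ᵀ * (Φ t)ᵀ = 1 := by
          rw [← Matrix.transpose_mul, h.mul_inv, Matrix.transpose_one]
        calc (Z t)ᵀ * ((Φ t)ᵀ * Q t * Φ t) * Z t
            = ((Z t)ᵀ * (Φ t)ᵀ) * Q t * (Φ t * Z t) := by simp only [mul_assoc]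
          _ = Q t := by rw [h3, h.mul_inv, one_mul, mul_one]
      simp only [p, zero_sub, Matrix.transpose_neg, Matrix.transpose_mul, Matrix.add_mul, neg_mul,
        mul_neg, h2]
      simp only [mul_assoc]
      abel
    simpa only [e] using h1
  have hderiv' : ∀ a b i j, IsPrimitiveOn (fun t => p t i j)
      (fun t => (-((F t)ᵀ * p t + p t * F t + Q t)) i j) a b := by
    intro a b i j
    rcases le_total a b with hab | hab
    · exact hderiv a b hab i j
    · have := hderiv b a hab i j
      refine ⟨this.1.symm, fun t ht => ?_⟩
      have : t = a := le_antisymm (ht.2.trans hab) ht.1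
      subst this
      simp
  refine ⟨p, hperiodic, fun t => ?_, hderiv', ?_⟩
  · simp only [p, Matrix.transpose_mul, Matrix.transpose_transpose, Matrix.transpose_sub, hSsymm,
      hJsymm, mul_assoc]
  · have hpc : Continuous fun z : ℝ × (Fin n → ℝ) => z.2 ⬝ᵥ p z.1 *ᵥ z.2 := by
      have hp' : ∀ i j, Continuous fun z : ℝ × (Fin n → ℝ) => p z.1 i j := fun i j =>
        (IsPrimitiveOn.continuous fun a b => hderiv' a b i j).comp continuous_fst
      simp only [dotProduct, mulVec]
      refine continuous_finsetSum _ fun i _ => Continuous.mul (by fun_prop)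
        (continuous_finsetSum _ fun j _ => (hp' i j).mul (by fun_prop))
    -- Compactness of one period times the unit sphere turns pointwise positivity into a uniform
    -- bound; periodicity and homogeneity then extend it to all times and vectors.
    have hK : IsCompact (Set.Icc 0 T ×ˢ {x : Fin n → ℝ | x ⬝ᵥ x = 1}) := by
      refine isCompact_Icc.prod (Metric.isCompact_of_isClosed_isBounded
        (isClosed_eq (by fun_prop) continuous_const) ?_)
      refine isBounded_iff_forall_norm_le.2 ⟨1, fun x hx => ?_⟩
      rw [pi_norm_le_iff_of_nonneg zero_le_one]
      intro i
      have h1 : x i * x i ≤ 1 := by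
        rw [← (hx : x ⬝ᵥ x = 1)]
        exact Finset.single_le_sum (f := fun k => x k * x k) (fun _ _ => mul_self_nonneg _)
          (Finset.mem_univ i)
      rw [Real.norm_eq_abs, abs_le_one_iff_mul_self_le_one]
      exact h1
    have hppos : ∀ t ∈ Set.Icc 0 T, ∀ x, x ≠ 0 → 0 < x ⬝ᵥ p t *ᵥ x := by
      intro t ht x hx
      rw [hpquad]
      set v := Z t *ᵥ x
      have hv : v ≠ 0 := fun h0 => hx <| by
        have := congrArg (Φ t *ᵥ ·) h0
        simpa [v, Matrix.mulVec_mulVec, h.mul_inv] using this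
      have hΨv : Φ T *ᵥ v ≠ 0 := fun h0 => hv <| by
        have := congrArg (Z T *ᵥ ·) h0
        simpa [Matrix.mulVec_mulVec, h.inv_mul] using this
      -- On [0, T] the first term is a nonnegative form, and the second dominates J(T) evaluated at
      -- Φ(T)v ≠ 0, which is positive.
      have h1 : S - J t = (J T - J t) + (Φ T)ᵀ * S * Φ T := by
        conv_lhs => rw [hS]
        abel
      rw [h1, Matrix.add_mulVec, dotProduct_add, dotProduct_congr_quad]
      have h2 := hmono v t T ht.2
      have h3 := hSW (Φ T *ᵥ v)
      have h4 := hWpos _ hΨv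
      linarith
    have hunit : ∀ x : Fin n → ℝ, x ⬝ᵥ x = 1 → x ≠ 0 := by
      rintro x hx rfl
      simp at hx
    obtain ⟨m, hm, hmK⟩ : ∃ m > 0, ∀ z ∈ Set.Icc 0 T ×ˢ {x : Fin n → ℝ | x ⬝ᵥ x = 1},
        m ≤ z.2 ⬝ᵥ p z.1 *ᵥ z.2 := by
      rcases Set.eq_empty_or_nonempty (Set.Icc 0 T ×ˢ {x : Fin n → ℝ | x ⬝ᵥ x = 1}) with he | hne
      · exact ⟨1, one_pos, fun z hz => by simp [he] at hz⟩
      · obtain ⟨z, hz, hmin⟩ := hK.exists_isMinOn hne hpc.continuousOn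
        exact ⟨_, hppos z.1 hz.1 z.2 (hunit _ hz.2), fun w hw => hmin hw⟩
    refine ⟨m, hm, fun t x => ?_⟩
    obtain ⟨s, hs, hts⟩ := hperiodic.exists_mem_Ico₀ hT t
    rw [hts]
    rcases eq_or_ne x 0 with rfl | hx
    · simp
    have hxx : 0 < x ⬝ᵥ x := lt_of_le_of_ne (Finset.sum_nonneg fun i _ => mul_self_nonneg _)
      (Ne.symm (by simpa [dotProduct_self_eq_zero] using hx))
    set c := (Real.sqrt (x ⬝ᵥ x))⁻¹
    have hc : c * c * (x ⬝ᵥ x) = 1 := by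
      simp only [c]
      rw [← mul_inv, Real.mul_self_sqrt hxx.le, inv_mul_cancel₀ hxx.ne']
    have h1 := hmK (s, c • x) ⟨Set.Ico_subset_Icc_self hs, by
      simp only [Set.mem_ofPred_eq, smul_dotProduct, dotProduct_smul, smul_eq_mul]
      linarith⟩
    simp only [Matrix.mulVec_smul, smul_dotProduct, dotProduct_smul, smul_eq_mul] at h1
    have h2 := mul_le_mul_of_nonneg_right h1 hxx.le
    calc m * (x ⬝ᵥ x) ≤ _ := h2
      _ = (c * c * (x ⬝ᵥ x)) * (x ⬝ᵥ p s *ᵥ x) := by ring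
      _ = _ := by rw [hc, one_mul]

theorem IsPeriodicLyapunov.isBoundedPeriodic {T : ℝ} (hT : 0 < T)
    {F Q p : ℝ → Matrix (Fin n) (Fin n) ℝ} (h : IsPeriodicLyapunov T F Q p) :
    IsBoundedPeriodic T p := by
  refine ⟨h.periodic, fun i j => ?_⟩
  have hc : Continuous fun t => p t i j := IsPrimitiveOn.continuous fun a b => h.deriv a b i j
  obtain ⟨M, hM⟩ := isCompact_Icc.exists_bound_of_continuousOn (s := Set.Icc 0 T) hc.continuousOn
  refine memLp_top_of_bound hc.aestronglyMeasurable M (ae_of_all _ fun t => ?_)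
  obtain ⟨s, hs, hts⟩ := h.periodic.exists_mem_Ico₀ hT t
  rw [hts]
  exact hM s (Set.Ico_subset_Icc_self hs)

end Floquet

/-! ### Real matrices acting on real or complex vectors -/

section Cast

variable {𝕜 : Type*} [RCLike 𝕜] {l m n : Type*}

theorem castMat_mul [Fintype m] (A : Matrix l m ℝ) (B : Matrix m n ℝ) :
    castMat 𝕜 (A * B) = castMat 𝕜 A * castMat 𝕜 B := by
  ext i j; simp [castMat, Matrix.mul_apply]

theorem castMat_add (A B : Matrix m n ℝ) : castMat 𝕜 (A + B) = castMat 𝕜 A + castMat 𝕜 B := by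
  ext i j; simp [castMat]

theorem castMat_neg (A : Matrix m n ℝ) : castMat 𝕜 (-A) = -castMat 𝕜 A := by
  ext i j; simp [castMat]

theorem castMat_one [DecidableEq n] : castMat 𝕜 (1 : Matrix n n ℝ) = 1 := by
  ext i j; simp [castMat, Matrix.one_apply, apply_ite]

theorem castMat_conjTranspose (A : Matrix m n ℝ) : (castMat 𝕜 A)ᴴ = castMat 𝕜 Aᵀ := by
  ext i j; simp [castMat]

variable [Fintype n]

theorem star_castMat_mulVec_dotProduct [Fintype m] (A : Matrix m n ℝ) (x : n → 𝕜) (y : m → 𝕜) :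
    star (castMat 𝕜 A *ᵥ x) ⬝ᵥ y = star x ⬝ᵥ castMat 𝕜 Aᵀ *ᵥ y := by
  rw [Matrix.star_mulVec, castMat_conjTranspose, Matrix.dotProduct_mulVec]

theorem sum_norm_sq_eq (x : n → 𝕜) :
    ∑ i, ‖x i‖ ^ 2 = (fun i => RCLike.re (x i)) ⬝ᵥ (fun i => RCLike.re (x i)) +
      (fun i => RCLike.im (x i)) ⬝ᵥ (fun i => RCLike.im (x i)) := by
  simp only [dotProduct, ← Finset.sum_add_distrib]
  exact Finset.sum_congr rfl fun i _ => RCLike.norm_sq_eq_def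

theorem re_quad_eq (S : Matrix n n ℝ) (x : n → 𝕜) :
    RCLike.re (star x ⬝ᵥ castMat 𝕜 S *ᵥ x) =
      (fun i => RCLike.re (x i)) ⬝ᵥ S *ᵥ (fun i => RCLike.re (x i)) +
      (fun i => RCLike.im (x i)) ⬝ᵥ S *ᵥ (fun i => RCLike.im (x i)) := by
  simp only [dotProduct, mulVec, ← Finset.sum_add_distrib, Finset.mul_sum, map_sum]
  refine Finset.sum_congr rfl fun i _ => Finset.sum_congr rfl fun j _ => ?_
  simp [castMat, RCLike.mul_re, RCLike.mul_im]

theorem le_re_quad {S : Matrix n n ℝ} {m : ℝ} (h : ∀ x, m * (x ⬝ᵥ x) ≤ x ⬝ᵥ S *ᵥ x) (x : n → 𝕜) :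
    m * ∑ i, ‖x i‖ ^ 2 ≤ RCLike.re (star x ⬝ᵥ castMat 𝕜 S *ᵥ x) := by
  rw [sum_norm_sq_eq, re_quad_eq, mul_add]
  exact add_le_add (h _) (h _)

end Cast

/-! ### The harmonic Lyapunov equation -/

section Lyapunov

variable {n : ℕ} {T : ℝ}

/-- The graph of the operator `𝒯(F) - 𝒩`. -/
def floquetGraph (T : ℝ) (F : ℝ → Matrix (Fin n) (Fin n) ℝ) : Set (EllTwo n × EllTwo n) :=
  {p | ∀ k, coords p.2 k = toeplitzMul (matHarmonics T F) (coords p.1) k -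
    frequencyMul T (coords p.1) k}

/-- Rearranged, the graph relation says in phasors that y' = F y − w, with no jump from one period
to the next. -/
theorem mem_floquetGraph_iff {F : ℝ → Matrix (Fin n) (Fin n) ℝ} (hT : 0 < T)
    (hF : IsBoundedPeriodic T F) {y w : ℝ → Fin n → ℂ} {Y W : EllTwo n}
    (hy : Represents T T y Y) (hw : Represents T T w W) :
    (Y, W) ∈ floquetGraph T F ↔ ∀ (k : ℤ) (i : Fin n), Complex.I * ((2 * Real.pi / T : ℝ) : ℂ) * (k : ℂ) *
      phasor T (fun s => y s i) T k =
      phasor T (fun s => (castMat ℂ (F s) *ᵥ y s - w s) i) T k := by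
  have hFy : ∀ i, MemLp (fun s => (castMat ℂ (F s) *ᵥ y s) i) 2 (window T T) :=
    memLp_mulVec (A := fun s => castMat ℂ (F s)) (fun i j => memLp_window (hF.2 i j) T) hy.1
  have hsub : ∀ k i, phasor T (fun s => (castMat ℂ (F s) *ᵥ y s - w s) i) T k =
      phasor T (fun s => (castMat ℂ (F s) *ᵥ y s) i) T k - phasor T (fun s => w s i) T k :=
    fun k i => phasor_sub ((intervalIntegrable_window hT).2 ((hFy i).integrable one_le_two))
      (hw.intervalIntegrable hT i) k
  simp only [floquetGraph, Set.mem_ofPred_eq, hy.2, hw.2, toeplitzMul_matHarmonics hT hF hy.1,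
    hsub]
  refine forall_congr' fun k => ?_
  rw [funext_iff]
  refine forall_congr' fun i => ?_
  simp only [vecPhasor, frequencyMul, Pi.sub_apply, Pi.smul_apply, smul_eq_mul]
  constructor <;> intro h <;> linear_combination h

/-- Mode 0 of the relation says that F y − w has zero mean, so its primitive closes up over the
period. The other modes identify y with that primitive up to a constant and a null set. -/
theorem exists_primitive_of_mem {F : ℝ → Matrix (Fin n) (Fin n) ℝ} (hT : 0 < T)
    (hF : IsBoundedPeriodic T F) {w : ℝ → Fin n → ℂ} {Y W : EllTwo n}
    (hw : Represents T T w W) (h : (Y, W) ∈ floquetGraph T F) :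
    ∃ y, Represents T T y Y ∧ y 0 = y T ∧ ∀ i, IsPrimitiveOn (fun s => y s i)
      (fun s => (castMat ℂ (F s) *ᵥ y s - w s) i) 0 T := by
  obtain ⟨x, hx⟩ := exists_represents hT T Y
  have h1 := (mem_floquetGraph_iff hT hF hx hw).1 h
  set f : ℝ → Fin n → ℂ := fun s => castMat ℂ (F s) *ᵥ x s - w s with hf
  have hfL : ∀ i, MemLp (fun s => f s i) 2 (window T T) := fun i =>
    (memLp_mulVec (A := fun s => castMat ℂ (F s))
      (fun i j => memLp_window (hF.2 i j) T) hx.1 i).sub (hw.1 i)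
  have hfi : ∀ i, IntervalIntegrable (fun s => f s i) volume (T - T) T := fun i =>
    (intervalIntegrable_window hT).2 ((hfL i).integrable one_le_two)
  have hzero : ∀ i, ∫ s in (T - T)..T, f s i = 0 := fun i => by
    have h2 : phasor T (fun s => f s i) T 0 = 0 := by rw [← h1 0 i]; simp
    have hT' : (T : ℂ) ≠ 0 := by exact_mod_cast hT.ne'
    simpa [phasor, hT'] using h2
  choose C hC using fun i => ae_eq_primitive_of_phasor hT (hx.1 i) (hfi i) fun k => by
    rw [h1 k i, hzero i, zero_mul, mul_zero, sub_zero]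
  simp only [sub_self] at hC hfi hzero
  let y : ℝ → Fin n → ℂ := fun s i => C i + ∫ τ in (0 : ℝ)..s, f τ i
  have hxy : x =ᵐ[window T T] y := by
    filter_upwards [ae_all_iff.2 hC] with s hs
    exact funext hs
  refine ⟨y, hx.congr_ae hT hxy, ?_, fun i => ?_⟩
  · ext i
    simp [y, hzero i]
  · refine (IsPrimitiveOn.of_integral (hfi i) (C i)).congr_deriv hT.le ?_
    rw [Filter.EventuallyEq, ae_restrict_iff' measurableSet_Ioc] at hxy
    filter_upwards [hxy] with s hs hs'
    rw [← hs (by simpa using hs')]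

theorem mem_of_primitive {F : ℝ → Matrix (Fin n) (Fin n) ℝ} (hT : 0 < T)
    (hF : IsBoundedPeriodic T F) {y w : ℝ → Fin n → ℂ} {Y W : EllTwo n}
    (hy : Represents T T y Y) (hw : Represents T T w W) (h0 : y 0 = y T)
    (h : ∀ i, IsPrimitiveOn (fun s => y s i)
      (fun s => (castMat ℂ (F s) *ᵥ y s - w s) i) 0 T) : (Y, W) ∈ floquetGraph T F := by
  refine (mem_floquetGraph_iff hT hF hy hw).2 fun k i => ?_
  have h1 := h i
  nth_rw 1 [← sub_self T] at h1
  rw [phasor_deriv hT h1, sub_self, h0]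
  simp

/-- For elements of the domain with periodic representatives y and y₂, the integral of (y₂* p y)'
over a period vanishes. Expanding this derivative with the equation for p leaves the weak form of
the Lyapunov equation. -/
theorem IsPeriodicLyapunov.solvesLyapunov {F Q p : ℝ → Matrix (Fin n) (Fin n) ℝ} (hT : 0 < T)
    (hF : IsBoundedPeriodic T F) (hQ : IsBoundedPeriodic T Q) (hp : IsPeriodicLyapunov T F Q p)
    {P : EllTwo n →L[ℂ] EllTwo n} (hP : ∀ t x X, Represents T t x X →
      Represents T t (fun s => castMat ℂ (p s) *ᵥ x s) (P X)) :
    SolvesLyapunov (floquetGraph T F) (matHarmonics T Q) P := by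
  obtain ⟨𝒬, h𝒬, h𝒬'⟩ := exists_toeplitz_operator hT hQ
  rintro ⟨Y, W⟩ hYW
  refine ⟨-(P W) - 𝒬 Y, ?_, fun k => ?_⟩
  · rintro ⟨Y₂, W₂⟩ hYW₂
    obtain ⟨w, hw⟩ := exists_represents hT T W
    obtain ⟨w₂, hw₂⟩ := exists_represents hT T W₂
    obtain ⟨y, hy, hy0, hyd⟩ := exists_primitive_of_mem hT hF hw hYW
    obtain ⟨y₂, hy₂, hy₂0, hy₂d⟩ := exists_primitive_of_mem hT hF hw₂ hYW₂
    have hPY := hP _ _ _ hy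
    have hR := ((hP _ _ _ hw).neg).sub hT (h𝒬' _ _ _ hy)
    change inner ℂ W₂ (P Y) = inner ℂ Y₂ (-(P W) - 𝒬 Y)
    rw [hw₂.inner_eq hT hPY, hy₂.inner_eq hT hR]
    have hI1 := (intervalIntegrable_window hT).2 (hw₂.integrable_dotProduct hPY)
    have hI2 := (intervalIntegrable_window hT).2 (hy₂.integrable_dotProduct hR)
    rw [← sub_eq_zero, ← mul_sub, ← intervalIntegral.integral_sub hI1 hI2]
    have hpd : ∀ i j, IsPrimitiveOn (fun t => castMat ℂ (p t) i j)
        (fun t => castMat ℂ (-((F t)ᵀ * p t + p t * F t + Q t)) i j) 0 T := fun i j =>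
      (hp.deriv 0 T i j).ofReal
    have hmain := (IsPrimitiveOn.dotProduct (fun i => (hy₂d i).star)
      (IsPrimitiveOn.mulVec hpd hyd hT.le) hT.le).integral_eq hT.le
    have hper : castMat ℂ (p T) = castMat ℂ (p 0) := by
      have := hp.periodic 0
      rw [zero_add] at this
      rw [this]
    simp only [hper, ← hy0, ← hy₂0, sub_self] at hmain
    rw [sub_self, mul_eq_zero]
    right
    rw [← neg_eq_zero, ← intervalIntegral.integral_neg, ← hmain]
    congr 1
    ext s
    change _ = star (castMat ℂ (F s) *ᵥ y₂ s - w₂ s) ⬝ᵥ castMat ℂ (p s) *ᵥ y s + star (y₂ s) ⬝ᵥ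
      (castMat ℂ (-((F s)ᵀ * p s + p s * F s + Q s)) *ᵥ y s +
        castMat ℂ (p s) *ᵥ (castMat ℂ (F s) *ᵥ y s - w s))
    rw [star_sub, sub_dotProduct, star_castMat_mulVec_dotProduct]
    simp only [castMat_neg, castMat_add, castMat_mul, Matrix.neg_mulVec, Matrix.add_mulVec,
      Matrix.mulVec_sub, Matrix.mulVec_mulVec, dotProduct_add, dotProduct_sub, dotProduct_neg]
    ring
  · change coords (-(P W) - 𝒬 Y) k + coords (P W) k + toeplitzMul _ (coords Y) k = 0
    rw [← h𝒬, coords_sub, coords_neg, Pi.sub_apply, Pi.neg_apply]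
    abel

theorem IsPeriodicLyapunov.isSelfAdjoint {F Q p : ℝ → Matrix (Fin n) (Fin n) ℝ} (hT : 0 < T)
    (hp : IsPeriodicLyapunov T F Q p) {P : EllTwo n →L[ℂ] EllTwo n}
    (hP : ∀ t x X, Represents T t x X →
      Represents T t (fun s => castMat ℂ (p s) *ᵥ x s) (P X)) : IsSelfAdjoint P := by
  rw [ContinuousLinearMap.isSelfAdjoint_iff_isSymmetric]
  intro X Y
  obtain ⟨x, hx⟩ := exists_represents hT T X
  obtain ⟨y, hy⟩ := exists_represents hT T Y
  change inner ℂ (P X) Y = inner ℂ X (P Y)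
  rw [(hP _ _ _ hx).inner_eq hT hy, hx.inner_eq hT (hP _ _ _ hy)]
  simp only [star_castMat_mulVec_dotProduct, hp.symm]

theorem Represents.integrable_norm_sq {t : ℝ} {x : ℝ → Fin n → ℂ} {X : EllTwo n} (hT : 0 < T)
    (hx : Represents T t x X) :
    IntervalIntegrable (fun s => ∑ i, ‖x s i‖ ^ 2) volume (t - T) t := by
  rw [intervalIntegrable_iff_integrableOn_Ioc_of_le (by linarith)]
  exact integrable_finsetSum _ fun i _ => (hx.1 i).integrable_norm_pow two_ne_zero

theorem IsPeriodicLyapunov.coercive_operator {F Q p : ℝ → Matrix (Fin n) (Fin n) ℝ} (hT : 0 < T)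
    (hp : IsPeriodicLyapunov T F Q p) {P : EllTwo n →L[ℂ] EllTwo n}
    (hP : ∀ t x X, Represents T t x X →
      Represents T t (fun s => castMat ℂ (p s) *ᵥ x s) (P X)) :
    ∃ m > 0, ∀ X : EllTwo n, m * ‖X‖ ^ 2 ≤ (inner ℂ X (P X)).re := by
  obtain ⟨m, hm, hmp⟩ := hp.coercive
  refine ⟨m, hm, fun X => ?_⟩
  obtain ⟨x, hx⟩ := exists_represents hT T X
  have hI := (intervalIntegrable_window hT).2 (hx.integrable_dotProduct (hP _ _ _ hx))
  have hre := Complex.reCLM.intervalIntegral_comp_comm hI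
  have e : (1 / (T : ℂ)) = ((1 / T : ℝ) : ℂ) := by push_cast; rfl
  rw [hx.inner_eq hT (hP _ _ _ hx), hx.norm_sq_eq hT, e, Complex.re_ofReal_mul]
  rw [← Complex.reCLM_apply, ← hre, mul_left_comm, ← intervalIntegral.integral_const_mul]
  refine mul_le_mul_of_nonneg_left (intervalIntegral.integral_mono (by linarith)
    ((hx.integrable_norm_sq hT).const_mul _) ⟨Complex.reCLM.integrable_comp hI.1,
      Complex.reCLM.integrable_comp hI.2⟩ fun s => ?_) (by positivity)
  exact le_re_quad (hmp s) (x s)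

end Lyapunov

/-! ### Spectrum of the harmonic operator and uniqueness for the Lyapunov equation -/

section Uniqueness

variable {n : ℕ} {T : ℝ}

theorem IsFundamental.castMat_inv_mul {F Φ Z : ℝ → Matrix (Fin n) (Fin n) ℝ}
    (h : IsFundamental F Φ Z) (s : ℝ) : castMat ℂ (Z s) * castMat ℂ (Φ s) = 1 := by
  rw [← castMat_mul, h.inv_mul, castMat_one]

theorem IsFundamental.castMat_mulVec_injective {F Φ Z : ℝ → Matrix (Fin n) (Fin n) ℝ}
    (h : IsFundamental F Φ Z) (s : ℝ) {v : Fin n → ℂ} (hv : castMat ℂ (Φ s) *ᵥ v = 0) : v = 0 := by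
  have := congrArg (castMat ℂ (Z s) *ᵥ ·) hv
  simpa [Matrix.mulVec_mulVec, h.castMat_inv_mul] using this

theorem memLp_window_of_continuous {x : ℝ → ℂ} (hx : Continuous x) (t : ℝ) :
    MemLp x 2 (window T t) := by
  obtain ⟨M, hM⟩ := isCompact_Icc.exists_bound_of_continuousOn (s := Set.Icc (t - T) t)
    hx.continuousOn
  refine MemLp.of_bound hx.aestronglyMeasurable M ?_
  rw [ae_restrict_iff' measurableSet_Ioc]
  exact ae_of_all _ fun s hs => hM s (Set.Ioc_subset_Icc_self hs)

theorem IsFundamental.continuous_mulVec {F Φ Z : ℝ → Matrix (Fin n) (Fin n) ℝ}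
    (h : IsFundamental F Φ Z) (v : Fin n → ℂ) (i : Fin n) :
    Continuous fun s => (castMat ℂ (Φ s) *ᵥ v) i := by
  simp only [mulVec, dotProduct]
  exact continuous_finsetSum _ fun j _ =>
    (Complex.continuous_ofReal.comp (h.continuous i j)).mul continuous_const

theorem IsFundamental.isPrimitiveOn_smul {F Φ Z : ℝ → Matrix (Fin n) (Fin n) ℝ}
    (h : IsFundamental F Φ Z) {a a' : ℝ → ℂ} (ha : ∀ t, HasDerivAt a (a' t) t)
    (ha' : Continuous a') (v : Fin n → ℂ) (i : Fin n) (hT : 0 < T) :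
    IsPrimitiveOn (fun s => (a s • castMat ℂ (Φ s) *ᵥ v) i)
      (fun s => (castMat ℂ (F s) *ᵥ (a s • castMat ℂ (Φ s) *ᵥ v) +
        a' s • castMat ℂ (Φ s) *ᵥ v) i) 0 T := by
  have hΦ : ∀ i j, IsPrimitiveOn (fun t => castMat ℂ (Φ t) i j)
      (fun t => castMat ℂ (F t * Φ t) i j) 0 T := fun i j => (h.deriv 0 T i j).ofReal
  have h1 := (IsPrimitiveOn.of_hasDerivAt ha ha' 0 T).mul
    (IsPrimitiveOn.mulVec hΦ (fun i => IsPrimitiveOn.const (v i) 0 T) hT.le i) hT.le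
  refine h1.congr_deriv hT.le (ae_of_all _ fun s _ => ?_)
  change a' s * (castMat ℂ (Φ s) *ᵥ v) i + a s * (castMat ℂ (F s * Φ s) *ᵥ v +
    castMat ℂ (Φ s) *ᵥ 0) i = _
  have h0 : (castMat ℂ (Φ s) *ᵥ fun _ => (0 : ℂ)) = 0 := Matrix.mulVec_zero _
  simp only [castMat_mul, Matrix.mulVec_zero, Matrix.mulVec_smul, Matrix.mulVec_mulVec,
    Pi.add_apply, Pi.smul_apply, smul_eq_mul, Pi.zero_apply]
  ring

theorem hasDerivAt_exp_mul (z : ℂ) (t : ℝ) :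
    HasDerivAt (fun t : ℝ => Complex.exp (z * t)) (z * Complex.exp (z * t)) t := by
  have h1 : HasDerivAt (fun τ : ℝ => z * (τ : ℂ)) z t := by
    simpa using (Complex.ofRealCLM.hasDerivAt (x := t)).const_mul z
  simpa [mul_comm] using h1.cexp

/-- Floquet multipliers of a Hurwitz harmonic operator lie in the open unit disk. -/
theorem IsFundamental.isSchur {F Φ Z : ℝ → Matrix (Fin n) (Fin n) ℝ} (hT : 0 < T)
    (hF : IsBoundedPeriodic T F) (h : IsFundamental F Φ Z)
    (hM : IsHurwitz (floquetGraph T F)) : IsSchur (Φ T) := by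
  intro μ v hv hμv
  have hμ : μ ≠ 0 := by
    rintro rfl
    rw [zero_smul] at hμv
    exact hv (h.castMat_mulVec_injective T hμv)
  have hT' : (T : ℂ) ≠ 0 := by exact_mod_cast hT.ne'
  -- A Floquet exponent; any branch of the logarithm would do. The signal exp(−zs)Φ(s)v is then
  -- periodic and F y − y' = z y.
  set z : ℂ := Complex.log μ / T with hz
  have hzT : Complex.exp (z * T) = μ := by
    rw [hz, div_mul_cancel₀ _ hT', Complex.exp_log hμ]
  set y : ℝ → Fin n → ℂ := fun s => Complex.exp (-z * s) • castMat ℂ (Φ s) *ᵥ v with hy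
  obtain ⟨Y, hY⟩ := exists_represented (x := y) hT (t := T) fun i =>
    memLp_window_of_continuous ((by fun_prop : Continuous fun s : ℝ => Complex.exp (-z * s)).mul
      (h.continuous_mulVec v i)) T
  have hmem : (Y, z • Y) ∈ floquetGraph T F := by
    refine mem_of_primitive hT hF hY (hY.smul z) ?_ fun i => ?_
    · have h1 : Complex.exp (-z * T) * μ = 1 := by
        rw [← hzT, ← Complex.exp_add]; simp
      simp only [hy, hμv, smul_smul, h1, h.zero, castMat_one, Matrix.one_mulVec]
      simp
    · refine (h.isPrimitiveOn_smul (hasDerivAt_exp_mul (-z)) (by fun_prop) v i hT).congr_deriv hT.le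
        (ae_of_all _ fun s _ => ?_)
      simp only [hy, Pi.add_apply, Pi.sub_apply, Pi.smul_apply, smul_eq_mul]
      ring
  -- A resolvent at z would map 0 to Y, forcing Y = 0, whereas its representative vanishes nowhere.
  have hres : ¬ InResolventSet (floquetGraph T F) z := by
    rintro ⟨R, -, hR⟩
    have h0 := hR _ hmem
    simp only [sub_self, map_zero] at h0
    have hY0 : Represents T T (fun s => (0 : ℂ) • y s) Y := by
      simpa [← h0] using hY.smul 0
    have hae := hY.ae_eq hT hY0
    have hFalse : ∀ᵐ s ∂(window T T), False := by
      filter_upwards [hae] with s hs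
      rw [zero_smul] at hs
      exact hv (h.castMat_mulVec_injective s ((smul_eq_zero_iff_right (Complex.exp_ne_zero _)).1 hs))
    rw [ae_iff] at hFalse
    simp [hT.not_ge] at hFalse
  have hre := hM z hres
  rw [← hzT, Complex.norm_exp, Complex.re_mul_ofReal, Real.exp_lt_one_iff]
  exact mul_neg_of_neg_of_pos hre hT

/-- If `M* D + D M = 0`, then generalized eigenvectors of `M` for eigenvalues in the left half-plane
are orthogonal to the range of `D`. -/
theorem inner_eq_zero_of_mem {E : Type*} [NormedAddCommGroup E] [InnerProductSpace ℂ E]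
    {M : Set (E × E)} (hM : IsHurwitz M) {D : E →L[ℂ] E}
    (hD : ∀ p ∈ M, ∀ q ∈ M, inner ℂ q.2 (D p.1) + inner ℂ q.1 (D p.2) = 0)
    {Y U : E} {z : ℂ} (hz : z.re < 0) (hY : (Y, z • Y + U) ∈ M) (hU : ∀ V, inner ℂ U (D V) = 0)
    (V : E) : inner ℂ Y (D V) = 0 := by
  -- This point has positive real part. Testing the relation at p = (R V, −z̄ R V − V) cancels the
  -- two terms in ⟨Y, D R V⟩ and leaves −⟨Y, D V⟩ = 0.
  have hres : InResolventSet M (-conj z) := by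
    by_contra hn
    have := hM _ hn
    rw [Complex.neg_re, Complex.conj_re] at this
    linarith
  obtain ⟨R, hR, -⟩ := hres
  have h1 := hD _ (hR V) _ hY
  simp only [inner_add_left, inner_smul_left, hU, add_zero, map_sub, map_smul, inner_sub_right,
    inner_smul_right] at h1
  linear_combination -h1

/-- An eigenvector of the map induced on the quotient by S is lifted to v. Its eigenvalue is one of
f itself: otherwise f − μ would be injective, hence onto when restricted to the finite-dimensional
S, and this would put v in S. -/
theorem exists_quotient_eigenvector {n : ℕ} (f : (Fin n → ℂ) →ₗ[ℂ] (Fin n → ℂ))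
    (S : Submodule ℂ (Fin n → ℂ)) (hS : S ≠ ⊤) (hf : ∀ v ∈ S, f v ∈ S) :
    ∃ (μ : ℂ) (v : Fin n → ℂ), v ∉ S ∧ f v - μ • v ∈ S ∧ ∃ w ≠ 0, f w = μ • w := by
  have hnt : Nontrivial ((Fin n → ℂ) ⧸ S) := Submodule.Quotient.nontrivial_iff.2 hS
  obtain ⟨μ, hμ⟩ := Module.End.exists_eigenvalue (S.mapQ S f hf)
  obtain ⟨q, hq⟩ := hμ.exists_hasEigenvector
  obtain ⟨v, rfl⟩ := Submodule.Quotient.mk_surjective S q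
  have hv : v ∉ S := fun h => hq.2 ((Submodule.Quotient.mk_eq_zero S).2 h)
  have hfv : f v - μ • v ∈ S := by
    rw [← Submodule.Quotient.mk_eq_zero, Submodule.Quotient.mk_sub, Submodule.Quotient.mk_smul,
      sub_eq_zero]
    exact hq.apply_eq_smul
  refine ⟨μ, v, hv, hfv, ?_⟩
  by_contra! hno
  let g := f - μ • LinearMap.id
  have hgS : ∀ v ∈ S, g v ∈ S := fun w hw => S.sub_mem (hf w hw) (S.smul_mem _ hw)
  have hinj : Function.Injective g := by
    rw [← LinearMap.ker_eq_bot, LinearMap.ker_eq_bot']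
    intro w hw
    by_contra hw0
    exact hno w hw0 (sub_eq_zero.1 hw)
  have hsurj : Function.Surjective (g.restrict hgS) := by
    rw [← LinearMap.injective_iff_surjective]
    intro a b hab
    exact Subtype.ext (hinj (congrArg Subtype.val hab))
  obtain ⟨w, hw⟩ := hsurj ⟨g v, hfv⟩
  have : g w = g v := congrArg Subtype.val hw
  exact hv (hinj this ▸ w.2)

theorem exists_mem_apply_eq {n : ℕ} {f : (Fin n → ℂ) →ₗ[ℂ] (Fin n → ℂ)}
    (hf : Function.Injective f) {S : Submodule ℂ (Fin n → ℂ)} (hS : ∀ v ∈ S, f v ∈ S)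
    {u : Fin n → ℂ} (hu : u ∈ S) : ∃ w ∈ S, f w = u := by
  have hsurj : Function.Surjective (f.restrict hS) := by
    rw [← LinearMap.injective_iff_surjective]
    intro a b hab
    exact Subtype.ext (hf (congrArg Subtype.val hab))
  obtain ⟨w, hw⟩ := hsurj ⟨u, hu⟩
  exact ⟨w, w.2, congrArg Subtype.val hw⟩

theorem mem_sup_span_singleton_iff {V : Type*} [AddCommGroup V] [Module ℂ V] (S : Submodule ℂ V)
    (v x : V) : x ∈ S ⊔ Submodule.span ℂ {v} ↔ ∃ s ∈ S, ∃ c : ℂ, s + c • v = x := by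
  simp [Submodule.mem_sup, Submodule.mem_span_singleton]

/-- The vectors `v` such that the multiples of `Φ v` are orthogonal to the range of `D`. -/
def orthogonalVectors (T : ℝ) (Φ : ℝ → Matrix (Fin n) (Fin n) ℝ) (D : EllTwo n →L[ℂ] EllTwo n) :
    Submodule ℂ (Fin n → ℂ) where
  carrier := {v | ∀ V x, Represents T T x (D V) →
    ∀ᵐ s ∂(window T T), star (castMat ℂ (Φ s) *ᵥ v) ⬝ᵥ x s = 0}
  add_mem' := fun {v w} hv hw V x hx => by
    filter_upwards [hv V x hx, hw V x hx] with s h1 h2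
    rw [Matrix.mulVec_add, star_add, add_dotProduct, h1, h2, add_zero]
  zero_mem' := fun V x _ => by simp
  smul_mem' := fun c v hv V x hx => by
    filter_upwards [hv V x hx] with s h1
    rw [Matrix.mulVec_smul, star_smul, smul_dotProduct, h1, smul_zero]

/-- One step up a Jordan chain of Φ(T). For each frequency w = jωk the function exp((w − z)s)Φv −
exp(ws)(s/T)Φu is periodic: the term linear in s compensates the contribution of u to the jump. It
is an eigenvector for z − w up to a multiple of Φu, already orthogonal to the range of D, so
`inner_eq_zero_of_mem` applies. Letting k vary kills every Fourier coefficient of exp(−zs)̄ ⟨Φv, x⟩,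
hence the function. -/
theorem orthogonalVectors_step {F Φ Z : ℝ → Matrix (Fin n) (Fin n) ℝ} (hT : 0 < T)
    (hF : IsBoundedPeriodic T F) (h : IsFundamental F Φ Z) (hM : IsHurwitz (floquetGraph T F))
    {D : EllTwo n →L[ℂ] EllTwo n} (hD : ∀ p ∈ floquetGraph T F, ∀ q ∈ floquetGraph T F,
      inner ℂ q.2 (D p.1) + inner ℂ q.1 (D p.2) = 0) {μ : ℂ} (hμ0 : μ ≠ 0) (hμ : ‖μ‖ < 1)
    {u v : Fin n → ℂ} (hu : u ∈ orthogonalVectors T Φ D)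
    (huv : castMat ℂ (Φ T) *ᵥ v = μ • (v + castMat ℂ (Φ T) *ᵥ u)) :
    v ∈ orthogonalVectors T Φ D := by
  have hT' : (T : ℂ) ≠ 0 := by exact_mod_cast hT.ne'
  set z : ℂ := Complex.log μ / T with hz
  have hzT : Complex.exp (z * T) = μ := by
    rw [hz, div_mul_cancel₀ _ hT', Complex.exp_log hμ0]
  have hzre : z.re < 0 := by
    rw [← hzT, Complex.norm_exp, Complex.re_mul_ofReal, Real.exp_lt_one_iff] at hμ
    exact neg_of_mul_neg_left hμ hT.le
  intro V x hx
  have hcont : ∀ {a : ℝ → ℂ}, Continuous a → ∀ w : Fin n → ℂ,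
      ∃ Y, Represents T T (fun s => a s • castMat ℂ (Φ s) *ᵥ w) Y := fun ha w =>
    exists_represented hT fun i => memLp_window_of_continuous (ha.mul (h.continuous_mulVec w i)) T
  have hUzero : ∀ {a : ℝ → ℂ} {U : EllTwo n},
      Represents T T (fun s => a s • castMat ℂ (Φ s) *ᵥ u) U → ∀ V, inner ℂ U (D V) = 0 := by
    intro a U hU V
    obtain ⟨x, hx⟩ := exists_represents hT T (D V)
    rw [hU.inner_eq hT hx, intervalIntegral.integral_of_le (by linarith), mul_eq_zero]
    right
    refine integral_eq_zero_of_ae ?_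
    filter_upwards [hu V x hx] with s hs
    simp [star_smul, smul_dotProduct, hs]
  have hk : ∀ k : ℤ, phasor T (fun s => conj (Complex.exp (-z * s)) *
      (star (castMat ℂ (Φ s) *ᵥ v) ⬝ᵥ x s)) T k = 0 := by
    intro k
    set w : ℂ := Complex.I * ((2 * Real.pi / T : ℝ) : ℂ) * (k : ℂ) with hw
    have hwre : w.re = 0 := by
      have : w = ((2 * Real.pi / T * k : ℝ) : ℂ) * Complex.I := by rw [hw]; push_cast; ring
      rw [this, Complex.re_ofReal_mul, Complex.I_re, mul_zero]
    have hwT : Complex.exp (w * T) = 1 := by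
      have := mode_add_period hT (-k) 0
      simp only [zero_add, Complex.ofReal_zero, mul_zero, neg_zero, Complex.exp_zero] at this
      rw [← this, hw]
      congr 1
      push_cast
      ring
    let a : ℝ → ℂ := fun s => Complex.exp ((w - z) * s)
    let b : ℝ → ℂ := fun s => Complex.exp (w * s) * (s / T)
    let b' : ℝ → ℂ := fun s => w * b s + Complex.exp (w * s) / T
    have ha : ∀ s, HasDerivAt a ((w - z) * a s) s := hasDerivAt_exp_mul (w - z)
    have hac : Continuous a := by fun_prop
    have hbc : Continuous b := by fun_prop
    have hb'c : Continuous b' := by fun_prop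
    have hb : ∀ s, HasDerivAt b (b' s) s := fun s => by
      have h1 : HasDerivAt (fun τ : ℝ => (τ : ℂ) / T) (1 / T) s := by
        simpa using (Complex.ofRealCLM.hasDerivAt (x := s)).div_const (T : ℂ)
      convert! (hasDerivAt_exp_mul w s).mul h1 using 1
      simp only [b', b]
      ring
    obtain ⟨Ya, hYa⟩ := hcont hac v
    obtain ⟨Yb, hYb⟩ := hcont hbc u
    obtain ⟨U, hU⟩ := hcont (hb'c.add (hbc.const_mul (z - w))) u
    have hY := hYa.sub hT hYb
    have hmem : (Ya - Yb, (z - w) • (Ya - Yb) + U) ∈ floquetGraph T F := by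
      refine mem_of_primitive hT hF hY ((hY.smul (z - w)).add hT hU) ?_ fun i => ?_
      · have e1 : Complex.exp ((w - z) * T) * μ = 1 := by
          rw [← hzT, ← Complex.exp_add, ← hwT]; congr 1; ring
        simp only [a, b, huv, smul_smul, e1, h.zero, castMat_one, Matrix.one_mulVec, hwT,
          div_self hT']
        simp
      · refine ((h.isPrimitiveOn_smul ha (by fun_prop) v i hT).sub
          (h.isPrimitiveOn_smul hb hb'c u i hT)).congr_deriv hT.le (ae_of_all _ fun s _ => ?_)
        simp only [Matrix.mulVec_sub, Pi.add_apply, Pi.sub_apply, Pi.smul_apply, smul_eq_mul]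
        ring
    have hzero := inner_eq_zero_of_mem hM hD (by simpa [hwre] using hzre) hmem (hUzero hU) V
    rw [inner_sub_left, hUzero hYb, sub_zero, hYa.inner_eq hT hx] at hzero
    rw [phasor, ← hzero]
    congr 1
    congr 1
    ext s
    rw [star_smul, smul_dotProduct, smul_eq_mul, mul_right_comm]
    congr 1
    simp only [a]
    rw [Complex.star_def, ← Complex.exp_conj, ← Complex.exp_conj, ← Complex.exp_add]
    congr 1
    simp [hw, -Complex.ofReal_mul, -Complex.ofReal_div]
    ring
  have hL2 : MemLp (fun s : ℝ => conj (Complex.exp (-z * s)) *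
      (star (castMat ℂ (Φ s) *ᵥ v) ⬝ᵥ x s)) 2 (window T T) := by
    have hc : ∀ i, Continuous fun s : ℝ =>
        conj (Complex.exp (-z * s)) * star ((castMat ℂ (Φ s) *ᵥ v) i) := fun i =>
      (Complex.continuous_conj.comp (by fun_prop)).mul (h.continuous_mulVec v i).star
    simp only [dotProduct, Finset.mul_sum, ← mul_assoc, Pi.star_apply]
    refine memLp_finsetSum _ fun i _ => ?_
    obtain ⟨M, hM⟩ := isCompact_Icc.exists_bound_of_continuousOn (s := Set.Icc (T - T) T)
      (hc i).continuousOn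
    refine (hx.1 i).of_le_mul (c := M) ((hc i).aestronglyMeasurable.mul (hx.1 i).1) ?_
    rw [ae_restrict_iff' measurableSet_Ioc]
    refine ae_of_all _ fun s hs => ?_
    rw [norm_mul]
    exact mul_le_mul_of_nonneg_right (hM s (Set.Ioc_subset_Icc_self hs)) (norm_nonneg _)
  have hae := ae_eq_of_phasor_eq hT hL2 (y := fun _ => 0) (MemLp.zero) fun k => by
    rw [hk k, phasor_const hT, ite_self]
  filter_upwards [hae] with s hs
  rwa [mul_eq_zero, map_eq_zero, or_iff_right (Complex.exp_ne_zero _)] at hs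

/-- Uniqueness for the homogeneous harmonic Lyapunov equation. -/
theorem eq_zero_of_homogeneous_lyapunov {F Φ Z : ℝ → Matrix (Fin n) (Fin n) ℝ} (hT : 0 < T)
    (hF : IsBoundedPeriodic T F) (h : IsFundamental F Φ Z) (hM : IsHurwitz (floquetGraph T F))
    {D : EllTwo n →L[ℂ] EllTwo n} (hD : ∀ p ∈ floquetGraph T F, ∀ q ∈ floquetGraph T F,
      inner ℂ q.2 (D p.1) + inner ℂ q.1 (D p.2) = 0) : D = 0 := by
  set f : (Fin n → ℂ) →ₗ[ℂ] (Fin n → ℂ) := (castMat ℂ (Φ T)).mulVecLin with hf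
  have hfi : Function.Injective f := by
    rw [← LinearMap.ker_eq_bot, LinearMap.ker_eq_bot']
    exact fun v hv => h.castMat_mulVec_injective T hv
  -- The largest Φ(T)-invariant subspace of orthogonal vectors. If it were proper, a quotient
  -- eigenvector would enlarge it, a contradiction.
  set S : Submodule ℂ (Fin n → ℂ) :=
    sSup {S | S ≤ orthogonalVectors T Φ D ∧ ∀ v ∈ S, f v ∈ S} with hSdef
  have hSO : S ≤ orthogonalVectors T Φ D := sSup_le fun _ hW => hW.1
  have hSf : S ≤ S.comap f := sSup_le fun W hW v hv =>
    (le_sSup hW : W ≤ S) (hW.2 v hv)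
  have htop : S = ⊤ := by
    by_contra hne
    obtain ⟨μ, v, hv, hfv, w, hw, hfw⟩ := exists_quotient_eigenvector f S hne hSf
    have hμ := h.isSchur hT hF hM μ w hw hfw
    have hμ0 : μ ≠ 0 := by
      rintro rfl
      rw [zero_smul] at hfw
      exact hw (h.castMat_mulVec_injective T hfw)
    -- The defect f v − μ v is written as f u' with u' in S, so that u = μ⁻¹u' has the form required
    -- by `orthogonalVectors_step`.
    obtain ⟨u', hu', hfu'⟩ := exists_mem_apply_eq hfi hSf hfv
    have hvO : v ∈ orthogonalVectors T Φ D := by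
      refine orthogonalVectors_step hT hF h hM hD hμ0 hμ (hSO (S.smul_mem μ⁻¹ hu')) ?_
      change f v = μ • (v + f (μ⁻¹ • u'))
      rw [map_smul, hfu', smul_add, smul_smul, mul_inv_cancel₀ hμ0, one_smul]
      abel
    have hle : S ⊔ Submodule.span ℂ {v} ≤ S := by
      refine le_sSup ⟨sup_le hSO ?_, ?_⟩
      · rwa [Submodule.span_singleton_le_iff_mem]
      · intro x hx
        obtain ⟨s, hs, c, rfl⟩ := (mem_sup_span_singleton_iff S v _).1 hx
        have : f (s + c • v) = (f s + c • (f v - μ • v)) + (c * μ) • v := by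
          rw [map_add, map_smul, smul_sub, smul_smul]; abel
        rw [this]
        exact (mem_sup_span_singleton_iff S v _).2
          ⟨_, S.add_mem (hSf hs) (S.smul_mem c hfv), _, rfl⟩
    exact hv (hle (Submodule.mem_sup_right (Submodule.mem_span_singleton_self v)))
  have hall : ∀ v, v ∈ orthogonalVectors T Φ D := fun v => hSO (htop ▸ Submodule.mem_top)
  ext1 V
  obtain ⟨x, hx⟩ := exists_represents hT T (D V)
  -- Orthogonality of x(s) to Φ(s)eᵢ for every basis vector eᵢ means Φ(s)ᵀx(s) = 0, and Φ(s) is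
  -- invertible.
  have hx0 : x =ᵐ[window T T] fun _ => 0 := by
    have h1 : ∀ i, ∀ᵐ s ∂(window T T), star (castMat ℂ (Φ s) *ᵥ Pi.single i 1) ⬝ᵥ x s = 0 :=
      fun i => hall _ V x hx
    filter_upwards [ae_all_iff.2 h1] with s hs
    have h2 : castMat ℂ (Φ s)ᵀ *ᵥ x s = 0 := by
      ext i
      have h3 := hs i
      rw [star_castMat_mulVec_dotProduct, ← Pi.single_star, single_dotProduct] at h3
      simpa using h3
    have h3 := congrArg (castMat ℂ (Z s)ᵀ *ᵥ ·) h2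
    have h4 : castMat ℂ (Z s)ᵀ * castMat ℂ (Φ s)ᵀ = 1 := by
      rw [← castMat_mul, ← Matrix.transpose_mul, h.mul_inv, Matrix.transpose_one, castMat_one]
    simpa [Matrix.mulVec_mulVec, h4] using h3
  have h5 := (hx.congr_ae hT hx0).norm_sq_eq hT
  simpa using h5

/-- The terms in 𝒬 cancel in the difference of two solutions, which therefore satisfies the
homogeneous equation in weak form. -/
theorem SolvesLyapunov.unique {F Φ Z : ℝ → Matrix (Fin n) (Fin n) ℝ} (hT : 0 < T)
    (hF : IsBoundedPeriodic T F) (h : IsFundamental F Φ Z) (hM : IsHurwitz (floquetGraph T F))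
    {q : ℤ → Matrix (Fin n) (Fin n) ℂ} {P P' : EllTwo n →L[ℂ] EllTwo n}
    (hP : SolvesLyapunov (floquetGraph T F) q P) (hP' : SolvesLyapunov (floquetGraph T F) q P') :
    P' = P := by
  rw [← sub_eq_zero]
  refine eq_zero_of_homogeneous_lyapunov hT hF h hM fun p hp r hr => ?_
  obtain ⟨W, hW, hW'⟩ := hP p hp
  obtain ⟨W', hW1, hW1'⟩ := hP' p hp
  have hWW : W' - W = -(P' p.2 - P p.2) := by
    apply coords_injective
    ext1 k
    have h1 := hW' k
    have h2 := hW1' k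
    simp only [coords_sub, coords_neg, Pi.sub_apply, Pi.neg_apply]
    rw [← h2] at h1
    rw [← sub_eq_zero] at h1 ⊢
    rw [← neg_eq_zero, ← h1]
    abel
  have h1 := hW r hr
  have h2 := hW1 r hr
  simp only at h1 h2
  rw [_root_.sub_apply, _root_.sub_apply, inner_sub_right, h1, h2,
    ← inner_sub_right, hWW, inner_neg_right, neg_add_cancel]

end Uniqueness

/-! ### Lyapunov functions of dissipative perturbations -/

section Dissipative

variable {𝕜 : Type*} [RCLike 𝕜] {n : ℕ} {T : ℝ}

/-- The quadratic form of a real symmetric matrix at a real or complex vector. -/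
def quad (S : Matrix (Fin n) (Fin n) ℝ) (x : Fin n → 𝕜) : ℝ :=
  RCLike.re (star x ⬝ᵥ castMat 𝕜 S *ᵥ x)

theorem quad_nonneg {S : Matrix (Fin n) (Fin n) ℝ} (hS : S.PosDef) (x : Fin n → 𝕜) :
    0 ≤ quad S x := by
  have h := le_re_quad (S := S) (m := 0) (fun x => by
    simpa using hS.posSemidef.dotProduct_mulVec_nonneg x) x
  simpa [quad] using h

theorem quad_le {S : Matrix (Fin n) (Fin n) ℝ} {C : ℝ} (hS : ∀ i j, |S i j| ≤ C)
    (x : Fin n → 𝕜) : quad S x ≤ n * C * ∑ i, ‖x i‖ ^ 2 := by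
  have hreal : ∀ x : Fin n → ℝ, -(n * C) * (x ⬝ᵥ x) ≤ x ⬝ᵥ (-S) *ᵥ x := by
    intro x
    have hterm : ∀ i j, x i * (S i j * x j) ≤ C * ((x i * x i + x j * x j) / 2) := fun i j => by
      have h1 : x i * (S i j * x j) ≤ |S i j| * (|x i| * |x j|) := by
        refine (le_abs_self _).trans (le_of_eq ?_)
        rw [abs_mul, abs_mul]; ring
      have h2 : |x i| * |x j| ≤ (x i * x i + x j * x j) / 2 := by
        nlinarith [sq_nonneg (|x i| - |x j|), abs_mul_abs_self (x i), abs_mul_abs_self (x j)]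
      exact h1.trans (mul_le_mul (hS i j) h2 (by positivity) ((abs_nonneg _).trans (hS i j)))
    have hsum : x ⬝ᵥ S *ᵥ x ≤ n * C * (x ⬝ᵥ x) := by
      calc x ⬝ᵥ S *ᵥ x = ∑ i, ∑ j, x i * (S i j * x j) := by
            simp only [dotProduct, mulVec, Finset.mul_sum]
        _ ≤ ∑ i, ∑ j, C * ((x i * x i + x j * x j) / 2) :=
            Finset.sum_le_sum fun i _ => Finset.sum_le_sum fun j _ => hterm i j
        _ = n * C * (x ⬝ᵥ x) := by
            simp only [← Finset.mul_sum, ← Finset.sum_div, Finset.sum_add_distrib, Finset.sum_const,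
              Finset.card_univ, Fintype.card_fin, nsmul_eq_mul, dotProduct]
            simp only [mul_left_comm _ (n : ℝ), ← Finset.mul_sum]
            ring
    rw [Matrix.neg_mulVec, dotProduct_neg]
    linarith
  have h := le_re_quad hreal x
  rw [castMat_neg, Matrix.neg_mulVec, dotProduct_neg, map_neg] at h
  unfold quad
  linarith

theorem IsPeriodicLyapunov.exists_quad_le (hT : 0 < T) {F Q p : ℝ → Matrix (Fin n) (Fin n) ℝ}
    (hp : IsPeriodicLyapunov T F Q p) :
    ∃ M > 0, ∀ t (x : Fin n → 𝕜), quad (p t) x ≤ M * ∑ i, ‖x i‖ ^ 2 := by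
  have h : ∀ i j, ∃ C, ∀ t, |p t i j| ≤ C := fun i j => by
    have hc : Continuous fun t => p t i j := IsPrimitiveOn.continuous fun a b => hp.deriv a b i j
    obtain ⟨M, hM⟩ := isCompact_Icc.exists_bound_of_continuousOn (s := Set.Icc 0 T) hc.continuousOn
    refine ⟨M, fun t => ?_⟩
    obtain ⟨s, hs, hts⟩ := hp.periodic.exists_mem_Ico₀ hT t
    rw [hts]
    exact hM s (Set.Ico_subset_Icc_self hs)
  choose C hC using h
  have hCle : ∀ t i j, |p t i j| ≤ ∑ i, ∑ j, |C i j| := fun t i j => by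
    refine (hC i j t).trans ((le_abs_self _).trans ?_)
    exact (Finset.single_le_sum (f := fun j => |C i j|) (fun j _ => abs_nonneg _)
      (Finset.mem_univ j)).trans (Finset.single_le_sum (f := fun i => ∑ j, |C i j|)
        (fun i _ => by positivity) (Finset.mem_univ i))
  refine ⟨n * (∑ i, ∑ j, |C i j|) + 1, by positivity, fun t x => (quad_le (hCle t) x).trans ?_⟩
  have : 0 ≤ ∑ i, ‖x i‖ ^ 2 := by positivity
  nlinarith

/-- A periodic positive rate bounding a periodic positive definite matrix from below. -/
theorem exists_rate {Q : ℝ → Matrix (Fin n) (Fin n) ℝ} (hQ : IsBoundedPeriodic T Q)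
    (hQpos : ∀ᵐ t, (Q t).PosDef) : ∃ q : ℝ → ℝ, Function.Periodic q T ∧ (∀ t, 0 < q t) ∧
      MemLp q ⊤ volume ∧ ∀ᵐ t, ∀ x : Fin n → 𝕜, q t * ∑ i, ‖x i‖ ^ 2 ≤ quad (Q t) x := by
  -- The quadratic form of Q is bounded below through the entries of Q⁻¹. Adding 1 keeps the rate
  -- positive and at most 1 at every time, including those where Q fails to be positive definite.
  refine ⟨fun t => (1 + ∑ i, ∑ j, |(Q t)⁻¹ i j|)⁻¹, fun t => by simp only [hQ.1 t],
    fun t => by positivity, memLp_top_of_bound ?_ 1 (ae_of_all _ fun t => ?_), ?_⟩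
  · have hm : AEMeasurable (fun t => (fun i j => Q t i j : Fin n → Fin n → ℝ)) volume :=
      aemeasurable_pi_lambda _ fun i => aemeasurable_pi_lambda _ fun j => (hQ.2 i j).1.aemeasurable
    have hid : Continuous fun A : Fin n → Fin n → ℝ => Matrix.of A := continuous_id
    refine AEMeasurable.aestronglyMeasurable (AEMeasurable.inv (AEMeasurable.const_add ?_ 1))
    refine Finset.aemeasurable_fun_sum _ fun i _ => Finset.aemeasurable_fun_sum _ fun j _ => ?_
    simp only [Matrix.inv_def, Matrix.smul_apply, smul_eq_mul, Ring.inverse_eq_inv']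
    have hg : Measurable fun A : Fin n → Fin n → ℝ =>
        |(Matrix.of A).det⁻¹ * (Matrix.of A).adjugate i j| :=
      (hid.matrix_det.measurable.inv.mul (hid.matrix_adjugate.matrix_elem i j).measurable).abs
    exact hg.comp_aemeasurable hm
  · rw [Real.norm_of_nonneg (by positivity)]
    exact inv_le_one_of_one_le₀ (le_add_of_nonneg_right (by positivity))
  · filter_upwards [hQpos] with t ht x
    refine le_re_quad (fun x => ?_) x
    have h1 := PosDef.div_sum_abs_inv_le ht x
    have hxx : 0 ≤ x ⬝ᵥ x := by
      simp only [dotProduct]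
      exact Finset.sum_nonneg fun i _ => mul_self_nonneg _
    set S := ∑ i, ∑ j, |(Q t)⁻¹ i j| with hS
    have hS0 : 0 ≤ S := by positivity
    -- If the sum is zero then Q⁻¹ = 0, so the identity is zero and the only vector is 0; this is
    -- dimension zero.
    rcases hS0.eq_or_lt with h0 | h0
    · have hz : (Q t)⁻¹ = 0 := by
        ext i j
        have h2 := (Finset.sum_eq_zero_iff_of_nonneg fun i _ => by positivity).1 h0.symm i
          (Finset.mem_univ i)
        have h3 := (Finset.sum_eq_zero_iff_of_nonneg fun j _ => abs_nonneg _).1 h2 j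
          (Finset.mem_univ j)
        simpa using h3
      have hx : x = 0 := by
        have h2 := Matrix.nonsing_inv_mul (Q t) (isUnit_iff_ne_zero.2 ht.det_pos.ne')
        rw [hz, zero_mul] at h2
        rw [← Matrix.one_mulVec x, ← h2, Matrix.zero_mulVec]
      simp [hx]
    · refine le_trans ?_ h1
      rw [div_eq_inv_mul]
      exact mul_le_mul_of_nonneg_right (inv_anti₀ h0 (by linarith)) hxx

/-- Dissipation inequality along `y' = F y - N` with `Re ⟨p y, N⟩ ≥ 0`. -/
theorem IsPeriodicLyapunov.quad_add_integral_le {F Q p : ℝ → Matrix (Fin n) (Fin n) ℝ}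
    (hp : IsPeriodicLyapunov T F Q p) {q : ℝ → ℝ} (hq : MemLp q ⊤ volume)
    (hqQ : ∀ᵐ t, ∀ x : Fin n → 𝕜, q t * ∑ i, ‖x i‖ ^ 2 ≤ quad (Q t) x) {a b : ℝ} (hab : a ≤ b)
    {y N : ℝ → Fin n → 𝕜}
    (hy : ∀ i, IsPrimitiveOn (fun s => y s i) (fun s => (castMat 𝕜 (F s) *ᵥ y s - N s) i) a b)
    (hN : ∀ᵐ s, 0 ≤ RCLike.re (star (castMat 𝕜 (p s) *ᵥ y s) ⬝ᵥ N s)) :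
    quad (p b) (y b) + ∫ s in a..b, q s * ∑ i, ‖y s i‖ ^ 2 ≤ quad (p a) (y a) := by
  have hpd : ∀ i j, IsPrimitiveOn (fun t => castMat 𝕜 (p t) i j)
      (fun t => castMat 𝕜 (-((F t)ᵀ * p t + p t * F t + Q t)) i j) a b := fun i j =>
    (hp.deriv a b i j).ofReal
  have hV := (IsPrimitiveOn.dotProduct (fun i => (hy i).star)
    (IsPrimitiveOn.mulVec hpd hy hab) hab).re
  have hmain := hV.integral_eq hab
  have hyc : ContinuousOn (fun s => ∑ i, ‖y s i‖ ^ 2) (Set.uIcc a b) := by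
    rw [Set.uIcc_of_le hab]
    exact continuousOn_finsetSum _ fun i _ => ((hy i).continuousOn hab).norm.pow 2
  have hI : IntervalIntegrable (fun s => q s * ∑ i, ‖y s i‖ ^ 2) volume a b :=
    (intervalIntegrable_of_memLp_top hq a b).mul_continuousOn hyc
  have hle : ∫ s in a..b, _ ≤ ∫ s in a..b, -(q s * ∑ i, ‖y s i‖ ^ 2) :=
    intervalIntegral.integral_mono_ae hab hV.1 hI.neg (by
      filter_upwards [hqQ, hN] with s h1 h2
      -- Along the equation the derivative of y* p y is exactly −y* Q y − 2 Re⟨p y, N⟩: the terms in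
      -- F cancel against p'.
      refine le_trans (le_of_eq ?_) (show -quad (Q s) (y s) -
        2 * RCLike.re (star (castMat 𝕜 (p s) *ᵥ y s) ⬝ᵥ N s) ≤ _ by linarith [h1 (y s)])
      have hc : RCLike.re (star (N s) ⬝ᵥ castMat 𝕜 (p s) *ᵥ y s) =
          RCLike.re (star (castMat 𝕜 (p s) *ᵥ y s) ⬝ᵥ N s) := by
        rw [← RCLike.conj_re (star (N s) ⬝ᵥ castMat 𝕜 (p s) *ᵥ y s), starRingEnd_apply,
          ← Matrix.star_dotProduct_star, star_star, dotProduct_comm]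
      change RCLike.re (star (castMat 𝕜 (F s) *ᵥ y s - N s) ⬝ᵥ castMat 𝕜 (p s) *ᵥ y s +
        star (y s) ⬝ᵥ (castMat 𝕜 (-((F s)ᵀ * p s + p s * F s + Q s)) *ᵥ y s +
          castMat 𝕜 (p s) *ᵥ (castMat 𝕜 (F s) *ᵥ y s - N s))) = _
      rw [star_sub, sub_dotProduct, star_castMat_mulVec_dotProduct, two_mul]
      nth_rw 2 [← hc]
      rw [star_castMat_mulVec_dotProduct, hp.symm, quad]
      simp only [castMat_neg, castMat_add, castMat_mul, Matrix.neg_mulVec, Matrix.add_mulVec,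
        Matrix.mulVec_sub, Matrix.mulVec_mulVec, dotProduct_add, dotProduct_sub, dotProduct_neg,
        map_add, map_sub, map_neg]
      ring)
  rw [hmain, intervalIntegral.integral_neg] at hle
  change quad (p b) (y b) - quad (p a) (y a) ≤ _ at hle
  linarith

/-- Attractivity from the dissipation inequality. -/
theorem tendsto_zero_of_dissipation (hT : 0 < T) {q V W : ℝ → ℝ} {m M t₀ : ℝ}
    (hqT : Function.Periodic q T) (hq0 : ∀ t, 0 < q t) (hq : MemLp q ⊤ volume) (hm : 0 < m)
    (hM : 0 < M) (hW : ∀ t ≥ t₀, 0 ≤ W t) (hmV : ∀ t ≥ t₀, m * W t ≤ V t)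
    (hMV : ∀ t ≥ t₀, V t ≤ M * W t) (hWc : ContinuousOn W (Set.Ici t₀))
    (hV : ∀ a b, t₀ ≤ a → a ≤ b → V b + ∫ s in a..b, q s * W s ≤ V a) :
    Tendsto W atTop (𝓝 0) := by
  have hqi := intervalIntegrable_of_memLp_top hq
  have hanti : ∀ a b, t₀ ≤ a → a ≤ b → V b ≤ V a := fun a b ha hab => by
    have h1 : 0 ≤ ∫ s in a..b, q s * W s :=
      intervalIntegral.integral_nonneg hab fun s hs =>
        mul_nonneg (hq0 s).le (hW s (ha.trans hs.1))
    linarith [hV a b ha hab]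
  have hdiv := hqT.tendsto_atTop_intervalIntegral_of_pos' (hqi 0 T) hq0 hT
  -- If V stayed above ε then W ≥ ε/M throughout, and the dissipated amount would exceed (ε/M)∫q,
  -- which diverges, while V stays positive. Monotonicity of V then makes a small value persist.
  have hsmall : ∀ ε > 0, ∃ t ≥ t₀, V t < ε := by
    intro ε hε
    by_contra! hbig
    have hlow : ∀ t ≥ t₀, ε / M * ∫ s in t₀..t, q s ≤ V t₀ := by
      intro t ht
      have h1 : ε / M * ∫ s in t₀..t, q s ≤ ∫ s in t₀..t, q s * W s := by
        rw [← intervalIntegral.integral_const_mul]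
        refine intervalIntegral.integral_mono_on ht ((hqi _ _).const_mul _)
          ((hqi _ _).mul_continuousOn (hWc.mono ?_)) fun s hs => ?_
        · rw [Set.uIcc_of_le ht]; exact Set.Icc_subset_Ici_self
        · rw [mul_comm]
          refine mul_le_mul_of_nonneg_left ?_ (hq0 s).le
          rw [div_le_iff₀' hM]
          exact (hbig s hs.1).trans (hMV s hs.1)
      have h2 := hV t₀ t le_rfl ht
      have h3 := hbig t ht
      linarith
    have hdiv' : Tendsto (fun t => ∫ s in t₀..t, q s) atTop atTop := by
      have : (fun t => ∫ s in t₀..t, q s) =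
          fun t => (∫ s in (0 : ℝ)..t, q s) + -∫ s in (0 : ℝ)..t₀, q s := by
        ext t
        rw [← intervalIntegral.integral_interval_sub_left (hqi 0 t) (hqi 0 t₀)]
        ring
      rw [this]
      exact tendsto_atTop_add_const_right _ _ hdiv
    have hdiv2 := hdiv'.const_mul_atTop (div_pos hε hM)
    obtain ⟨t, ht, ht'⟩ := ((hdiv2.eventually_gt_atTop (V t₀)).and (eventually_ge_atTop t₀)).exists
    exact absurd (hlow t ht') (not_le.2 ht)
  rw [Metric.tendsto_atTop]
  intro ε hε
  obtain ⟨t, ht, hVt⟩ := hsmall (m * ε) (by positivity)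
  refine ⟨t, fun s hs => ?_⟩
  have hs' : t₀ ≤ s := le_trans ht hs
  rw [Real.dist_eq, sub_zero, abs_of_nonneg (hW s hs')]
  have := (hmV s hs').trans_lt ((hanti t s ht hs).trans_lt hVt)
  exact lt_of_mul_lt_mul_left this hm.le

end Dissipative

/-! ### Bounded Lipschitz families and global solutions of dissipative equations -/

section Existence

variable {𝕜 : Type*} [RCLike 𝕜] {n : ℕ} {T : ℝ}

/-- Measurable families of functions which are bounded and Lipschitz, uniformly in time. -/
structure IsBoundedLipschitz {E : Type*} [NormedAddCommGroup E] (f : ℝ → E → 𝕜) : Prop where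
  aestronglyMeasurable : ∀ u : ℝ → E, Continuous u → AEStronglyMeasurable (fun s => f s (u s)) volume
  exists_bound : ∃ C ≥ 0, ∀ᵐ s, (∀ y, ‖f s y‖ ≤ C) ∧ ∀ y z, ‖f s y - f s z‖ ≤ C * ‖y - z‖

namespace IsBoundedLipschitz

variable {E : Type*} [NormedAddCommGroup E] {f g : ℝ → E → 𝕜}

theorem add (hf : IsBoundedLipschitz f) (hg : IsBoundedLipschitz g) :
    IsBoundedLipschitz fun s y => f s y + g s y := by
  refine ⟨fun u hu => (hf.1 u hu).add (hg.1 u hu), ?_⟩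
  obtain ⟨C, hC, h1⟩ := hf.2
  obtain ⟨D, hD, h2⟩ := hg.2
  refine ⟨C + D, by positivity, ?_⟩
  filter_upwards [h1, h2] with s h1 h2
  refine ⟨fun y => (norm_add_le _ _).trans (add_le_add (h1.1 y) (h2.1 y)), fun y z => ?_⟩
  rw [add_sub_add_comm, add_mul]
  exact (norm_add_le _ _).trans (add_le_add (h1.2 y z) (h2.2 y z))

theorem mul (hf : IsBoundedLipschitz f) (hg : IsBoundedLipschitz g) :
    IsBoundedLipschitz fun s y => f s y * g s y := by
  refine ⟨fun u hu => (hf.1 u hu).mul (hg.1 u hu), ?_⟩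
  obtain ⟨C, hC, h1⟩ := hf.2
  obtain ⟨D, hD, h2⟩ := hg.2
  refine ⟨2 * (C * D), by positivity, ?_⟩
  filter_upwards [h1, h2] with s h1 h2
  refine ⟨fun y => ?_, fun y z => ?_⟩
  · rw [norm_mul]
    have := mul_le_mul (h1.1 y) (h2.1 y) (norm_nonneg _) hC
    nlinarith [mul_nonneg hC hD]
  · have e : f s y * g s y - f s z * g s z = (f s y - f s z) * g s y + f s z * (g s y - g s z) := by
      ring
    rw [e]
    refine (norm_add_le _ _).trans ?_
    rw [norm_mul, norm_mul]
    have a1 := mul_le_mul (h1.2 y z) (h2.1 y) (norm_nonneg _) (by positivity)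
    have a2 := mul_le_mul (h1.1 z) (h2.2 y z) (norm_nonneg _) hC
    linarith

theorem of_coeff {a : ℝ → 𝕜} (ha : MemLp a ⊤ volume) :
    IsBoundedLipschitz fun s (_ : E) => a s := by
  refine ⟨fun u _ => ha.1, (eLpNormEssSup a volume).toReal, ENNReal.toReal_nonneg, ?_⟩
  have h2 := ha.2
  rw [eLpNorm_exponent_top] at h2
  filter_upwards [ae_le_eLpNormEssSup (f := a) (μ := volume)] with s hs
  refine ⟨fun _ => by simpa using ENNReal.toReal_mono h2.ne hs, fun y z => ?_⟩
  rw [sub_self, norm_zero]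
  exact mul_nonneg ENNReal.toReal_nonneg (norm_nonneg _)

theorem sum {ι : Type*} (t : Finset ι) {f : ι → ℝ → E → 𝕜}
    (h : ∀ i ∈ t, IsBoundedLipschitz (f i)) : IsBoundedLipschitz fun s y => ∑ i ∈ t, f i s y := by
  classical
  induction t using Finset.induction_on with
  | empty => simpa using of_coeff (E := E) (memLp_top_const (0 : 𝕜))
  | insert i t hi ih =>
    simp only [Finset.sum_insert hi]
    exact (h i (by simp)).add (ih fun j hj => h j (by simp [hj]))

theorem star (hf : IsBoundedLipschitz f) : IsBoundedLipschitz fun s y => star (f s y) := by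
  refine ⟨fun u hu => (hf.1 u hu).star, ?_⟩
  obtain ⟨C, hC, h1⟩ := hf.2
  refine ⟨C, hC, h1.mono fun s hs => ⟨fun y => ?_, fun y z => ?_⟩⟩
  · rw [norm_star]; exact hs.1 y
  · rw [← star_sub, norm_star]; exact hs.2 y z

theorem mulVec {m l : ℕ} {A : ℝ → E → Matrix (Fin m) (Fin l) 𝕜} {x : ℝ → E → Fin l → 𝕜}
    (hA : ∀ i j, IsBoundedLipschitz fun s y => A s y i j)
    (hx : ∀ j, IsBoundedLipschitz fun s y => x s y j) (i : Fin m) :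
    IsBoundedLipschitz fun s y => (A s y *ᵥ x s y) i := by
  simp only [Matrix.mulVec, dotProduct]
  exact sum _ fun j _ => (hA i j).mul (hx j)

end IsBoundedLipschitz

/-- The radial retraction onto the ball of radius `R`. -/
def radialRetraction {E : Type*} [NormedAddCommGroup E] [NormedSpace ℝ E] (R : ℝ) (y : E) : E :=
  (R / max R ‖y‖) • y

section Radial

variable {E : Type*} [NormedAddCommGroup E] [NormedSpace ℝ E] {R : ℝ}

theorem radialRetraction_eq_self (hR : 0 < R) {y : E} (hy : ‖y‖ ≤ R) : radialRetraction R y = y := by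
  rw [radialRetraction, max_eq_left hy, div_self hR.ne', one_smul]

theorem norm_radialRetraction_le (hR : 0 < R) (y : E) : ‖radialRetraction R y‖ ≤ R := by
  have h : 0 < max R ‖y‖ := lt_max_of_lt_left hR
  rw [radialRetraction, norm_smul, Real.norm_of_nonneg (by positivity), div_mul_eq_mul_div,
    div_le_iff₀ h]
  exact mul_le_mul_of_nonneg_left (le_max_right _ _) hR.le

/-- The change of point and the change of scaling factor each contribute at most ‖y − z‖. The
argument works in any norm, in particular the sup norm used here. -/
theorem norm_radialRetraction_sub_le (hR : 0 < R) (y z : E) :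
    ‖radialRetraction R y - radialRetraction R z‖ ≤ 2 * ‖y - z‖ := by
  set a := max R ‖y‖ with ha
  set b := max R ‖z‖ with hb
  have ha0 : 0 < a := lt_max_of_lt_left hR
  have hb0 : 0 < b := lt_max_of_lt_left hR
  have hab : |b - a| ≤ ‖y - z‖ := by
    rw [ha, hb, abs_sub_comm]
    refine (abs_max_sub_max_le_max R ‖y‖ R ‖z‖).trans ?_
    rw [sub_self, abs_zero, max_eq_right (abs_nonneg _)]
    exact abs_norm_sub_norm_le y z
  have e : radialRetraction R y - radialRetraction R z =
      (R / a) • (y - z) + ((b - a) / a) • radialRetraction R z := by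
    simp only [radialRetraction, ← ha, ← hb, smul_sub, smul_smul]
    rw [← sub_eq_zero]
    rw [show (R / a) • y - (R / b) • z - ((R / a) • y - (R / a) • z + ((b - a) / a * (R / b)) • z) =
      (R / a - R / b - (b - a) / a * (R / b)) • z by module]
    rw [show R / a - R / b - (b - a) / a * (R / b) = 0 by field_simp; ring, zero_smul]
  rw [e]
  refine (norm_add_le _ _).trans ?_
  rw [norm_smul, norm_smul, Real.norm_of_nonneg (by positivity), norm_div, Real.norm_eq_abs,
    Real.norm_of_nonneg ha0.le, two_mul]
  have h1 : R / a ≤ 1 := (div_le_one ha0).2 (le_max_left _ _)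
  refine add_le_add (mul_le_of_le_one_left (norm_nonneg _) h1) ?_
  calc |b - a| / a * ‖radialRetraction R z‖ ≤ ‖y - z‖ / a * R :=
        mul_le_mul (by gcongr) (norm_radialRetraction_le hR z) (norm_nonneg _) (by positivity)
    _ = ‖y - z‖ * (R / a) := by ring
    _ ≤ ‖y - z‖ := mul_le_of_le_one_right (norm_nonneg _) h1

theorem continuous_radialRetraction (hR : 0 < R) :
    Continuous (radialRetraction R : E → E) :=
  (LipschitzWith.of_dist_le_mul (K := 2) fun y z => by
    rw [dist_eq_norm, dist_eq_norm]; exact norm_radialRetraction_sub_le hR y z).continuous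

theorem isBoundedLipschitz_radialRetraction (hR : 0 < R) (i : Fin n) :
    IsBoundedLipschitz fun _ (y : Fin n → 𝕜) => radialRetraction R y i := by
  refine ⟨fun u hu => (((continuous_apply i).comp
    ((continuous_radialRetraction hR).comp hu))).aestronglyMeasurable, max R 2, by positivity,
    ae_of_all _ fun s => ⟨fun y => ?_, fun y z => ?_⟩⟩
  · exact (norm_le_pi_norm _ i).trans ((norm_radialRetraction_le hR y).trans (le_max_left _ _))
  · refine ((norm_le_pi_norm (radialRetraction R y - radialRetraction R z) i).trans
      (norm_radialRetraction_sub_le hR y z)).trans ?_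
    exact mul_le_mul_of_nonneg_right (le_max_right _ _) (norm_nonneg _)

end Radial

theorem norm_sq_le_sum (y : Fin n → 𝕜) : ‖y‖ ^ 2 ≤ ∑ i, ‖y i‖ ^ 2 := by
  have h0 : (0 : ℝ) ≤ ∑ i, ‖y i‖ ^ 2 := by positivity
  refine (Real.le_sqrt (norm_nonneg _) h0).1 ?_
  rw [pi_norm_le_iff_of_nonneg (Real.sqrt_nonneg _)]
  refine fun i => Real.le_sqrt_of_sq_le ?_
  exact Finset.single_le_sum (f := fun i => ‖y i‖ ^ 2) (fun i _ => by positivity) (Finset.mem_univ i)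

theorem sum_le_norm_sq (y : Fin n → 𝕜) : ∑ i, ‖y i‖ ^ 2 ≤ n * ‖y‖ ^ 2 := by
  calc ∑ i, ‖y i‖ ^ 2 ≤ ∑ _i : Fin n, ‖y‖ ^ 2 :=
        Finset.sum_le_sum fun i _ => by gcongr; exact norm_le_pi_norm y i
    _ = _ := by simp

/-- Global forward solutions of `y' = F y - N(t, y)` for a locally Lipschitz `N` with
`Re ⟨p y, N(t, y)⟩ ≥ 0`. -/
theorem IsPeriodicLyapunov.exists_solution (hT : 0 < T) {F Q p : ℝ → Matrix (Fin n) (Fin n) ℝ}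
    (hp : IsPeriodicLyapunov T F Q p) (hF : IsBoundedPeriodic T F) (hQ : IsBoundedPeriodic T Q)
    (hQpos : ∀ᵐ t, (Q t).PosDef) {N : ℝ → (Fin n → 𝕜) → Fin n → 𝕜}
    (hNlip : ∀ R > 0, ∀ i, IsBoundedLipschitz fun s y => N s (radialRetraction R y) i)
    (hN : ∀ᵐ s, ∀ y, 0 ≤ RCLike.re (star (castMat 𝕜 (p s) *ᵥ y) ⬝ᵥ N s y))
    (t₀ : ℝ) (y₀ : Fin n → 𝕜) :
    ∃ y : ℝ → Fin n → 𝕜, Continuous y ∧ y t₀ = y₀ ∧ ∀ b ≥ t₀, ∀ i,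
      IsPrimitiveOn (fun s => y s i) (fun s => (castMat 𝕜 (F s) *ᵥ y s - N s (y s)) i) t₀ b := by
  obtain ⟨q, -, hq0, hq, hqQ⟩ := exists_rate (𝕜 := 𝕜) hQ hQpos
  obtain ⟨m, hm, hmp⟩ := hp.coercive
  obtain ⟨M, hM, hMp⟩ := hp.exists_quad_le (𝕜 := 𝕜) hT
  -- The a priori bound from m|y(t)|² ≤ V(t) ≤ V(t₀) ≤ M|y₀|², plus 1 to keep the radius positive.
  -- The truncated equation is globally Lipschitz, and its solution never leaves this ball.
  set R : ℝ := Real.sqrt (M / m * ∑ i, ‖y₀ i‖ ^ 2) + 1 with hRdef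
  have hR : 0 < R := by positivity
  obtain ⟨CF, hCF0, hCF⟩ := exists_bound_of_memLp_top hF.2
  choose CN hCN0 hCN using fun i => (hNlip R hR i).exists_bound
  have hCN' := ae_all_iff.2 hCN
  set D : ℝ := ∑ i, CN i with hD
  have hD0 : 0 ≤ D := Finset.sum_nonneg fun i _ => hCN0 i
  have hCD : ∀ i, CN i ≤ D := fun i =>
    Finset.single_le_sum (f := CN) (fun i _ => hCN0 i) (Finset.mem_univ i)
  obtain ⟨y, hyc, hy0, hy⟩ := exists_global_solution
    (fun s y => castMat 𝕜 (F s) *ᵥ y - N s (radialRetraction R y)) (n * CF + D).toNNReal D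
    (fun u hu => aestronglyMeasurable_pi' fun i => by
      refine AEStronglyMeasurable.sub ?_ ((hNlip R hR i).1 u hu)
      simp only [mulVec, dotProduct]
      exact Finset.aestronglyMeasurable_fun_sum _ fun j _ =>
        (RCLike.continuous_ofReal.comp_aestronglyMeasurable (hF.2 i j).1).mul
          ((continuous_apply j).comp hu).aestronglyMeasurable)
    (by
      filter_upwards [hCF, hCN'] with s hs hs'
      refine LipschitzWith.of_dist_le_mul fun x z => ?_
      rw [dist_eq_norm, dist_eq_norm, Real.coe_toNNReal _ (by positivity), sub_sub_sub_comm,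
        ← Matrix.mulVec_sub, add_mul]
      refine (norm_sub_le _ _).trans (add_le_add ?_ ?_)
      · rw [pi_norm_le_iff_of_nonneg (by positivity)]
        intro i
        simp only [mulVec, dotProduct]
        refine (norm_sum_le _ _).trans ?_
        calc ∑ j, ‖castMat 𝕜 (F s) i j * (x - z) j‖ ≤ ∑ _j : Fin n, CF * ‖x - z‖ := by
              refine Finset.sum_le_sum fun j _ => ?_
              rw [norm_mul]
              refine mul_le_mul ?_ (norm_le_pi_norm _ _) (norm_nonneg _) hCF0
              simpa using hs i j
          _ = _ := by simp; ring
      · rw [pi_norm_le_iff_of_nonneg (by positivity)]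
        exact fun i => ((hs' i).2 x z).trans (mul_le_mul_of_nonneg_right (hCD i) (norm_nonneg _)))
    (by
      filter_upwards [hCN'] with s hs'
      rw [Matrix.mulVec_zero, zero_sub, norm_neg, pi_norm_le_iff_of_nonneg hD0]
      exact fun i => ((hs' i).1 0).trans (hCD i)) t₀ y₀
  have hyi : ∀ a b i, IsPrimitiveOn (fun s => y s i)
      (fun s => (castMat 𝕜 (F s) *ᵥ y s - N s (radialRetraction R (y s))) i) a b := fun a b i =>
    (hy a b).clm (ContinuousLinearMap.proj (R := ℝ) (φ := fun _ : Fin n => 𝕜) i)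
  -- The retraction multiplies y by a positive scalar, so the truncated nonlinearity stays
  -- dissipative with respect to y itself.
  have hN' : ∀ᵐ s, 0 ≤ RCLike.re (star (castMat 𝕜 (p s) *ᵥ y s) ⬝ᵥ
      N s (radialRetraction R (y s))) := by
    filter_upwards [hN] with s hs
    have h1 := hs (radialRetraction R (y s))
    have hr : 0 < R / max R ‖y s‖ := div_pos hR (lt_max_of_lt_left hR)
    have e : castMat 𝕜 (p s) *ᵥ radialRetraction R (y s) =
        (R / max R ‖y s‖) • castMat 𝕜 (p s) *ᵥ y s := by
      rw [radialRetraction, Matrix.mulVec_smul]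
    rw [e, star_smul, smul_dotProduct, RCLike.smul_re] at h1
    simp only [star_trivial] at h1
    exact nonneg_of_mul_nonneg_right h1 hr
  have hsmall : ∀ t ≥ t₀, ‖y t‖ ≤ R := by
    intro t ht
    have h1 := hp.quad_add_integral_le hq hqQ ht (hyi t₀ t) hN'
    have h2 : 0 ≤ ∫ s in t₀..t, q s * ∑ i, ‖y s i‖ ^ 2 :=
      intervalIntegral.integral_nonneg ht fun s _ => mul_nonneg (hq0 s).le (by positivity)
    have h3 : m * ∑ i, ‖y t i‖ ^ 2 ≤ quad (p t) (y t) := le_re_quad (hmp t) (y t)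
    have h4 := hMp t₀ (y t₀)
    rw [hy0] at h1 h4
    have h5 : ‖y t‖ ^ 2 ≤ M / m * ∑ i, ‖y₀ i‖ ^ 2 := by
      refine (norm_sq_le_sum _).trans ?_
      rw [div_mul_eq_mul_div, le_div_iff₀ hm]
      linarith
    have h6 := Real.le_sqrt_of_sq_le h5
    linarith
  refine ⟨y, hyc, hy0, fun b hb i => (hyi t₀ b i).congr_deriv hb (ae_of_all _ fun s hs => ?_)⟩
  rw [radialRetraction_eq_self hR (hsmall s hs.1.le)]

end Existence

/-! ### The closed loop in error coordinates -/

namespace Converter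

variable (c : Converter) {𝕜 : Type*} [RCLike 𝕜] {T : ℝ}

/-- Linearity in coordinates, through which integrability, Lipschitz bounds and phasors pass from x
to G(x). -/
theorem G_apply (x : Fin 4 → 𝕜) (i : Fin 4) (j : Fin 3) :
    c.G x i j = ∑ k, c.G (Pi.single k (1 : 𝕜)) i j * x k := by
  fin_cases i <;> fin_cases j <;> simp [G, Fin.sum_univ_four] <;> ring

theorem G_mulVec_ofReal (x : Fin 4 → 𝕜) (d : Fin 3 → ℝ) :
    c.G x *ᵥ (fun i => (d i : 𝕜)) = castMat 𝕜 (c.Ad d) *ᵥ x := by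
  ext i
  fin_cases i <;>
    simp [G, Ad, C33, Matrix.mulVec, dotProduct, Fin.sum_univ_four, Fin.sum_univ_three,
      castMat, map_ofNat] <;> ring

theorem castMat_mulVec_ofReal {m n : Type*} [Fintype n] (A : Matrix m n ℝ) (v : n → ℝ) :
    castMat 𝕜 A *ᵥ (fun i => (v i : 𝕜)) = fun i => ((A *ᵥ v) i : 𝕜) := by
  ext i; simp [Matrix.mulVec, dotProduct, castMat]

/-- The damping injected by the feedback, as a function of the error `y`. -/
def damping (xe : Fin 4 → ℝ) (P : Matrix (Fin 4) (Fin 4) ℝ) (H₁ : Matrix (Fin 3) (Fin 3) ℝ)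
    (y : Fin 4 → 𝕜) : Fin 4 → 𝕜 :=
  c.G ((fun i => (xe i : 𝕜)) + y) *ᵥ (castMat 𝕜 H₁ *ᵥ
    ((c.G ((fun i => (xe i : 𝕜)) + y))ᴴ *ᵥ (castMat 𝕜 P *ᵥ y)))

/-- Right-hand side of the closed loop, for a real or complex state. -/
def closedLoopField (de : Fin 3 → ℝ) (ve xe : Fin 4 → ℝ) (P : Matrix (Fin 4) (Fin 4) ℝ)
    (H₁ : Matrix (Fin 3) (Fin 3) ℝ) (x : Fin 4 → 𝕜) : Fin 4 → 𝕜 :=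
  castMat 𝕜 c.A *ᵥ x + c.G x *ᵥ c.feedback de xe P H₁ x + castMat 𝕜 c.B *ᵥ fun i => (ve i : 𝕜)

/-- Because G(x)dᵉ = A(dᵉ)x, the nominal part of the control is linear in x and joins A. The input
cancels, and only the correction of the feedback remains nonlinear. -/
theorem closedLoopField_sub (de : Fin 3 → ℝ) (ve xe : Fin 4 → ℝ) (P : Matrix (Fin 4) (Fin 4) ℝ)
    (H₁ : Matrix (Fin 3) (Fin 3) ℝ) (x : Fin 4 → 𝕜) :
    c.closedLoopField de ve xe P H₁ x -
        (fun i => (((c.A + c.Ad de) *ᵥ xe + c.B *ᵥ ve) i : 𝕜)) =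
      castMat 𝕜 (c.A + c.Ad de) *ᵥ (x - fun i => (xe i : 𝕜)) -
        c.damping xe P H₁ (x - fun i => (xe i : 𝕜)) := by
  have e : (fun i => (((c.A + c.Ad de) *ᵥ xe + c.B *ᵥ ve) i : 𝕜)) =
      castMat 𝕜 (c.A + c.Ad de) *ᵥ (fun i => (xe i : 𝕜)) + castMat 𝕜 c.B *ᵥ fun i => (ve i : 𝕜) := by
    rw [castMat_mulVec_ofReal, castMat_mulVec_ofReal]
    ext i
    simp
  rw [e, closedLoopField, feedback, damping, add_sub_cancel, Matrix.mulVec_sub (c.G x), G_mulVec_ofReal,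
    castMat_add, Matrix.mulVec_sub (_ + _), Matrix.add_mulVec, Matrix.add_mulVec]
  abel

/-- The pairing is the quadratic form of H₁ at G*Py. This is why the feedback contains G* P. -/
theorem re_damping_nonneg (xe : Fin 4 → ℝ) (P : Matrix (Fin 4) (Fin 4) ℝ)
    {H₁ : Matrix (Fin 3) (Fin 3) ℝ} (hH : H₁.PosDef) (y : Fin 4 → 𝕜) :
    0 ≤ RCLike.re (star (castMat 𝕜 P *ᵥ y) ⬝ᵥ c.damping xe P H₁ y) := by
  have h := quad_nonneg hH ((c.G ((fun i => (xe i : 𝕜)) + y))ᴴ *ᵥ (castMat 𝕜 P *ᵥ y))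
  rw [quad, Matrix.star_mulVec, Matrix.conjTranspose_conjTranspose, ← Matrix.dotProduct_mulVec] at h
  exact h

theorem isBoundedPeriodic_Ad {de : ℝ → Fin 3 → ℝ}
    (hde : ∀ i, MemLp (fun t => de t i) ⊤ volume) (hdeT : Function.Periodic de T) :
    IsBoundedPeriodic T fun t => c.Ad (de t) := by
  refine ⟨fun t => by simp only [hdeT t], fun i j => ?_⟩
  have hC : ∀ i, MemLp (fun t => -(C33 ℝ *ᵥ de t) i / c.L) ⊤ volume := fun i => by
    simp only [Matrix.mulVec, dotProduct, div_eq_inv_mul]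
    exact (memLp_finsetSum _ fun j _ => (hde j).const_mul _).neg.const_mul _
  have hd : ∀ i, MemLp (fun t => de t i / c.C) ⊤ volume := fun i => by
    simp only [div_eq_inv_mul]
    exact (hde i).const_mul _
  have h0 : MemLp (fun _ : ℝ => (0 : ℝ)) ⊤ volume := memLp_top_const _
  fin_cases i <;> fin_cases j
  exacts [h0, h0, h0, hC 0, h0, h0, h0, hC 1, h0, h0, h0, hC 2, hd 0, hd 1, hd 2, h0]

theorem isBoundedPeriodic_A_add_Ad {de : ℝ → Fin 3 → ℝ}
    (hde : ∀ i, MemLp (fun t => de t i) ⊤ volume) (hdeT : Function.Periodic de T) :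
    IsBoundedPeriodic T fun t => c.A + c.Ad (de t) :=
  ⟨fun t => by simp only [hdeT t], fun i j =>
    (memLp_top_const (c.A i j)).add ((c.isBoundedPeriodic_Ad hde hdeT).2 i j)⟩

theorem memLp_top_of_continuous_periodic {f : ℝ → ℝ} (hT : 0 < T) (hf : Continuous f)
    (hfT : Function.Periodic f T) : MemLp f ⊤ volume := by
  obtain ⟨M, hM⟩ := isCompact_Icc.exists_bound_of_continuousOn (s := Set.Icc 0 T) hf.continuousOn
  refine memLp_top_of_bound hf.aestronglyMeasurable M (ae_of_all _ fun t => ?_)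
  obtain ⟨s, hs, hts⟩ := hfT.exists_mem_Ico₀ hT t
  rw [hts]
  exact hM s (Set.Ico_subset_Icc_self hs)

/-- The damping is polynomial in the components of y and their conjugates, with bounded
coefficients, and the truncated components are bounded and Lipschitz. -/
theorem isBoundedLipschitz_damping {xe : ℝ → Fin 4 → ℝ} (hxe : ∀ i, MemLp (fun t => xe t i) ⊤ volume)
    {p : ℝ → Matrix (Fin 4) (Fin 4) ℝ} (hp : ∀ i j, MemLp (fun t => p t i j) ⊤ volume)
    {H₁ : ℝ → Matrix (Fin 3) (Fin 3) ℝ} (hH : ∀ i j, MemLp (fun t => H₁ t i j) ⊤ volume)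
    {R : ℝ} (hR : 0 < R) (i : Fin 4) :
    IsBoundedLipschitz fun s (y : Fin 4 → 𝕜) =>
      c.damping (xe s) (p s) (H₁ s) (radialRetraction R y) i := by
  have hy := fun i => isBoundedLipschitz_radialRetraction (𝕜 := 𝕜) (n := 4) hR i
  have hG : ∀ i j, IsBoundedLipschitz fun s (y : Fin 4 → 𝕜) =>
      c.G ((fun i => (xe s i : 𝕜)) + radialRetraction R y) i j := fun i j => by
    simp only [c.G_apply (_ + _)]
    exact .sum _ fun k _ => (.mul (.of_coeff (memLp_top_const _))
      (.add (.of_coeff (hxe k).ofReal) (hy k)))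
  have hcast : ∀ {m n : ℕ} {a : ℝ → Matrix (Fin m) (Fin n) ℝ},
      (∀ i j, MemLp (fun t => a t i j) ⊤ volume) → ∀ i j,
      IsBoundedLipschitz fun s (_ : Fin 4 → 𝕜) => castMat 𝕜 (a s) i j := fun ha i j =>
    .of_coeff (ha i j).ofReal
  exact .mulVec hG (.mulVec (hcast hH) (.mulVec (fun i j => (hG j i).star)
    (.mulVec (hcast hp) hy))) i

end Converter

/-! ### Phasors of vector signals and integrability of periodic signals on windows -/

theorem vecPhasor_add {n : ℕ} {T t : ℝ} {x y : ℝ → Fin n → ℂ}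
    (hx : ∀ i, IntervalIntegrable (fun s => x s i) volume (t - T) t)
    (hy : ∀ i, IntervalIntegrable (fun s => y s i) volume (t - T) t) :
    vecPhasor T (fun s => x s + y s) t = vecPhasor T x t + vecPhasor T y t := by
  ext k i
  exact phasor_add (hx i) (hy i) k

theorem vecPhasor_sub {n : ℕ} {T t : ℝ} {x y : ℝ → Fin n → ℂ}
    (hx : ∀ i, IntervalIntegrable (fun s => x s i) volume (t - T) t)
    (hy : ∀ i, IntervalIntegrable (fun s => y s i) volume (t - T) t) :
    vecPhasor T (fun s => x s - y s) t = vecPhasor T x t - vecPhasor T y t := by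
  ext k i
  exact phasor_sub (hx i) (hy i) k

/-- A periodic signal which is square integrable over a period is so over every window. -/
theorem memLp_window_of_periodic {T : ℝ} (hT : 0 < T) {f : ℝ → ℝ} (hfT : Function.Periodic f T)
    (hf : MemLp f 2 (volume.restrict (Set.Icc 0 T))) (t : ℝ) :
    MemLp (fun s => (f s : ℂ)) 2 (window T t) := by
  have hf' : MemLp f 2 (volume.restrict (Set.Ioc 0 T)) :=
    hf.mono_measure (Measure.restrict_mono Set.Ioc_subset_Icc_self le_rfl)
  have h1 : IntervalIntegrable f volume 0 T := by
    rw [intervalIntegrable_iff_integrableOn_Ioc_of_le hT.le]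
    exact hf'.integrable one_le_two
  have h2 : IntervalIntegrable (fun s => f s ^ 2) volume 0 T := by
    rw [intervalIntegrable_iff_integrableOn_Ioc_of_le hT.le]
    exact hf'.integrable_sq
  have h3 := (hfT.intervalIntegrable₀ hT.ne' h1 (t - T) t)
  have hsT : Function.Periodic (fun s => f s ^ 2) T := fun s => by simp only [hfT s]
  have h4 := hsT.intervalIntegrable₀ hT.ne' h2 (t - T) t
  rw [intervalIntegrable_iff_integrableOn_Ioc_of_le (by linarith)] at h3 h4
  exact ((memLp_two_iff_integrable_sq h3.1).2 h4).ofReal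

namespace Converter

variable (c : Converter) {T : ℝ}

/-! ### The harmonic model in terms of signals -/

theorem symG_vecPhasor {t : ℝ} {x : ℝ → Fin 4 → ℂ}
    (hx : ∀ i, IntervalIntegrable (fun s => x s i) volume (t - T) t) :
    c.symG (vecPhasor T x t) = fun k => Matrix.of fun i j => phasor T (fun s => c.G (x s) i j) t k := by
  ext k i j
  simp only [symG, Matrix.of_apply]
  rw [c.G_apply, funext fun s => c.G_apply (x s) i j, phasor_sum _ fun l _ => (hx l).const_mul _]
  simp only [phasor_const_mul]
  rfl

theorem memLp_G {μ : Measure ℝ} {q : ℝ≥0∞} {x : ℝ → Fin 4 → ℂ} (hx : ∀ i, MemLp (fun s => x s i) q μ)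
    (i : Fin 4) (j : Fin 3) : MemLp (fun s => c.G (x s) i j) q μ := by
  simp only [c.G_apply (x _)]
  exact memLp_finsetSum _ fun k _ => (hx k).const_mul _

theorem toeplitzMul_symG (hT : 0 < T) {t : ℝ} {x : ℝ → Fin 4 → ℂ} {d : ℝ → Fin 3 → ℂ}
    (hx : ∀ i, MemLp (fun s => x s i) 2 (window T t))
    (hd : ∀ i, MemLp (fun s => d s i) 2 (window T t)) :
    toeplitzMul (c.symG (vecPhasor T x t)) (vecPhasor T d t) =
      vecPhasor T (fun s => c.G (x s) *ᵥ d s) t := by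
  rw [c.symG_vecPhasor fun i => (intervalIntegrable_window hT).2 ((hx i).integrable one_le_two)]
  exact toeplitzMul_vecPhasor hT (fun i j => c.memLp_G hx i j) hd

theorem harmonicField_vecPhasor (hT : 0 < T) {t : ℝ} {x v : ℝ → Fin 4 → ℂ} {d : ℝ → Fin 3 → ℂ}
    (hx : ∀ i, MemLp (fun s => x s i) 2 (window T t))
    (hd : ∀ i, MemLp (fun s => d s i) 2 (window T t))
    (hv : ∀ i, MemLp (fun s => v s i) 2 (window T t)) :
    c.harmonicField T (vecPhasor T x t) (vecPhasor T d t) (vecPhasor T v t) =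
      vecPhasor T (fun s => castMat ℂ c.A *ᵥ x s + c.G (x s) *ᵥ d s + castMat ℂ c.B *ᵥ v s) t -
        frequencyMul T (vecPhasor T x t) := by
  have hint : ∀ {m : ℕ} {a : Matrix (Fin m) (Fin 4) ℝ} {u : ℝ → Fin 4 → ℂ},
      (∀ i, MemLp (fun s => u s i) 2 (window T t)) → ∀ i,
      IntervalIntegrable (fun s => (castMat ℂ a *ᵥ u s) i) volume (t - T) t := fun {m a u} hu i =>
    (intervalIntegrable_window hT).2 ((memLp_mulVec (A := fun _ => castMat ℂ a)
      (fun i j => memLp_window ((isBoundedPeriodic_const T a).2 i j) t) hu i).integrable one_le_two)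
  have hG : ∀ i, IntervalIntegrable (fun s => (c.G (x s) *ᵥ d s) i) volume (t - T) t := fun i => by
    refine (intervalIntegrable_window hT).2 ?_
    simp only [mulVec, dotProduct]
    exact integrable_finsetSum _ fun j _ => (c.memLp_G hx i j).integrable_mul (hd j)
  rw [harmonicField, c.toeplitzMul_symG hT hx hd, symA, symB,
    toeplitzMul_matHarmonics hT (isBoundedPeriodic_const T _) hx,
    toeplitzMul_matHarmonics hT (isBoundedPeriodic_const T _) hv,
    vecPhasor_add (x := fun s => castMat ℂ c.A *ᵥ x s + c.G (x s) *ᵥ d s)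
      (fun i => (hint hx i).add (hG i)) (hint hv), vecPhasor_add (hint hx) hG]
  abel

theorem errorOperator_eq_floquetGraph (hT : 0 < T) {de : ℝ → Fin 3 → ℝ}
    (hde : ∀ i, MemLp (fun t => de t i) ⊤ volume) (hdeT : Function.Periodic de T) :
    c.errorOperator T de = floquetGraph T fun t => c.A + c.Ad (de t) := by
  have h : ∀ X : EllTwo 4, toeplitzMul (matHarmonics T fun t => c.A + c.Ad (de t)) (coords X) =
      toeplitzMul (c.symA T) (coords X) +
        toeplitzMul (matHarmonics T fun t => c.Ad (de t)) (coords X) := by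
    intro X
    obtain ⟨x, hx⟩ := exists_represents hT T X
    have hint : ∀ {a : ℝ → Matrix (Fin 4) (Fin 4) ℝ}, IsBoundedPeriodic T a → ∀ i,
        IntervalIntegrable (fun s => (castMat ℂ (a s) *ᵥ x s) i) volume (T - T) T := fun ha i =>
      (intervalIntegrable_window hT).2 ((memLp_mulVec
        (fun i j => memLp_window (ha.2 i j) T) hx.1 i).integrable one_le_two)
    have hA := isBoundedPeriodic_const T c.A
    have hAd := c.isBoundedPeriodic_Ad hde hdeT
    rw [hx.2, symA, toeplitzMul_matHarmonics hT (c.isBoundedPeriodic_A_add_Ad hde hdeT) hx.1,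
      toeplitzMul_matHarmonics hT hA hx.1, toeplitzMul_matHarmonics hT hAd hx.1,
      ← vecPhasor_add (hint hA) (hint hAd)]
    simp only [castMat_add, Matrix.add_mulVec]
  ext p
  simp only [errorOperator, floquetGraph, Set.mem_ofPred_eq, h, Pi.add_apply]

/-- The equilibrium signal solves the open-loop equation. -/
theorem isPrimitiveOn_equilibrium (hT : 0 < T) {xe : ℝ → Fin 4 → ℝ} {de : ℝ → Fin 3 → ℝ}
    {ve : ℝ → Fin 4 → ℝ} (hxe : Continuous xe) (hxeT : Function.Periodic xe T)
    (hde : ∀ i, MemLp (fun t => de t i) ⊤ volume) (hdeT : Function.Periodic de T)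
    (hve : ∀ i, MemLp (fun t => ve t i) 2 (volume.restrict (Set.Icc 0 T)))
    (hveT : Function.Periodic ve T)
    {Xe : EllTwo 4} (hXe : coords Xe = vecHarmonics T xe)
    (hequil : c.harmonicField T (coords Xe) (vecHarmonics T de) (vecHarmonics T ve) = 0)
    (a b : ℝ) (i : Fin 4) :
    IsPrimitiveOn (fun s => xe s i)
      (fun s => ((c.A + c.Ad (de s)) *ᵥ xe s + c.B *ᵥ ve s) i) a b := by
  set x' : ℝ → Fin 4 → ℂ := fun s i => (xe s i : ℂ) with hx'
  set d' : ℝ → Fin 3 → ℂ := fun s i => (de s i : ℂ) with hd'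
  set v' : ℝ → Fin 4 → ℂ := fun s i => (ve s i : ℂ) with hv'
  have hx'c : ∀ i, Continuous fun s => x' s i := fun i =>
    Complex.continuous_ofReal.comp ((continuous_apply i).comp hxe)
  have hxL : ∀ i, MemLp (fun s => x' s i) 2 (window T T) := fun i =>
    memLp_window_of_continuous (hx'c i) T
  have hdL : ∀ i, MemLp (fun s => d' s i) 2 (window T T) := fun i => memLp_window (hde i) T
  have hvL : ∀ i, MemLp (fun s => v' s i) 2 (window T T) := fun i =>
    memLp_window_of_periodic hT (fun s => by simp only [hveT s]) (hve i) T
  have hFb := c.isBoundedPeriodic_A_add_Ad (T := T) hde hdeT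
  have hrep : Represents T T x' Xe := ⟨hxL, hXe⟩
  have hwL : ∀ i, MemLp (fun s => (-(castMat ℂ c.B *ᵥ v' s)) i) 2 (window T T) := fun i =>
    (memLp_mulVec (A := fun _ => castMat ℂ c.B)
      (fun i j => memLp_window ((isBoundedPeriodic_const T c.B).2 i j) T) hvL i).neg
  obtain ⟨W, hW⟩ := exists_represented hT hwL
  have hFx : ∀ s, castMat ℂ (c.A + c.Ad (de s)) *ᵥ x' s =
      castMat ℂ c.A *ᵥ x' s + c.G (x' s) *ᵥ d' s := fun s => by
    rw [castMat_add, Matrix.add_mulVec, ← G_mulVec_ofReal]; rfl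
  -- The equilibrium condition is 𝓜Xᵉ = −ℬVᵉ, so Xᵉ lies in the domain and has an absolutely
  -- continuous representative.
  have hmem : (Xe, W) ∈ floquetGraph T fun t => c.A + c.Ad (de t) := by
    refine (mem_floquetGraph_iff hT hFb hrep hW).2 fun k i => ?_
    have h1 := congrFun (congrFun (c.harmonicField_vecPhasor hT hxL hdL hvL) k) i
    rw [hXe] at hequil
    change c.harmonicField T (vecPhasor T x' T) (vecPhasor T d' T) (vecPhasor T v' T) = 0 at hequil
    rw [hequil] at h1
    simp only [Pi.zero_apply, Pi.sub_apply, vecPhasor, frequencyMul, Pi.smul_apply,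
      smul_eq_mul] at h1
    simp only [hFx, sub_neg_eq_add]
    linear_combination h1
  obtain ⟨y, hy, hy0, hyp⟩ := exists_primitive_of_mem hT hFb hW hmem
  have hae := hy.ae_eq hT hrep
  -- Two continuous functions that agree almost everywhere on the period agree everywhere on it.
  have hyx : ∀ s ∈ Set.Icc 0 T, ∀ i, y s i = x' s i := by
    intro s hs i
    have h1 : (fun s => y s i) =ᵐ[volume.restrict (Set.Ioc 0 T)] fun s => x' s i := by
      have h2 := hae
      rw [window, sub_self] at h2
      filter_upwards [h2] with s hs
      rw [hs]
    have h3 : (fun s => y s i) =ᵐ[volume.restrict (Set.Icc 0 T)] fun s => x' s i := by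
      rwa [Measure.restrict_congr_set Ioc_ae_eq_Icc] at h1
    exact Measure.eqOn_Icc_of_ae_eq volume hT.ne h3 ((hyp i).continuousOn hT.le)
      (hx'c i).continuousOn hs
  set f : ℝ → ℝ := fun s => ((c.A + c.Ad (de s)) *ᵥ xe s + c.B *ᵥ ve s) i with hf
  have hfT : Function.Periodic f T := fun s => by simp only [hf, hxeT s, hdeT s, hveT s]
  have hprim : IsPrimitiveOn (fun s => xe s i) f 0 T := by
    have h1 : IsPrimitiveOn (fun s => x' s i) (fun s => ((f s : ℝ) : ℂ)) 0 T := by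
      refine ((hyp i).congr hT.le fun s hs => hyx s hs i).congr_deriv hT.le
        (ae_of_all _ fun s hs => ?_)
      have h2 : y s = x' s := funext fun i => hyx s (Set.Ioc_subset_Icc_self hs) i
      have h3 := castMat_mulVec_ofReal (𝕜 := ℂ) (c.A + c.Ad (de s)) (xe s)
      have h4 := castMat_mulVec_ofReal (𝕜 := ℂ) c.B (ve s)
      simp only [h2, hf, sub_neg_eq_add, Pi.add_apply, Complex.ofReal_add]
      exact congrArg₂ (· + ·) (congrFun h3 i) (congrFun h4 i)
    exact h1.re
  have hfi : ∀ a b, IntervalIntegrable f volume a b := hfT.intervalIntegrable₀ hT.ne' hprim.1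
  have hf0 : ∀ t, ∫ s in t..t + T, f s = 0 := fun t => by
    rw [hfT.intervalIntegral_add_eq t 0, zero_add, hprim.integral_eq hT.le]
    have := hxeT 0
    rw [zero_add] at this
    rw [this, sub_self]
  -- The integral of f over a period is zero, so this difference is periodic; being constant on one
  -- period, it is constant on the line.
  have hDT : Function.Periodic (fun t => xe t i - ∫ s in (0 : ℝ)..t, f s) T := fun t => by
    simp only [hxeT t]
    rw [← intervalIntegral.integral_add_adjacent_intervals (hfi 0 t) (hfi t (t + T)), hf0, add_zero]
  have hD : ∀ t, xe t i - ∫ s in (0 : ℝ)..t, f s = xe 0 i := fun t => by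
    obtain ⟨s, hs, hts⟩ := hDT.exists_mem_Ico₀ hT t
    have h1 := hprim.2 s (Set.Ico_subset_Icc_self hs)
    simp only at h1
    rw [hts, h1]
    ring
  refine ⟨hfi a b, fun t _ => ?_⟩
  have h1 := hD t
  have h2 := hD a
  rw [← intervalIntegral.integral_interval_sub_left (hfi 0 t) (hfi 0 a)]
  linarith

end Converter

/-! ### Existence and stability for the error dynamics, with real or complex state -/

theorem castMat_real {m n : Type*} (A : Matrix m n ℝ) :
    castMat ℝ A = A := by
  ext i j; simp [castMat]

theorem isPrimitiveOn_pi {ι E : Type*} [Fintype ι] [NormedAddCommGroup E] [NormedSpace ℝ E]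
    [CompleteSpace E] {u u' : ℝ → ι → E} {a b : ℝ}
    (h : ∀ i, IsPrimitiveOn (fun s => u s i) (fun s => u' s i) a b) : IsPrimitiveOn u u' a b := by
  have hi : IntervalIntegrable u' volume a b :=
    ⟨Integrable.of_eval fun i => (h i).1.1, Integrable.of_eval fun i => (h i).1.2⟩
  refine ⟨hi, fun t ht => funext fun i => ?_⟩
  have hit : IntervalIntegrable u' volume a t := hi.mono_set (by
    rw [Set.uIcc_of_le ht.1, Set.uIcc_of_le (ht.1.trans ht.2)]
    exact Set.Icc_subset_Icc_right ht.2)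
  have h1 := (ContinuousLinearMap.proj (R := ℝ) (φ := fun _ : ι => E) i).intervalIntegral_comp_comm
    hit
  exact ((h i).2 t ht).trans (congrArg (u a i + ·) h1)

/-- The standing assumptions on the closed loop: an equilibrium, a periodic Lyapunov matrix `p` of
the error dynamics, and a gain `H₁`. -/
structure IsStabilizingDesign (c : Converter) (T : ℝ) (xe : ℝ → Fin 4 → ℝ) (de : ℝ → Fin 3 → ℝ)
    (ve : ℝ → Fin 4 → ℝ) (Q p : ℝ → Matrix (Fin 4) (Fin 4) ℝ) (H₁ : ℝ → Matrix (Fin 3) (Fin 3) ℝ) :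
    Prop where
  pos : 0 < T
  continuous_xe : Continuous xe
  periodic_xe : Function.Periodic xe T
  memLp_de : ∀ i, MemLp (fun t => de t i) ⊤ volume
  periodic_de : Function.Periodic de T
  memLp_ve : ∀ i, MemLp (fun t => ve t i) 2 (volume.restrict (Set.Icc 0 T))
  periodic_ve : Function.Periodic ve T
  equilibrium : ∀ a b i, IsPrimitiveOn (fun s => xe s i)
    (fun s => ((c.A + c.Ad (de s)) *ᵥ xe s + c.B *ᵥ ve s) i) a b
  bounded_Q : IsBoundedPeriodic T Q
  posDef_Q : ∀ᵐ t, (Q t).PosDef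
  lyapunov : IsPeriodicLyapunov T (fun t => c.A + c.Ad (de t)) Q p
  bounded_H : IsBoundedPeriodic T H₁
  posDef_H : ∀ᵐ t, (H₁ t).PosDef

namespace IsStabilizingDesign

variable {𝕜 : Type*} [RCLike 𝕜] {c : Converter} {T : ℝ} {xe : ℝ → Fin 4 → ℝ} {de : ℝ → Fin 3 → ℝ}
  {ve : ℝ → Fin 4 → ℝ} {Q p : ℝ → Matrix (Fin 4) (Fin 4) ℝ} {H₁ : ℝ → Matrix (Fin 3) (Fin 3) ℝ}

theorem isPrimitiveOn_error (h : IsStabilizingDesign c T xe de ve Q p H₁) {a b : ℝ} (hab : a ≤ b)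
    {x : ℝ → Fin 4 → 𝕜} {i : Fin 4} (hx : IsPrimitiveOn (fun s => x s i)
      (fun s => c.closedLoopField (de s) (ve s) (xe s) (p s) (H₁ s) (x s) i) a b) :
    IsPrimitiveOn (fun s => (x s - fun i => (xe s i : 𝕜)) i)
      (fun s => (castMat 𝕜 (c.A + c.Ad (de s)) *ᵥ (x s - fun i => (xe s i : 𝕜)) -
        c.damping (xe s) (p s) (H₁ s) (x s - fun i => (xe s i : 𝕜))) i) a b := by
  refine (hx.sub (h.equilibrium a b i).ofReal).congr_deriv hab (ae_of_all _ fun s _ => ?_)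
  rw [← c.closedLoopField_sub]
  rfl

theorem isPrimitiveOn_of_error (h : IsStabilizingDesign c T xe de ve Q p H₁) {a b : ℝ}
    (hab : a ≤ b) {y : ℝ → Fin 4 → 𝕜} {i : Fin 4} (hy : IsPrimitiveOn (fun s => y s i)
      (fun s => (castMat 𝕜 (c.A + c.Ad (de s)) *ᵥ y s -
        c.damping (xe s) (p s) (H₁ s) (y s)) i) a b) :
    IsPrimitiveOn (fun s => (y s + fun i => (xe s i : 𝕜)) i)
      (fun s => c.closedLoopField (de s) (ve s) (xe s) (p s) (H₁ s)
        (y s + fun i => (xe s i : 𝕜)) i) a b := by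
  refine (hy.add (h.equilibrium a b i).ofReal).congr_deriv hab (ae_of_all _ fun s _ => ?_)
  have h1 := congrFun (c.closedLoopField_sub (de s) (ve s) (xe s) (p s) (H₁ s)
    (y s + fun i => (xe s i : 𝕜))) i
  rw [add_sub_cancel_right] at h1
  change _ + _ = _
  rw [← h1, Pi.sub_apply, sub_add_cancel]

theorem memLp_xe (h : IsStabilizingDesign c T xe de ve Q p H₁) (i : Fin 4) :
    MemLp (fun t => xe t i) ⊤ volume :=
  Converter.memLp_top_of_continuous_periodic h.pos ((continuous_apply i).comp h.continuous_xe)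
    fun s => by simp only [h.periodic_xe s]

theorem exists_solution (h : IsStabilizingDesign c T xe de ve Q p H₁) (t₀ : ℝ) (x₀ : Fin 4 → 𝕜) :
    ∃ x : ℝ → Fin 4 → 𝕜, Continuous x ∧ x t₀ = x₀ ∧ ∀ b ≥ t₀, ∀ i, IsPrimitiveOn (fun s => x s i)
      (fun s => c.closedLoopField (de s) (ve s) (xe s) (p s) (H₁ s) (x s) i) t₀ b := by
  obtain ⟨y, hyc, hy0, hy⟩ := h.lyapunov.exists_solution h.pos
    (c.isBoundedPeriodic_A_add_Ad h.memLp_de h.periodic_de) h.bounded_Q h.posDef_Q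
    (N := fun s y => c.damping (xe s) (p s) (H₁ s) y)
    (fun R hR i => c.isBoundedLipschitz_damping h.memLp_xe
      (h.lyapunov.isBoundedPeriodic h.pos).2 h.bounded_H.2 hR i)
    (h.posDef_H.mono fun s hs y => c.re_damping_nonneg (xe s) (p s) hs y)
    t₀ (x₀ - fun i => (xe t₀ i : 𝕜))
  refine ⟨fun s => y s + fun i => (xe s i : 𝕜), hyc.add (continuous_pi fun i =>
    RCLike.continuous_ofReal.comp ((continuous_apply i).comp h.continuous_xe)), ?_,
    fun b hb i => h.isPrimitiveOn_of_error hb (hy b hb i)⟩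
  simp only [hy0, sub_add_cancel]

/-- Uniform stability and attractivity of the equilibrium. -/
theorem stability (h : IsStabilizingDesign c T xe de ve Q p H₁) :
    ∃ K > 0, ∀ (t₀ : ℝ) (x : ℝ → Fin 4 → 𝕜), (∀ b ≥ t₀, ∀ i, IsPrimitiveOn (fun s => x s i)
      (fun s => c.closedLoopField (de s) (ve s) (xe s) (p s) (H₁ s) (x s) i) t₀ b) →
      (∀ a b, t₀ ≤ a → a ≤ b →
        ∑ i, ‖x b i - (xe b i : 𝕜)‖ ^ 2 ≤ K * ∑ i, ‖x a i - (xe a i : 𝕜)‖ ^ 2) ∧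
      Tendsto (fun t => ∑ i, ‖x t i - (xe t i : 𝕜)‖ ^ 2) atTop (𝓝 0) := by
  obtain ⟨q, hqT, hq0, hq, hqQ⟩ := exists_rate (𝕜 := 𝕜) h.bounded_Q h.posDef_Q
  obtain ⟨m, hm, hmp⟩ := h.lyapunov.coercive
  obtain ⟨M, hM, hMp⟩ := h.lyapunov.exists_quad_le (𝕜 := 𝕜) h.pos
  -- The ratio of the upper and lower bounds of p; it depends neither on the initial time nor on the
  -- trajectory.
  refine ⟨M / m, by positivity, fun t₀ x hx => ?_⟩
  set y : ℝ → Fin 4 → 𝕜 := fun s => x s - fun i => (xe s i : 𝕜) with hy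
  have hyp : ∀ b ≥ t₀, ∀ i, IsPrimitiveOn (fun s => y s i)
      (fun s => (castMat 𝕜 (c.A + c.Ad (de s)) *ᵥ y s -
        c.damping (xe s) (p s) (H₁ s) (y s)) i) t₀ b := fun b hb i =>
    h.isPrimitiveOn_error hb (hx b hb i)
  have hN : ∀ᵐ s, 0 ≤ RCLike.re (star (castMat 𝕜 (p s) *ᵥ y s) ⬝ᵥ
      c.damping (xe s) (p s) (H₁ s) (y s)) :=
    h.posDef_H.mono fun s hs => c.re_damping_nonneg (xe s) (p s) hs _
  have hV : ∀ a b, t₀ ≤ a → a ≤ b →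
      quad (p b) (y b) + ∫ s in a..b, q s * ∑ i, ‖y s i‖ ^ 2 ≤ quad (p a) (y a) :=
    fun a b ha hab => h.lyapunov.quad_add_integral_le hq hqQ hab
      (fun i => (hyp b (ha.trans hab) i).mono ha hab le_rfl) hN
  have hlow : ∀ t, m * ∑ i, ‖y t i‖ ^ 2 ≤ quad (p t) (y t) := fun t => le_re_quad (hmp t) (y t)
  refine ⟨fun a b ha hab => ?_, ?_⟩
  · have h1 := hV a b ha hab
    have h2 : 0 ≤ ∫ s in a..b, q s * ∑ i, ‖y s i‖ ^ 2 :=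
      intervalIntegral.integral_nonneg hab fun s _ => mul_nonneg (hq0 s).le (by positivity)
    change ∑ i, ‖y b i‖ ^ 2 ≤ M / m * ∑ i, ‖y a i‖ ^ 2
    rw [div_mul_eq_mul_div, le_div_iff₀ hm]
    linarith [hlow b, hMp a (y a)]
  · refine tendsto_zero_of_dissipation (V := fun t => quad (p t) (y t)) (t₀ := t₀) h.pos hqT hq0 hq
      hm hM (fun t _ => by positivity) (fun t _ => hlow t) (fun t _ => hMp t (y t)) ?_ hV
    refine continuousOn_finsetSum _ fun i _ => ContinuousOn.pow (ContinuousOn.norm fun t ht => ?_) 2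
    have h1 := (hyp (t + 1) (by linarith [Set.mem_Ici.1 ht]) i).continuousOn
      (by linarith [Set.mem_Ici.1 ht]) t ⟨ht, by linarith⟩
    refine (h1.mono_of_mem_nhdsWithin ?_)
    exact mem_nhdsWithin.2 ⟨Set.Iio (t + 1), isOpen_Iio, by simp, fun s hs => ⟨hs.2, hs.1.le⟩⟩

/-! ### The time-domain closed loop -/

theorem isTimeTrajectory_iff {t₀ : ℝ} {x : ℝ → Fin 4 → ℝ} :
    c.IsTimeTrajectory de ve xe p H₁ t₀ x ↔ ∀ b ≥ t₀, ∀ i, IsPrimitiveOn (fun s => x s i)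
      (fun s => c.closedLoopField (de s) (ve s) (xe s) (p s) (H₁ s) (x s) i) t₀ b := by
  have e : ∀ s, c.A *ᵥ x s + c.G (x s) *ᵥ c.feedback (de s) (xe s) (p s) (H₁ s) (x s) +
      c.B *ᵥ ve s = c.closedLoopField (de s) (ve s) (xe s) (p s) (H₁ s) (x s) := fun s => by
    rw [Converter.closedLoopField, castMat_real, castMat_real]; rfl
  simp only [Converter.IsTimeTrajectory, e]
  constructor
  · intro hx b hb i
    have h1 : IsPrimitiveOn x
        (fun s => c.closedLoopField (de s) (ve s) (xe s) (p s) (H₁ s) (x s)) t₀ b :=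
      ⟨(hx b hb).1, fun t ht => (hx t ht.1).2⟩
    exact h1.clm (ContinuousLinearMap.proj (R := ℝ) (φ := fun _ : Fin 4 => ℝ) i)
  · intro hx t ht
    have h1 := isPrimitiveOn_pi (hx t ht)
    exact ⟨h1.1, h1.2 t ⟨ht, le_rfl⟩⟩

theorem exists_isTimeTrajectory (h : IsStabilizingDesign c T xe de ve Q p H₁) (t₀ : ℝ)
    (x₀ : Fin 4 → ℝ) : ∃ x, x t₀ = x₀ ∧ c.IsTimeTrajectory de ve xe p H₁ t₀ x := by
  obtain ⟨x, -, hx0, hx⟩ := h.exists_solution (𝕜 := ℝ) t₀ x₀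
  exact ⟨x, hx0, isTimeTrajectory_iff.2 hx⟩

theorem isGloballyAsymptoticallyStable_time (h : IsStabilizingDesign c T xe de ve Q p H₁) :
    IsGloballyAsymptoticallyStable (c.IsTimeTrajectory de ve xe p H₁) xe := by
  obtain ⟨K, hK, hst⟩ := h.stability (𝕜 := ℝ)
  -- The norm here is the sup norm, whose square is within a factor 4 of the sum of squares in
  -- dimension 4. The added 1 is slack.
  refine ⟨fun ε hε => ⟨ε / Real.sqrt (4 * K + 1), by positivity, fun t₀ x hx hδ t ht => ?_⟩,
    fun t₀ x hx => ?_⟩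
  · have h1 := (hst t₀ x (isTimeTrajectory_iff.1 hx)).1 t₀ t le_rfl ht
    have h2 := norm_sq_le_sum (x t - xe t)
    have h3 := sum_le_norm_sq (x t₀ - xe t₀)
    have h4 : ‖x t - xe t‖ ^ 2 ≤ K * (4 * ‖x t₀ - xe t₀‖ ^ 2) :=
      h2.trans (h1.trans (mul_le_mul_of_nonneg_left (by exact_mod_cast h3) hK.le))
    rw [lt_div_iff₀ (by positivity)] at hδ
    refine lt_of_pow_lt_pow_left₀ 2 hε.le ?_
    have h5 : (‖x t₀ - xe t₀‖ * Real.sqrt (4 * K + 1)) ^ 2 < ε ^ 2 := by gcongr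
    rw [mul_pow, Real.sq_sqrt (by positivity)] at h5
    nlinarith [sq_nonneg ‖x t₀ - xe t₀‖]
  · have h1 := (hst t₀ x (isTimeTrajectory_iff.1 hx)).2
    have h2 : Tendsto (fun t => ‖x t - xe t‖ ^ 2) atTop (𝓝 0) :=
      squeeze_zero (fun t => by positivity) (fun t => norm_sq_le_sum (x t - xe t)) h1
    have h3 := (Real.continuous_sqrt.tendsto 0).comp h2
    rw [Real.sqrt_zero] at h3
    exact h3.congr fun t => Real.sqrt_sq (norm_nonneg _)

end IsStabilizingDesign

/-! ### Sliding phasors as functions of time -/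

section Sliding

variable {T : ℝ}

/-- The phasors of a locally integrable signal are almost everywhere differentiable. -/
theorem ae_hasDerivAt_phasor (hT : 0 < T) {x : ℝ → ℂ} {t₀ : ℝ}
    (hx : ∀ b ≥ t₀, IntervalIntegrable x volume (t₀ - T) b) :
    ∀ᵐ t, t₀ < t → ∀ k : ℤ, HasDerivAt (fun s => phasor T x s k)
      ((1 / (T : ℂ)) * ((x t - x (t - T)) *
        Complex.exp (-(Complex.I * ((2 * Real.pi / T : ℝ) : ℂ) * (k : ℂ) * (t : ℂ))))) t := by
  set g : ℤ → ℝ → ℂ := fun k τ =>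
    x τ * Complex.exp (-(Complex.I * ((2 * Real.pi / T : ℝ) : ℂ) * (k : ℂ) * (τ : ℂ))) with hg
  have hgi : ∀ k, ∀ b ≥ t₀, IntervalIntegrable (g k) volume (t₀ - T) b := fun k b hb =>
    (hx b hb).mul_continuousOn (continuous_mode T k).continuousOn
  have h1 : ∀ᵐ t, t₀ - T < t → ∀ k,
      HasDerivAt (fun s => ∫ τ in (t₀ - T)..s, g k τ) (g k t) t := by
    have h2 : ∀ (k : ℤ) (N : ℕ), ∀ᵐ t, t ∈ Set.uIcc (t₀ - T) (t₀ + N) →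
        HasDerivAt (fun s => ∫ τ in (t₀ - T)..s, g k τ) (g k t) t := fun k N => by
      filter_upwards [(hgi k (t₀ + N) (by simp)).ae_hasDerivAt_integral] with t ht ht'
      exact ht ht' _ Set.left_mem_uIcc
    filter_upwards [ae_all_iff.2 fun k => ae_all_iff.2 (h2 k)] with t ht ht0 k
    obtain ⟨N, hN⟩ := exists_nat_ge (t - t₀)
    refine ht k N ?_
    rw [Set.uIcc_of_le (by have : (0 : ℝ) ≤ N := N.cast_nonneg; linarith)]
    exact ⟨ht0.le, by linarith⟩
  -- Translation preserves null sets, so for almost every t both ends of the window are points of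
  -- differentiability of the primitives.
  have h2 := (measurePreserving_sub_right volume T).quasiMeasurePreserving.ae h1
  filter_upwards [h1, h2] with t ht1 ht2 ht k
  have d1 := ht1 (by linarith) k
  have d2 := (ht2 (by linarith) k).comp_sub_const
  have d3 := (d1.sub d2).const_mul (1 / (T : ℂ))
  have hgk : g k (t - T) = x (t - T) *
      Complex.exp (-(Complex.I * ((2 * Real.pi / T : ℝ) : ℂ) * (k : ℂ) * (t : ℂ))) := by
    have := mode_add_period hT k (t - T)
    rw [sub_add_cancel] at this
    simp only [hg, this]
  rw [hgk] at d3
  refine (d3.congr_of_eventuallyEq ?_).congr_deriv (by simp only [hg]; ring)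
  filter_upwards [Ioi_mem_nhds ht] with s hs
  simp only [phasor]
  congr 1
  exact (intervalIntegral.integral_interval_sub_left (hgi k s (le_of_lt hs))
      ((hgi k s (le_of_lt hs)).mono_set (Set.uIcc_subset_uIcc_left (by
        rw [Set.uIcc_of_le (by linarith [Set.mem_Ioi.1 hs])]
        exact ⟨by linarith [Set.mem_Ioi.1 hs], by linarith⟩)))).symm

theorem exists_mem_Ioo_of_ae {q : ℝ → Prop} (h : ∀ᵐ t, q t) {a b : ℝ} (hab : a < b) :
    ∃ t ∈ Set.Ioo a b, q t := by
  have hne : (ae (volume.restrict (Set.Ioo a b))).NeBot := by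
    rw [ae_neBot, Ne, Measure.restrict_eq_zero, Real.volume_Ioo, ENNReal.ofReal_eq_zero]
    linarith
  exact ((ae_restrict_mem measurableSet_Ioo).and (ae_restrict_of_ae h)).exists

/-- A signal that is constant on almost every window is constant. -/
theorem exists_const_of_windows (hT : 0 < T) {u : ℝ → ℂ} {t₀ : ℝ}
    (h : ∀ᵐ t, t₀ < t → ∃ C, ∀ᵐ s ∂(window T t), u s = C) :
    ∃ C, ∀ᵐ s, t₀ - T < s → u s = C := by
  let R : ℝ → ℂ → Prop := fun t C => ∀ᵐ s, s ∈ Set.Ioc (t - T) t → u s = C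
  have hex : ∀ a b, t₀ ≤ a → a < b → ∃ t ∈ Set.Ioo a b, ∃ C, R t C := fun a b ha hab => by
    obtain ⟨t, ht, hq⟩ := exists_mem_Ioo_of_ae h hab
    obtain ⟨C, hC⟩ := hq (ha.trans_lt ht.1)
    exact ⟨t, ht, C, (ae_restrict_iff' measurableSet_Ioc).1 hC⟩
  -- The windows overlap in an interval of positive length, on which both constants are attained.
  have hover : ∀ t t' C C', R t C → R t' C' → t ≤ t' → t' < t + T → C = C' := by
    intro t t' C C' hC hC' htt htT
    obtain ⟨s, hs, h1, h2⟩ := exists_mem_Ioo_of_ae (hC.and hC') (show t' - T < t by linarith)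
    rw [← h1 ⟨by linarith [hs.1], hs.2.le⟩, ← h2 ⟨hs.1, by linarith [hs.2]⟩]
  -- Only almost every window is available. For distant windows an intermediate good time r is
  -- chosen between t' − T and t' − T/2: its window still meets that of t', and it is at least half
  -- a period closer to t.
  have hchain : ∀ n : ℕ, ∀ t t' C C', t₀ < t → R t C → R t' C' → t ≤ t' →
      t' ≤ t + n * (T / 2) → C = C' := by
    intro n
    induction n with
    | zero =>
      intro t t' C C' _ hC hC' htt hle
      exact hover t t' C C' hC hC' htt (by simp at hle; linarith)
    | succ n ih =>
      intro t t' C C' ht0 hC hC' htt hle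
      rcases lt_or_ge t' (t + T) with hlt | hge
      · exact hover t t' C C' hC hC' htt hlt
      · obtain ⟨r, hr, D, hD⟩ := hex (t' - T) (t' - T / 2) (by linarith) (by linarith)
        push_cast at hle
        rw [ih t r C D ht0 hC hD (by linarith [hr.1]) (by linarith [hr.2])]
        exact hover r t' D C' hD hC' (by linarith [hr.2]) (by linarith [hr.1])
  have hall : ∀ t t' C C', t₀ < t → R t C → R t' C' → t ≤ t' → C = C' := by
    intro t t' C C' ht0 hC hC' htt
    obtain ⟨n, hn⟩ := exists_nat_ge ((t' - t) / (T / 2))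
    rw [div_le_iff₀ (by positivity)] at hn
    exact hchain n t t' C C' ht0 hC hC' htt (by linarith)
  obtain ⟨t₁, ht₁, C, hC⟩ := hex t₀ (t₀ + 1) le_rfl (by linarith)
  refine ⟨C, ?_⟩
  rw [ae_iff]
  -- There are uncountably many windows, but it suffices that each exceptional point has a
  -- neighbourhood lying in one good window.
  refine measure_null_of_locally_null _ fun s hs => ?_
  have hs' : t₀ - T < s := by
    by_contra hn
    exact hs fun h => absurd h hn
  obtain ⟨t, ht, D, hD⟩ := hex (max s t₀) (s + T) (le_max_right _ _)
    (max_lt (by linarith) (by linarith))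
  have hDC : D = C := by
    have ht0 := (le_max_right s t₀).trans_lt ht.1
    rcases le_total t t₁ with h1 | h1
    · exact hall t t₁ D C ht0 hD hC h1
    · exact (hall t₁ t C D ht₁.1 hC hD h1).symm
  refine ⟨{a | ¬(t₀ - T < a → u a = C)} ∩ Set.Ioo (t - T) t, inter_mem_nhdsWithin _
    (Ioo_mem_nhds (by linarith [ht.2]) ((le_max_left _ _).trans_lt ht.1)), ?_⟩
  refine measure_mono_null ?_ (ae_iff.1 hD)
  rintro a ⟨h1, h2⟩ h3
  exact h1 fun _ => by rw [h3 (Set.Ioo_subset_Ioc_self h2), hDC]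

end Sliding

/-! ### The harmonic closed loop and its time-domain representative -/

theorem intervalIntegrable_of_memLp_top_Ioc {f : ℝ → ℂ} {a b : ℝ} (hab : a ≤ b)
    (hf : MemLp f ⊤ (volume.restrict (Set.Ioc a b))) : IntervalIntegrable f volume a b := by
  have : IsFiniteMeasure (volume.restrict (Set.Ioc a b)) := ⟨by simp⟩
  exact (intervalIntegrable_iff_integrableOn_Ioc_of_le hab).2 (hf.integrable le_top)

theorem memLp_top_Icc_of_continuous {f : ℝ → ℂ} (hf : Continuous f) (a b : ℝ) :
    MemLp f ⊤ (volume.restrict (Set.Icc a b)) := by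
  obtain ⟨M, hM⟩ := isCompact_Icc.exists_bound_of_continuousOn (s := Set.Icc a b) hf.continuousOn
  refine memLp_top_of_bound hf.aestronglyMeasurable M ?_
  rw [ae_restrict_iff' measurableSet_Icc]
  exact ae_of_all _ hM

/-- Constants of the harmonic closed loop: the harmonics of the equilibrium and the Toeplitz
operator of the Lyapunov matrix. -/
structure IsHarmonicDesign (T : ℝ) (xe : ℝ → Fin 4 → ℝ) (p : ℝ → Matrix (Fin 4) (Fin 4) ℝ)
    (Xe : EllTwo 4) (P : EllTwo 4 →L[ℂ] EllTwo 4) : Prop where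
  coords_Xe : coords Xe = vecHarmonics T xe
  represents : ∀ t x X, Represents T t x X → Represents T t (fun s => castMat ℂ (p s) *ᵥ x s) (P X)

namespace IsStabilizingDesign

variable {c : Converter} {T : ℝ} {xe : ℝ → Fin 4 → ℝ} {de : ℝ → Fin 3 → ℝ}
  {ve : ℝ → Fin 4 → ℝ} {Q p : ℝ → Matrix (Fin 4) (Fin 4) ℝ} {H₁ : ℝ → Matrix (Fin 3) (Fin 3) ℝ}

theorem memLp_feedback (h : IsStabilizingDesign c T xe de ve Q p H₁) {S : Set ℝ}
    {x : ℝ → Fin 4 → ℂ} (hx : ∀ i, MemLp (fun s => x s i) ⊤ (volume.restrict S)) (i : Fin 3) :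
    MemLp (fun s => c.feedback (de s) (xe s) (p s) (H₁ s) (x s) i) ⊤ (volume.restrict S) := by
  have hcast : ∀ {m n : ℕ} {a : ℝ → Matrix (Fin m) (Fin n) ℝ}, IsBoundedPeriodic T a → ∀ i j,
      MemLp (fun t => castMat ℂ (a t) i j) ⊤ (volume.restrict S) := fun ha i j =>
    ((ha.2 i j).restrict S).ofReal
  have hy : ∀ i, MemLp (fun s => (x s - fun i => (xe s i : ℂ)) i) ⊤ (volume.restrict S) := fun i =>
    (hx i).sub ((h.memLp_xe i).restrict S).ofReal
  exact (((h.memLp_de i).restrict S).ofReal (K := ℂ)).sub (memLp_mulVec (hcast h.bounded_H)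
    (memLp_mulVec (fun i j => (c.memLp_G hx j i).star)
      (memLp_mulVec (hcast (h.lyapunov.isBoundedPeriodic h.pos)) hy)) i)

theorem intervalIntegrable_closedLoopField (h : IsStabilizingDesign c T xe de ve Q p H₁) {a b : ℝ}
    (hab : a ≤ b) {x : ℝ → Fin 4 → ℂ}
    (hx : ∀ i, MemLp (fun s => x s i) ⊤ (volume.restrict (Set.Ioc a b))) (i : Fin 4) :
    IntervalIntegrable (fun s => c.closedLoopField (de s) (ve s) (xe s) (p s) (H₁ s) (x s) i)
      volume a b := by
  have hv : ∀ j, IntervalIntegrable (fun s => (ve s j : ℂ)) volume a b := fun j => by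
    have h1 : IntervalIntegrable (fun s => ve s j) volume 0 T := by
      rw [intervalIntegrable_iff_integrableOn_Ioc_of_le h.pos.le]
      exact ((h.memLp_ve j).mono_measure (Measure.restrict_mono Set.Ioc_subset_Icc_self
        le_rfl)).integrable one_le_two
    have h2 : Function.Periodic (fun s => ve s j) T := fun s => by simp only [h.periodic_ve s]
    have h3 := h2.intervalIntegrable₀ h.pos.ne' h1 a b
    exact ⟨h3.1.ofReal, h3.2.ofReal⟩
  have h1 := intervalIntegrable_of_memLp_top_Ioc hab (memLp_mulVec
    (A := fun _ => castMat ℂ c.A) (fun i j => memLp_top_const _) hx i)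
  have h2 := intervalIntegrable_of_memLp_top_Ioc hab (memLp_mulVec
    (fun i j => c.memLp_G hx i j) (h.memLp_feedback hx) i)
  have h3 : IntervalIntegrable (fun s => (castMat ℂ c.B *ᵥ fun i => (ve s i : ℂ)) i)
      volume a b := by
    simp only [mulVec, dotProduct]
    exact intervalIntegrable_fun_sum _ fun j _ => (hv j).const_mul _
  exact (h1.add h2).add h3

variable {Xe : EllTwo 4} {P : EllTwo 4 →L[ℂ] EllTwo 4}

theorem represents_xe (h : IsStabilizingDesign c T xe de ve Q p H₁)
    (hd : IsHarmonicDesign T xe p Xe P) (t : ℝ) : Represents T t (fun s i => (xe s i : ℂ)) Xe :=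
  ⟨fun i => memLp_window (h.memLp_xe i) t, by rw [hd.1, vecHarmonics_eq h.pos h.periodic_xe t]⟩

/-- The harmonic feedback is the sliding Fourier decomposition of the time-domain feedback. -/
theorem harmonicFeedback_eq (h : IsStabilizingDesign c T xe de ve Q p H₁)
    (hd : IsHarmonicDesign T xe p Xe P) {t : ℝ} {x : ℝ → Fin 4 → ℂ} {X : EllTwo 4}
    (hx : ∀ i, MemLp (fun s => x s i) ⊤ (window T t)) (hX : Represents T t x X) :
    c.harmonicFeedback T de Xe P H₁ X =
      vecPhasor T (fun s => c.feedback (de s) (xe s) (p s) (H₁ s) (x s)) t := by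
  have hT := h.pos
  have hW := hd.2 _ _ _ (hX.sub hT (h.represents_xe hd t))
  set w : ℝ → Fin 4 → ℂ := fun s => castMat ℂ (p s) *ᵥ (x s - fun i => (xe s i : ℂ)) with hw
  have hGt : ∀ i j, MemLp (fun s => (c.G (x s))ᴴ i j) ⊤ (window T t) := fun i j =>
    (c.memLp_G hx j i).star
  have hadj : adjointSymbol (c.symG (coords X)) =
      fun k => Matrix.of fun i j => phasor T (fun s => (c.G (x s))ᴴ i j) t k := by
    rw [hX.2, c.symG_vecPhasor fun i => hX.intervalIntegrable hT i]
    ext k i j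
    exact (phasor_conj (fun s => c.G (x s) j i) t k).symm
  have hGw : ∀ i, MemLp (fun s => ((c.G (x s))ᴴ *ᵥ w s) i) 2 (window T t) :=
    memLp_mulVec hGt hW.1
  have hHGw := toeplitzMul_matHarmonics hT h.bounded_H hGw
  have hHint : ∀ i, IntervalIntegrable (fun s => (castMat ℂ (H₁ s) *ᵥ ((c.G (x s))ᴴ *ᵥ w s)) i)
      volume (t - T) t := fun i => (intervalIntegrable_window hT).2
    ((memLp_mulVec (fun i j => memLp_window (h.bounded_H.2 i j) t) hGw i).integrable one_le_two)
  have hdint : ∀ i, IntervalIntegrable (fun s => (de s i : ℂ)) volume (t - T) t := fun i =>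
    (intervalIntegrable_window hT).2 ((memLp_window (h.memLp_de i) t).integrable le_rfl)
  rw [Converter.harmonicFeedback, hadj, hW.2, toeplitzMul_vecPhasor hT
    (fun i j => (hGt i j).mono_exponent le_top) hW.1, hHGw, vecHarmonics_eq hT h.periodic_de t,
    ← vecPhasor_sub hdint hHint]
  rfl

theorem harmonicField_eq (h : IsStabilizingDesign c T xe de ve Q p H₁)
    (hd : IsHarmonicDesign T xe p Xe P) {t : ℝ} {x : ℝ → Fin 4 → ℂ} {X : EllTwo 4}
    (hx : ∀ i, MemLp (fun s => x s i) ⊤ (window T t)) (hX : Represents T t x X) :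
    c.harmonicField T (coords X) (c.harmonicFeedback T de Xe P H₁ X) (vecHarmonics T ve) =
      vecPhasor T (fun s => c.closedLoopField (de s) (ve s) (xe s) (p s) (H₁ s) (x s)) t -
        frequencyMul T (vecPhasor T x t) := by
  rw [h.harmonicFeedback_eq hd hx hX, hX.2, vecHarmonics_eq h.pos h.periodic_ve t,
    c.harmonicField_vecPhasor h.pos hX.1 (fun i => (h.memLp_feedback hx i).mono_exponent le_top)
    fun i => memLp_window_of_periodic h.pos (fun s => by simp only [h.periodic_ve s])
      (h.memLp_ve i) t]
  rfl

section Trajectory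

variable {t₀ : ℝ} {x : ℝ → Fin 4 → ℂ} {X : ℝ → EllTwo 4}

theorem _root_.HarmonicConverter.Converter.IsHarmonicTrajectory.memLp_window
    (hx : c.IsHarmonicTrajectory T de ve Xe P H₁ t₀ x X) {t : ℝ} (ht : t₀ ≤ t) (i : Fin 4) :
    MemLp (fun s => x s i) ⊤ (window T t) :=
  (hx.bounded t ht i).mono_measure (Measure.restrict_mono
    (Set.Ioc_subset_Icc_self.trans (Set.Icc_subset_Icc_left (by linarith))) le_rfl)

theorem _root_.HarmonicConverter.Converter.IsHarmonicTrajectory.represents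
    (hx : c.IsHarmonicTrajectory T de ve Xe P H₁ t₀ x X) {t : ℝ} (ht : t₀ ≤ t) :
    Represents T t x (X t) :=
  ⟨fun i => (hx.memLp_window ht i).mono_exponent le_top, hx.phasors t ht⟩

theorem _root_.HarmonicConverter.Converter.IsHarmonicTrajectory.intervalIntegrable (hT : 0 < T)
    (hx : c.IsHarmonicTrajectory T de ve Xe P H₁ t₀ x X) {b : ℝ} (hb : t₀ ≤ b) (i : Fin 4) :
    IntervalIntegrable (fun s => x s i) volume (t₀ - T) b :=
  intervalIntegrable_of_memLp_top_Ioc (by linarith) ((hx.bounded b hb i).mono_measure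
    (Measure.restrict_mono Set.Ioc_subset_Icc_self le_rfl))

/-- The signal of a harmonic trajectory is, up to a null set, a solution of the time-domain closed
loop. -/
theorem exists_solution_of_harmonic (h : IsStabilizingDesign c T xe de ve Q p H₁)
    (hd : IsHarmonicDesign T xe p Xe P) (hx : c.IsHarmonicTrajectory T de ve Xe P H₁ t₀ x X) :
    ∃ z : ℝ → Fin 4 → ℂ, (∀ b ≥ t₀ - T, ∀ i, IsPrimitiveOn (fun s => z s i)
      (fun s => c.closedLoopField (de s) (ve s) (xe s) (p s) (H₁ s) (z s) i) (t₀ - T) b) ∧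
      ∀ t ≥ t₀, Represents T t z (X t) := by
  have hT := h.pos
  have hT' : (T : ℂ) ≠ 0 := by exact_mod_cast hT.ne'
  set f : ℝ → Fin 4 → ℂ := fun s => c.closedLoopField (de s) (ve s) (xe s) (p s) (H₁ s) (x s)
    with hf
  have hfi : ∀ b ≥ t₀ - T, ∀ i, IntervalIntegrable (fun s => f s i) volume (t₀ - T) b := by
    intro b hb i
    refine h.intervalIntegrable_closedLoopField hb (fun i =>
      (hx.bounded (max b t₀) (le_max_right _ _) i).mono_measure (Measure.restrict_mono
        (Set.Ioc_subset_Icc_self.trans (Set.Icc_subset_Icc_right (le_max_left _ _))) le_rfl)) i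
  have hfw : ∀ t ≥ t₀, ∀ i, IntervalIntegrable (fun s => f s i) volume (t - T) t := fun t ht i =>
    h.intervalIntegrable_closedLoopField (by linarith) (hx.memLp_window ht) i
  have hwin : ∀ i, ∀ᵐ t, t₀ < t → ∃ C, ∀ᵐ s ∂(window T t),
      x s i - ∫ τ in (t₀ - T)..s, f τ i = C := by
    intro i
    have hder := ae_hasDerivAt_phasor hT fun b hb => hx.intervalIntegrable hT hb i
    filter_upwards [hder, ae_all_iff.2 hx.equation] with t h1 h2 ht
    -- Two expressions for the derivative of the k-th phasor: the jump over the window, and the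
    -- harmonic equation.
    have hkey : ∀ k : ℤ, (1 / (T : ℂ)) * ((x t i - x (t - T) i) *
        Complex.exp (-(Complex.I * ((2 * Real.pi / T : ℝ) : ℂ) * (k : ℂ) * (t : ℂ)))) =
        phasor T (fun s => f s i) t k -
          Complex.I * ((2 * Real.pi / T : ℝ) : ℂ) * (k : ℂ) * phasor T (fun s => x s i) t k := by
      intro k
      have h3 := (hasDerivAt_pi.1 (h2 k ht)) i
      rw [h.harmonicField_eq hd (hx.memLp_window ht.le) (hx.represents ht.le)] at h3
      refine (h1 ht k).unique (h3.congr_of_eventuallyEq ?_)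
      filter_upwards [Ioi_mem_nhds ht] with s hs
      rw [hx.phasors s (le_of_lt hs)]
      rfl
    -- Mode 0 of the preceding identity. With the jump replaced by this integral, the other modes
    -- say that x has the phasors of a primitive of f.
    have hjump : ∫ s in (t - T)..t, f s i = x t i - x (t - T) i := by
      have h3 := hkey 0
      simp only [Int.cast_zero, mul_zero, zero_mul, neg_zero, Complex.exp_zero, mul_one, sub_zero,
        phasor] at h3
      exact (mul_left_cancel₀ (one_div_ne_zero hT') h3).symm
    obtain ⟨C, hC⟩ := ae_eq_primitive_of_phasor hT ((hx.represents ht.le).1 i) (hfw t ht.le i)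
      fun k => by
        rw [hjump]
        linear_combination hkey k
    refine ⟨C - ∫ τ in (t₀ - T)..(t - T), f τ i, ?_⟩
    filter_upwards [hC, ae_restrict_mem measurableSet_Ioc] with s hs hs'
    have h3 := intervalIntegral.integral_add_adjacent_intervals (hfi (t - T) (by linarith) i)
      ((hfw t ht.le i).mono_set (Set.uIcc_subset_uIcc_left (by
        rw [Set.uIcc_of_le (by linarith)]; exact ⟨hs'.1.le, hs'.2⟩)) :
        IntervalIntegrable (fun s => f s i) volume (t - T) s)
    rw [hs, ← h3]
    ring
  choose C hC using fun i => exists_const_of_windows hT (hwin i)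
  set z : ℝ → Fin 4 → ℂ := fun s i => C i + ∫ τ in (t₀ - T)..s, f τ i with hz
  have hxz : ∀ᵐ s, t₀ - T < s → x s = z s := by
    filter_upwards [ae_all_iff.2 hC] with s hs hs'
    ext i
    simp only [hz]
    linear_combination hs i hs'
  refine ⟨z, fun b hb i => ?_, fun t ht => ?_⟩
  · refine (IsPrimitiveOn.of_integral (hfi b hb i) (C i)).congr_deriv hb ?_
    filter_upwards [hxz] with s hs hs'
    rw [hf, ← hs hs'.1]
  · refine (hx.represents ht).congr_ae hT ?_
    rw [Filter.EventuallyEq, window, ae_restrict_iff' measurableSet_Ioc]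
    filter_upwards [hxz] with s hs hs'
    exact hs (by linarith [hs'.1])

end Trajectory

/-- Existence of harmonic trajectories. -/
theorem exists_isHarmonicTrajectory (h : IsStabilizingDesign c T xe de ve Q p H₁)
    (hd : IsHarmonicDesign T xe p Xe P) (t₀ : ℝ) (x₀ : Fin 4 → ℂ) :
    ∃ (x : ℝ → Fin 4 → ℂ) (X : ℝ → EllTwo 4), ContinuousOn x (Set.Ici (t₀ - T)) ∧
      x (t₀ - T) = x₀ ∧ c.IsHarmonicTrajectory T de ve Xe P H₁ t₀ x X := by
  have hT := h.pos
  obtain ⟨x, hxc, hx0, hx⟩ := h.exists_solution (𝕜 := ℂ) (t₀ - T) x₀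
  have hxi : ∀ i, Continuous fun s => x s i := fun i => (continuous_apply i).comp hxc
  choose X hX using fun t => exists_represented (x := x) hT (t := t) fun i =>
    memLp_window_of_continuous (hxi i) t
  refine ⟨x, X, hxc.continuousOn, hx0, fun t _ i => memLp_top_Icc_of_continuous (hxi i) _ _,
    fun t _ => (hX t).2, fun k => ?_⟩
  have hder := fun i => ae_hasDerivAt_phasor hT (t₀ := t₀) fun b _ =>
    (hxi i).intervalIntegrable (t₀ - T) b
  filter_upwards [ae_all_iff.2 hder] with t h1 ht
  rw [h.harmonicField_eq hd (fun i => (memLp_top_Icc_of_continuous (hxi i) (t - T) t).mono_measure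
    (Measure.restrict_mono Set.Ioc_subset_Icc_self le_rfl)) (hX t)]
  refine hasDerivAt_pi.2 fun i => ?_
  have h2 : (fun s => coords (X s) k i) = fun s => phasor T (fun τ => x τ i) s k := by
    ext s
    rw [(hX s).2]
    rfl
  rw [h2]
  refine (h1 i ht k).congr_deriv ?_
  -- Starting the solution at t₀ − T makes it satisfy the equation on every window, including the
  -- first, so integration by parts turns the jump into the harmonic field.
  have h3 := phasor_deriv hT ((hx t (by linarith) i).mono (c := t - T) (by linarith) (by linarith)
    le_rfl) k
  change _ = phasor T _ t k - _ * phasor T (fun s => x s i) t k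
  rw [h3]
  ring

/-- Global asymptotic stability of the harmonic closed loop. -/
theorem isGloballyAsymptoticallyStable_harmonic (h : IsStabilizingDesign c T xe de ve Q p H₁)
    (hd : IsHarmonicDesign T xe p Xe P) : IsGloballyAsymptoticallyStable
      (fun t₀ X => ∃ x, c.IsHarmonicTrajectory T de ve Xe P H₁ t₀ x X) (fun _ => Xe) := by
  have hT := h.pos
  obtain ⟨K, hK, hst⟩ := h.stability (𝕜 := ℂ)
  have hnorm : ∀ {t : ℝ} {z : ℝ → Fin 4 → ℂ} {Z : EllTwo 4}, Represents T t z Z →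
      ‖Z - Xe‖ ^ 2 = (1 / T) * ∫ s in (t - T)..t, ∑ i, ‖z s i - (xe s i : ℂ)‖ ^ 2 := fun hz =>
    (hz.sub hT (h.represents_xe hd _)).norm_sq_eq hT
  have hint : ∀ {t : ℝ} {z : ℝ → Fin 4 → ℂ} {Z : EllTwo 4}, Represents T t z Z →
      IntervalIntegrable (fun s => ∑ i, ‖z s i - (xe s i : ℂ)‖ ^ 2) volume (t - T) t := fun hz =>
    (hz.sub hT (h.represents_xe hd _)).integrable_norm_sq hT
  refine ⟨fun ε hε => ⟨ε / Real.sqrt K, by positivity, ?_⟩, ?_⟩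
  · rintro t₀ X ⟨x, hx⟩ hδ t ht
    obtain ⟨z, hz, hzX⟩ := h.exists_solution_of_harmonic hd hx
    have hK' := (hst _ z hz).1
    have hle : ‖X t - Xe‖ ^ 2 ≤ K * ‖X t₀ - Xe‖ ^ 2 := by
      rw [hnorm (hzX t ht), hnorm (hzX t₀ le_rfl), mul_left_comm,
        ← intervalIntegral.integral_const_mul K]
      refine mul_le_mul_of_nonneg_left ?_ (one_div_pos.2 hT).le
      -- Each instant s of the initial window is paired with s + (t − t₀), and the pointwise bound
      -- is integrated. It is valid from t₀ − T on, where the representative starts.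
      have e : ∫ s in (t - T)..t, ∑ i, ‖z s i - (xe s i : ℂ)‖ ^ 2 =
          ∫ s in (t₀ - T)..t₀, ∑ i, ‖z (s + (t - t₀)) i - (xe (s + (t - t₀)) i : ℂ)‖ ^ 2 := by
        rw [intervalIntegral.integral_comp_add_right
          (fun s => ∑ i, ‖z s i - (xe s i : ℂ)‖ ^ 2)]
        congr 1 <;> ring
      rw [e]
      refine intervalIntegral.integral_mono_on (by linarith) ?_ ((hint (hzX t₀ le_rfl)).const_mul _)
        fun s hs => hK' s _ hs.1 (by linarith)
      have h1 := (hint (hzX t ht)).comp_add_right (t - t₀)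
      rwa [show t - T - (t - t₀) = t₀ - T by ring, show t - (t - t₀) = t₀ by ring] at h1
    rw [lt_div_iff₀ (by positivity)] at hδ
    refine lt_of_pow_lt_pow_left₀ 2 hε.le (hle.trans_lt ?_)
    have h5 : (‖X t₀ - Xe‖ * Real.sqrt K) ^ 2 < ε ^ 2 := by gcongr
    rw [mul_pow, Real.sq_sqrt hK.le] at h5
    linarith
  · rintro t₀ X ⟨x, hx⟩
    obtain ⟨z, hz, hzX⟩ := h.exists_solution_of_harmonic hd hx
    have hlim := (hst _ z hz).2
    rw [Metric.tendsto_atTop] at hlim ⊢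
    intro ε hε
    obtain ⟨N, hN⟩ := hlim (ε ^ 2 / 2) (by positivity)
    -- The delay T puts the whole window after N. The bound ε² / 2 taken there leaves room for a
    -- strict inequality after averaging.
    refine ⟨max (N + T) t₀, fun t ht => ?_⟩
    have ht1 := (le_max_left _ _).trans ht
    have ht2 := (le_max_right _ _).trans ht
    have hle : ‖X t - Xe‖ ^ 2 ≤ ε ^ 2 / 2 := by
      rw [hnorm (hzX t ht2)]
      have h1 : ∫ s in (t - T)..t, ∑ i, ‖z s i - (xe s i : ℂ)‖ ^ 2 ≤
          ∫ _s in (t - T)..t, ε ^ 2 / 2 := by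
        refine intervalIntegral.integral_mono_on (by linarith) (hint (hzX t ht2))
          intervalIntegrable_const fun s hs => ?_
        have h2 := hN s (by linarith [hs.1])
        rw [Real.dist_eq, sub_zero] at h2
        exact (le_abs_self _).trans h2.le
      rw [intervalIntegral.integral_const, smul_eq_mul, sub_sub_cancel] at h1
      calc _ ≤ 1 / T * (T * (ε ^ 2 / 2)) := mul_le_mul_of_nonneg_left h1 (by positivity)
        _ = _ := by field_simp
    rw [Real.dist_eq, sub_zero, abs_of_nonneg (norm_nonneg _)]
    refine lt_of_pow_lt_pow_left₀ 2 hε.le (hle.trans_lt ?_)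
    have : 0 < ε ^ 2 := by positivity
    linarith

end IsStabilizingDesign

end HarmonicConverter

end

/-! ### The main theorem -/

open HarmonicConverter in
theorem theorem2 (c : Converter) (T : ℝ) (hT : 0 < T)
    -- the equilibrium: periodic signals and their harmonics
    (xe : ℝ → Fin 4 → ℝ) (de : ℝ → Fin 3 → ℝ) (ve : ℝ → Fin 4 → ℝ)
    (hxe : Continuous xe) (hxeT : Function.Periodic xe T)
    (hde : ∀ i, MemLp (fun t => de t i) ⊤ volume) (hdeT : Function.Periodic de T)
    (hve : ∀ i, MemLp (fun t => ve t i) 2 (volume.restrict (Set.Icc 0 T)))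
    (hveT : Function.Periodic ve T)
    (Xe : EllTwo 4) (hXe : coords Xe = vecHarmonics T xe)
    (hequil : c.harmonicField T (coords Xe) (vecHarmonics T de) (vecHarmonics T ve) = 0)
    (hHurwitz : IsHurwitz (c.errorOperator T de))
    (Q : ℝ → Matrix (Fin 4) (Fin 4) ℝ) (hQ : IsBoundedPeriodic T Q)
    (hQpos : ∀ᵐ t, (Q t).PosDef) :
    ∃ (P : EllTwo 4 →L[ℂ] EllTwo 4) (p : ℝ → Matrix (Fin 4) (Fin 4) ℝ),
      -- `P` is the bounded solution of the harmonic Lyapunov equation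
      SolvesLyapunov (c.errorOperator T de) (matHarmonics T Q) P ∧
      (∀ P' : EllTwo 4 →L[ℂ] EllTwo 4,
        SolvesLyapunov (c.errorOperator T de) (matHarmonics T Q) P' → P' = P) ∧
      -- `P` is Hermitian and positive definite
      IsSelfAdjoint P ∧
      (∃ m > 0, ∀ X : EllTwo 4, m * ‖X‖ ^ 2 ≤ (inner ℂ X (P X)).re) ∧
      -- `P` is the Toeplitz operator of a bounded periodic gain matrix `p`
      IsBoundedPeriodic T p ∧
      (∀ X : EllTwo 4, coords (P X) = toeplitzMul (matHarmonics T p) (coords X)) ∧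
      ∀ H₁ : ℝ → Matrix (Fin 3) (Fin 3) ℝ, IsBoundedPeriodic T H₁ →
        (∀ᵐ t, (H₁ t).PosDef) →
        -- harmonic closed loop: global solutions, global asymptotic stability
        (∀ (t₀ : ℝ) (x₀ : Fin 4 → ℂ), ∃ (x : ℝ → Fin 4 → ℂ) (X : ℝ → EllTwo 4),
          ContinuousOn x (Set.Ici (t₀ - T)) ∧ x (t₀ - T) = x₀ ∧
          c.IsHarmonicTrajectory T de ve Xe P H₁ t₀ x X) ∧
        IsGloballyAsymptoticallyStable
          (fun t₀ X => ∃ x, c.IsHarmonicTrajectory T de ve Xe P H₁ t₀ x X) (fun _ => Xe) ∧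
        -- the time-domain counterpart of the harmonic feedback
        (∀ t₀ x X, c.IsHarmonicTrajectory T de ve Xe P H₁ t₀ x X → ∀ t ≥ t₀,
          c.harmonicFeedback T de Xe P H₁ (X t) =
            vecPhasor T (fun s => c.feedback (de s) (xe s) (p s) (H₁ s) (x s)) t) ∧
        -- time-domain closed loop: global solutions, global asymptotic stability
        (∀ (t₀ : ℝ) (x₀ : Fin 4 → ℝ), ∃ x : ℝ → Fin 4 → ℝ,
          x t₀ = x₀ ∧ c.IsTimeTrajectory de ve xe p H₁ t₀ x) ∧
        IsGloballyAsymptoticallyStable (c.IsTimeTrajectory de ve xe p H₁) xe := by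
  have hF := c.isBoundedPeriodic_A_add_Ad (T := T) hde hdeT
  rw [c.errorOperator_eq_floquetGraph hT hde hdeT] at hHurwitz ⊢
  obtain ⟨Φ, Z, hΦ⟩ := exists_isFundamental hF.2
  obtain ⟨p, hp⟩ := exists_isPeriodicLyapunov hT hF hΦ (hΦ.isSchur hT hF hHurwitz) hQ hQpos
  have hpb := hp.isBoundedPeriodic hT
  obtain ⟨P, hPc, hPr⟩ := exists_toeplitz_operator hT hpb
  have hP := hp.solvesLyapunov hT hF hQ hPr
  refine ⟨P, p, hP, fun P' hP' => hP.unique hT hF hΦ hHurwitz hP', hp.isSelfAdjoint hT hPr,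
    hp.coercive_operator hT hPr, hpb, hPc, fun H₁ hH hHpos => ?_⟩
  have h : IsStabilizingDesign c T xe de ve Q p H₁ :=
    ⟨hT, hxe, hxeT, hde, hdeT, hve, hveT,
      c.isPrimitiveOn_equilibrium hT hxe hxeT hde hdeT hve hveT hXe hequil, hQ, hQpos, hp, hH, hHpos⟩
  have hd : IsHarmonicDesign T xe p Xe P := ⟨hXe, hPr⟩
  exact ⟨h.exists_isHarmonicTrajectory hd, h.isGloballyAsymptoticallyStable_harmonic hd,
    fun t₀ x X hx t ht => h.harmonicFeedback_eq hd (hx.memLp_window ht) (hx.represents ht),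
    h.exists_isTimeTrajectory, h.isGloballyAsymptoticallyStable_time⟩
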